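/- **Setting.** Let $\Omega\subset\mathbb R^2$ be a bounded polygonal Lipschitz domain (open and connected) with outward unit normal $\mathbf n=(n_1,n_2)^T$, points being written $(x,y)$. Put $\partial_0\Omega=\{n_1\ne0\}$, $\partial_-\Omega=\{z\in\partial\Omega\setminus\partial_0\Omega: xn_2<0\}$, $\partial_+\Omega=\{z\in\partial\Omega\setminus\partial_0\Omega: xn_2\ge0\}$, $\partial_{-,0}\Omega=\partial_-\Omega\cup\partial_0\Omega$, and assume that $\partial_{-,0}\Omega$ has positive one-dimensional Hausdorff measure. Let $H^1_{-,0}(\Omega)=\{v\in H^1(\Omega): v|_{\partial_{-,0}\Omega}=0\}$. Let $\mathcal T$ be a triangulation of $\Omega$: a finite set of mutually disjoint open triangles $T$ whose closures cover $\overline\Omega$ exactly, with $h_T=\operatorname{diam}T$. It is shape-regular with constant $\sigma$ ($h_T\le\sigma\rho_T$, $\rho_T$ the inradius of $T$) and locally quasi-uniform with constant $q$ ($h_T\le q\,h_{T'}$ if $T,T'$ share an interface of positive length). Let $\Gamma=\bigcup_T\partial T$, $\Gamma_{\rm int}=\Gamma\setminus\partial\Omega$. $H^2(\Omega,\mathcal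 T)$ is the space of functions whose restriction to each $T$ lies in $H^2(T)$, $\nabla_{\mathcal T}$ is the element-wise gradient and, for $p\ge2$, $V_h=\{V\in H^1_{-,0}(\Omega): V|_T\in\mathbb P_p(T)\ \forall T\}$. On an interior face $e=\partial T^+\cap\partial T^-$ let $[\![w]\!]=w^+\mathbf n^++w^-\mathbf n^-$, $[w]_1=w^+n_1^++w^-n_1^-$, $\{w\}=(w^++w^-)/2$; on a boundary face $[\![w]\!]=w\mathbf n$, $[w]_1=wn_1$, $\{w\}=w$ (component-wise for vectors). Let $\tau=C_\tau p^2/\{h\}$ on $\Gamma$. Let $\alpha,\beta,\gamma\ge0$ be such that $A=\begin{pmatrix}\alpha&\beta\\\beta&\gamma\end{pmatrix}$ is non-negative definite, let $0<\epsilon<1$ be such that $B=\operatorname{diag}\big(2(1-\epsilon),\,2\beta-\tfrac{\alpha^2}{2\epsilon}\big)$ is positive definite, and let $\kappa,\lambda\ge0$. With $L_2$-inner products $(\cdot,\cdot)$ and norms $\|\cdot\|$ on $\Omega$ unless indicated, set $$s_{1,h}(w,v)=\int_{\Gamma_{\rm int}}\tfrac{|xn_2|}{2}\big(\kappa[\![w_x]\!]\cdot[\![v_x]\!]+\lambda[\![w_y]\!]\cdot[\![v_y]\!]\big)ds,$$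 $$\begin{aligned}s_h(w,v)=&-\int_{\Gamma_{\rm int}\cup\partial_-\Omega}(0,x)^T\cdot\big(\alpha[\![w_x]\!]\{v_x\}+\beta[\![w_x]\!]\{v_y\}+\beta[\![w_y]\!]\{v_x\}+\gamma[\![w_y]\!]\{v_y\}\big)ds+s_{1,h}(w,v)\\&-\int_{\Gamma_{\rm int}\cup\partial_0\Omega}\big(\{A\nabla w_x\}\cdot[\nabla v]_1+\{A\nabla v_x\}\cdot[\nabla w]_1-\tau[\nabla w]_1\cdot A[\nabla v]_1\big)ds,\end{aligned}$$ $$\mathcal B(w,v)=(w_x,v_x)+(xw_y,v)+(A\nabla_{\mathcal T}w_x,\nabla_{\mathcal T}v_x)+(\nabla_{\mathcal T}(xw_y),A\nabla v)+s_h(w,v),$$ $$|||w|||=\Big(\|\sqrt B\nabla w\|^2+\|\sqrt{xn_2}\,w\|_{\partial_+\Omega}^2+\|\sqrt{xn_2A}\,\nabla w\|_{\partial_+\Omega}^2+\|\sqrt A\nabla_{\mathcal T}w_x\|^2+\|\sqrt{\tau A}[\nabla w]_1\|^2_{\Gamma_{\rm int}\cup\partial_0\Omega}+s_{1,h}(w,w)\Big)^{1/2}.$$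 **Lemma ((Hypo)coercivity).** There is a constant $C_0>0$, depending only on $\Omega,\sigma,q$ (in particular not on $h$ or $p$), such that for every $C_\tau\ge C_0$, and all $\mathcal T$, $p$, $A$, $\epsilon$, $\kappa$, $\lambda$ as above, $|||\cdot|||$ is (well defined and) a norm on $H^1_{-,0}(\Omega)\cap H^2(\Omega,\mathcal T)$, and $$\mathcal B(w,w)\ge\tfrac12|||w|||^2\qquad\text{for all }w\in V_h.$$ -/

import Mathlib

open MeasureTheory Set Filter Topology
open scoped ContDiff Matrix RealInnerProductSpace

noncomputable section

namespace Kolmogorov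

/-- The Euclidean plane; for `z : Plane` the coordinates are `x = z 0` and `y = z 1`. -/
abbrev Plane := EuclideanSpace ℝ (Fin 2)

/-- Arc length: the one-dimensional Hausdorff measure of the plane. -/
abbrev arcLength : Measure Plane := Measure.hausdorffMeasure 1

/-! ### Sobolev spaces through weak derivatives, and traces -/

/-- The classical partial derivative in the `i`-th coordinate direction. -/
def pd (i : Fin 2) (φ : Plane → ℝ) (z : Plane) : ℝ :=
  fderiv ℝ φ z (EuclideanSpace.single i 1)

/-- Smooth test functions with compact support in `U`. -/
def IsTestFunction (U : Set Plane) (φ : Plane → ℝ) : Prop :=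
  ContDiff ℝ ∞ φ ∧ HasCompactSupport φ ∧ tsupport φ ⊆ U

/-- `f ∈ L₂(U)`. -/
def MemL2 (U : Set Plane) (f : Plane → ℝ) : Prop := MemLp f 2 (volume.restrict U)

/-- `g ∈ L₂(U)` is the weak partial derivative of `f` on `U` in the `i`-th direction. -/
def HasWeakPD (U : Set Plane) (i : Fin 2) (f g : Plane → ℝ) : Prop :=
  MemL2 U g ∧ ∀ φ, IsTestFunction U φ →
    ∫ z in U, f z * pd i φ z = - ∫ z in U, g z * φ z

/-- `f ∈ H¹(U)`. -/
def MemH1 (U : Set Plane) (f : Plane → ℝ) : Prop :=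
  MemL2 U f ∧ ∀ i, ∃ g, HasWeakPD U i f g

open Classical in
/-- The weak partial derivative on `U` (a representative; zero if there is none). -/
def wpd (U : Set Plane) (i : Fin 2) (f : Plane → ℝ) : Plane → ℝ :=
  if h : ∃ g, HasWeakPD U i f g then h.choose else 0

/-- The weak gradient on `U`. -/
def wgrad (U : Set Plane) (f : Plane → ℝ) (z : Plane) : Fin 2 → ℝ := fun i => wpd U i f z

/-- `f ∈ H²(U)`. -/
def MemH2 (U : Set Plane) (f : Plane → ℝ) : Prop :=
  MemH1 U f ∧ ∀ i, MemH1 U (wpd U i f)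

/-- `g ∈ L₂(∂U)` is the trace of `f ∈ H¹(U)`: there are functions, smooth up to the boundary,
that converge to `f` in `H¹(U)` and whose restrictions to `∂U` converge to `g` in `L₂(∂U)`. -/
def IsTrace (U : Set Plane) (f g : Plane → ℝ) : Prop :=
  MemH1 U f ∧ MemLp g 2 (arcLength.restrict (frontier U)) ∧
    ∃ v : ℕ → Plane → ℝ, (∀ n, ContDiff ℝ ∞ (v n)) ∧
      Tendsto (fun n => eLpNorm (fun z => v n z - f z) 2 (volume.restrict U)) atTop (𝓝 0) ∧
      (∀ i, Tendsto (fun n => eLpNorm (fun z => pd i (v n) z - wpd U i f z) 2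
        (volume.restrict U)) atTop (𝓝 0)) ∧
      Tendsto (fun n => eLpNorm (fun z => v n z - g z) 2 (arcLength.restrict (frontier U)))
        atTop (𝓝 0)

open Classical in
/-- The trace of `f` on `∂U` (a representative; zero if there is none). -/
def bdTrace (U : Set Plane) (f : Plane → ℝ) : Plane → ℝ :=
  if h : ∃ g, IsTrace U f g then h.choose else 0

/-! ### Polygonal domains and their boundaries -/

/-- `Ω` has a Lipschitz boundary: near every boundary point, in suitable Cartesian coordinates,
`Ω` is the region below the graph of a Lipschitz function. -/
def HasLipschitzBoundary (Ω : Set Plane) : Prop :=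
  ∀ z ∈ frontier Ω, ∃ (R : Plane ≃ₗᵢ[ℝ] Plane) (r : ℝ) (K : NNReal) (f : ℝ → ℝ),
    0 < r ∧ LipschitzWith K f ∧ ∀ y ∈ Metric.ball z r, y ∈ Ω ↔ (R y) 1 < f ((R y) 0)

/-- Bounded polygonal Lipschitz domains. -/
structure IsPolygonalDomain (Ω : Set Plane) : Prop where
  isOpen : IsOpen Ω
  isConnected : IsConnected Ω
  isBounded : Bornology.IsBounded Ω
  lipschitz : HasLipschitzBoundary Ω
  polygonal : ∃ S : Finset (Plane × Plane), frontier Ω ⊆ ⋃ s ∈ S, segment ℝ s.1 s.2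

/-- `n` is the outward unit normal at `z` to the polygonal set `U`, which near `z` is a
half-plane. -/
def IsOuterNormal (U : Set Plane) (z n : Plane) : Prop :=
  ‖n‖ = 1 ∧ ∃ r > 0, ∀ y ∈ Metric.ball z r, y ∈ U ↔ ⟪y - z, n⟫ < 0

open Classical in
/-- The outward unit normal of a polygonal set (zero at the finitely many corners). -/
def outerNormal (U : Set Plane) (z : Plane) : Plane :=
  if h : ∃ n, IsOuterNormal U z n then h.choose else 0

/-- The elliptic portion `∂₀Ω` of the boundary. -/
def bdryZero (Ω : Set Plane) : Set Plane := {z ∈ frontier Ω | outerNormal Ω z 0 ≠ 0}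

/-- The inflow boundary `∂₋Ω`. -/
def bdryMinus (Ω : Set Plane) : Set Plane :=
  {z ∈ frontier Ω \ bdryZero Ω | z 0 * outerNormal Ω z 1 < 0}

/-- The outflow boundary `∂₊Ω`, which includes the characteristic portions. -/
def bdryPlus (Ω : Set Plane) : Set Plane :=
  {z ∈ frontier Ω \ bdryZero Ω | 0 ≤ z 0 * outerNormal Ω z 1}

/-- `∂₋,₀Ω = ∂₋Ω ∪ ∂₀Ω`. -/
def bdryMinusZero (Ω : Set Plane) : Set Plane := bdryMinus Ω ∪ bdryZero Ω

/-- `f ∈ H¹₋,₀(Ω)`: `f ∈ H¹(Ω)` and the trace of `f` vanishes on `∂₋,₀Ω`. -/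
def MemH1MinusZero (Ω : Set Plane) (f : Plane → ℝ) : Prop :=
  ∃ g, IsTrace Ω f g ∧ ∀ᵐ z ∂(arcLength.restrict (bdryMinusZero Ω)), g z = 0

/-! ### Triangulations -/

/-- The open triangle with vertices `v 0`, `v 1`, `v 2`. -/
def openTriangle (v : Fin 3 → Plane) : Set Plane := interior (convexHull ℝ (range v))

/-- A triangulation of `Ω`: finitely many mutually disjoint, non-degenerate open triangles whose
closures cover the closure of `Ω` exactly. -/
structure Triangulation (Ω : Set Plane) where
  card : ℕ
  vert : Fin card → Fin 3 → Plane
  nondegenerate : ∀ k, AffineIndependent ℝ (vert k)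
  disjoint : ∀ k l, k ≠ l → Disjoint (openTriangle (vert k)) (openTriangle (vert l))
  cover : ⋃ k, closure (openTriangle (vert k)) = closure Ω

/-- The radius of the largest disc inscribed in `U`. -/
def inradius (U : Set Plane) : ℝ := sSup {r : ℝ | 0 ≤ r ∧ ∃ c, Metric.ball c r ⊆ U}

namespace Triangulation

variable {Ω : Set Plane} (𝒯 : Triangulation Ω)

/-- The `k`-th element `T`. -/
def elem (k : Fin 𝒯.card) : Set Plane := openTriangle (𝒯.vert k)

/-- The local mesh size `h_T = diam T`. -/
def meshSize (k : Fin 𝒯.card) : ℝ := Metric.diam (𝒯.elem k)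

/-- Shape regularity with constant `σ`. -/
def ShapeRegular (σ : ℝ) : Prop := ∀ k, 𝒯.meshSize k ≤ σ * inradius (𝒯.elem k)

/-- Two different elements are adjacent if they share an interface of positive length. -/
def Adjacent (k l : Fin 𝒯.card) : Prop :=
  k ≠ l ∧ 0 < arcLength (frontier (𝒯.elem k) ∩ frontier (𝒯.elem l))

/-- Local quasi-uniformity with constant `q`. -/
def LocallyQuasiUniform (q : ℝ) : Prop :=
  ∀ k l, 𝒯.Adjacent k l → 𝒯.meshSize k ≤ q * 𝒯.meshSize l

/-- The mesh skeleton `Γ`. -/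
def skeleton : Set Plane := ⋃ k, frontier (𝒯.elem k)

/-- `Γ_int = Γ \ ∂Ω`. -/
def interiorSkeleton : Set Plane := 𝒯.skeleton \ frontier Ω

open Classical in
/-- The elements whose boundary contains `z`: up to finitely many points `z`, two adjacent
elements if `z ∈ Γ_int` and one element if `z ∈ ∂Ω`. -/
def elemsAt (z : Plane) : Finset (Fin 𝒯.card) :=
  Finset.univ.filter fun k => z ∈ frontier (𝒯.elem k)

/-- The average of a family of boundary values `φ k` on `∂T_k`: on an interior face
`(φ⁺ + φ⁻) / 2`, on a boundary face `φ`. -/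
def avg (φ : Fin 𝒯.card → Plane → ℝ) (z : Plane) : ℝ :=
  (∑ k ∈ 𝒯.elemsAt z, φ k z) / (𝒯.elemsAt z).card

/-- The jump of a family of boundary values: `φ⁺ n⁺ + φ⁻ n⁻` on an interior face, `φ n` on a
boundary face. -/
def jump (φ : Fin 𝒯.card → Plane → ℝ) (z : Plane) : Plane :=
  ∑ k ∈ 𝒯.elemsAt z, φ k z • outerNormal (𝒯.elem k) z

/-- The first component jump `[φ]₁`: `φ⁺ n₁⁺ + φ⁻ n₁⁻` on an interior face, `φ n₁` on a boundary
face. -/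
def jump1 (φ : Fin 𝒯.card → Plane → ℝ) (z : Plane) : ℝ :=
  ∑ k ∈ 𝒯.elemsAt z, φ k z * outerNormal (𝒯.elem k) z 0

/-- `|x n₂|` on the skeleton (the same number from either side). -/
def absXN2 (z : Plane) : ℝ := 𝒯.avg (fun k z => |z 0 * outerNormal (𝒯.elem k) z 1|) z

/-- The penalty function `τ = C_τ p² / {h}`. -/
def penalty (Cτ : ℝ) (p : ℕ) (z : Plane) : ℝ :=
  Cτ * (p : ℝ) ^ 2 / 𝒯.avg (fun k _ => 𝒯.meshSize k) z

/-- The boundary values on `∂T` of the derivative `∂ᵢ w` computed in `T`. -/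
def bdPD (i : Fin 2) (w : Plane → ℝ) (k : Fin 𝒯.card) : Plane → ℝ :=
  bdTrace (𝒯.elem k) (wpd (𝒯.elem k) i w)

/-- The boundary values on `∂T` of the derivative `∂ⱼ wₓ` computed in `T`. -/
def bdPDx (j : Fin 2) (w : Plane → ℝ) (k : Fin 𝒯.card) : Plane → ℝ :=
  bdTrace (𝒯.elem k) (wpd (𝒯.elem k) j (wpd (𝒯.elem k) 0 w))

/-- `{∇w}`. -/
def avgGrad (w : Plane → ℝ) (z : Plane) : Fin 2 → ℝ := fun i => 𝒯.avg (𝒯.bdPD i w) z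

/-- `{∇wₓ}`. -/
def avgGradx (w : Plane → ℝ) (z : Plane) : Fin 2 → ℝ := fun j => 𝒯.avg (𝒯.bdPDx j w) z

/-- `[∇w]₁`. -/
def jump1Grad (w : Plane → ℝ) (z : Plane) : Fin 2 → ℝ := fun i => 𝒯.jump1 (𝒯.bdPD i w) z

/-- `w ∈ H²(Ω, 𝒯)`. -/
def MemBrokenH2 (w : Plane → ℝ) : Prop := ∀ k, MemH2 (𝒯.elem k) w

/-- `w ∈ V_h`: `w ∈ H¹₋,₀(Ω)` is on every element a polynomial of total degree at most `p`. -/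
def MemVh (p : ℕ) (w : Plane → ℝ) : Prop :=
  MemH1MinusZero Ω w ∧ ∀ k, ∃ P : MvPolynomial (Fin 2) ℝ, P.totalDegree ≤ p ∧
    ∀ᵐ z ∂(volume.restrict (𝒯.elem k)), w z = MvPolynomial.eval (fun i => z i) P

/-! ### The bilinear form -/

/-- The integrand of `s₁,ₕ`. -/
def s1Density (κ lam : ℝ) (w v : Plane → ℝ) (z : Plane) : ℝ :=
  𝒯.absXN2 z / 2 *
    (κ * ⟪𝒯.jump (𝒯.bdPD 0 w) z, 𝒯.jump (𝒯.bdPD 0 v) z⟫ +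
      lam * ⟪𝒯.jump (𝒯.bdPD 1 w) z, 𝒯.jump (𝒯.bdPD 1 v) z⟫)

/-- The form `s₁,ₕ`. -/
def s1 (κ lam : ℝ) (w v : Plane → ℝ) : ℝ :=
  ∫ z in 𝒯.interiorSkeleton, 𝒯.s1Density κ lam w v z ∂arcLength

/-- The stabilisation `sₕ`; the sum over `i, j` is
`α [[wₓ]]{vₓ} + β [[wₓ]]{v_y} + β [[w_y]]{vₓ} + γ [[w_y]]{v_y}`, and the inner product of a vector
with `(0, x)ᵀ` is `x` times its second component. -/
def sh (A : Matrix (Fin 2) (Fin 2) ℝ) (κ lam : ℝ) (τ : Plane → ℝ) (w v : Plane → ℝ) : ℝ :=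
  - (∫ z in 𝒯.interiorSkeleton ∪ bdryMinus Ω,
      z 0 * (∑ i, ∑ j, (A i j * 𝒯.avg (𝒯.bdPD j v) z) • 𝒯.jump (𝒯.bdPD i w) z) 1 ∂arcLength)
    + 𝒯.s1 κ lam w v
    - ∫ z in 𝒯.interiorSkeleton ∪ bdryZero Ω,
      ((A *ᵥ 𝒯.avgGradx w z) ⬝ᵥ 𝒯.jump1Grad v z
        + (A *ᵥ 𝒯.avgGradx v z) ⬝ᵥ 𝒯.jump1Grad w z
        - τ z * (𝒯.jump1Grad w z ⬝ᵥ (A *ᵥ 𝒯.jump1Grad v z))) ∂arcLength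

/-- The bilinear form `𝓑(w, v) = (wₓ, vₓ) + (x w_y, v) + (A∇wₓ, ∇vₓ) + (∇(x w_y), A∇v) + sₕ(w, v)`,
with element-wise gradients in the third and fourth terms. -/
def bilin (A : Matrix (Fin 2) (Fin 2) ℝ) (κ lam : ℝ) (τ : Plane → ℝ) (w v : Plane → ℝ) : ℝ :=
  (∫ z in Ω, wpd Ω 0 w z * wpd Ω 0 v z)
    + (∫ z in Ω, z 0 * wpd Ω 1 w z * v z)
    + (∑ k, ∫ z in 𝒯.elem k,
        (A *ᵥ wgrad (𝒯.elem k) (wpd (𝒯.elem k) 0 w) z) ⬝ᵥ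
          wgrad (𝒯.elem k) (wpd (𝒯.elem k) 0 v) z)
    + (∑ k, ∫ z in 𝒯.elem k,
        wgrad (𝒯.elem k) (fun y => y 0 * wpd (𝒯.elem k) 1 w y) z ⬝ᵥ
          (A *ᵥ wgrad (𝒯.elem k) v z))
    + 𝒯.sh A κ lam τ w v

/-! ### The mesh-dependent norm

For a non-negative definite matrix `M` the quantity `|√M ξ|²` is written `ξ ⬝ᵥ (M *ᵥ ξ)`. -/

/-- The integrand of `‖√B ∇w‖²` on `Ω`. -/
def gradDensity (_ : Triangulation Ω) (B : Matrix (Fin 2) (Fin 2) ℝ) (w : Plane → ℝ)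
    (z : Plane) : ℝ :=
  wgrad Ω w z ⬝ᵥ (B *ᵥ wgrad Ω w z)

/-- The integrand of `‖√(x n₂) w‖²` on `∂₊Ω`. -/
def outDensity (_ : Triangulation Ω) (w : Plane → ℝ) (z : Plane) : ℝ :=
  z 0 * outerNormal Ω z 1 * bdTrace Ω w z ^ 2

/-- The integrand of `‖√(x n₂ A) ∇w‖²` on `∂₊Ω`. -/
def outGradDensity (A : Matrix (Fin 2) (Fin 2) ℝ) (w : Plane → ℝ) (z : Plane) : ℝ :=
  z 0 * outerNormal Ω z 1 * (𝒯.avgGrad w z ⬝ᵥ (A *ᵥ 𝒯.avgGrad w z))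

/-- The integrand of `‖√A ∇wₓ‖²` on the element `T`. -/
def secondDensity (A : Matrix (Fin 2) (Fin 2) ℝ) (w : Plane → ℝ) (k : Fin 𝒯.card)
    (z : Plane) : ℝ :=
  wgrad (𝒯.elem k) (wpd (𝒯.elem k) 0 w) z ⬝ᵥ
    (A *ᵥ wgrad (𝒯.elem k) (wpd (𝒯.elem k) 0 w) z)

/-- The integrand of `‖√(τ A) [∇w]₁‖²` on `Γ_int ∪ ∂₀Ω`. -/
def jumpDensity (A : Matrix (Fin 2) (Fin 2) ℝ) (τ : Plane → ℝ) (w : Plane → ℝ)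
    (z : Plane) : ℝ :=
  τ z * (𝒯.jump1Grad w z ⬝ᵥ (A *ᵥ 𝒯.jump1Grad w z))

/-- All traces and integrals that enter the mesh-dependent norm of `w` exist. -/
def TNormWellDefined (A B : Matrix (Fin 2) (Fin 2) ℝ) (κ lam : ℝ) (τ : Plane → ℝ)
    (w : Plane → ℝ) : Prop :=
  (∃ g, IsTrace Ω w g) ∧
  (∀ k i, ∃ g, IsTrace (𝒯.elem k) (wpd (𝒯.elem k) i w) g) ∧
  IntegrableOn (𝒯.gradDensity B w) Ω ∧
  IntegrableOn (𝒯.outDensity w) (bdryPlus Ω) arcLength ∧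
  IntegrableOn (𝒯.outGradDensity A w) (bdryPlus Ω) arcLength ∧
  (∀ k, IntegrableOn (𝒯.secondDensity A w k) (𝒯.elem k)) ∧
  IntegrableOn (𝒯.jumpDensity A τ w) (𝒯.interiorSkeleton ∪ bdryZero Ω) arcLength ∧
  IntegrableOn (𝒯.s1Density κ lam w w) 𝒯.interiorSkeleton arcLength

/-- The square of the mesh-dependent norm. -/
def tnormSq (A B : Matrix (Fin 2) (Fin 2) ℝ) (κ lam : ℝ) (τ : Plane → ℝ) (w : Plane → ℝ) : ℝ :=
  (∫ z in Ω, 𝒯.gradDensity B w z)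
    + (∫ z in bdryPlus Ω, 𝒯.outDensity w z ∂arcLength)
    + (∫ z in bdryPlus Ω, 𝒯.outGradDensity A w z ∂arcLength)
    + (∑ k, ∫ z in 𝒯.elem k, 𝒯.secondDensity A w k z)
    + (∫ z in 𝒯.interiorSkeleton ∪ bdryZero Ω, 𝒯.jumpDensity A τ w z ∂arcLength)
    + 𝒯.s1 κ lam w w

/-- The mesh-dependent norm. -/
def tnorm (A B : Matrix (Fin 2) (Fin 2) ℝ) (κ lam : ℝ) (τ : Plane → ℝ) (w : Plane → ℝ) : ℝ :=
  √(𝒯.tnormSq A B κ lam τ w)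

end Triangulation

/-- The matrix `A`. -/
def matA (α β γ : ℝ) : Matrix (Fin 2) (Fin 2) ℝ := !![α, β; β, γ]

/-- The diagonal matrix `B = diag(2(1 - ε), 2β - α²/(2ε))`. -/
def matB (α β ε : ℝ) : Matrix (Fin 2) (Fin 2) ℝ :=
  Matrix.diagonal ![2 * (1 - ε), 2 * β - α ^ 2 / (2 * ε)]

end Kolmogorov

end

open Kolmogorov

noncomputable section

namespace Kolmogorov

/-! ### Weak derivatives -/

/-! Coercivity is an energy identity for the form tested with `w` itself, closed by Young's
inequality and an inverse trace estimate. Let `w` be the polynomial `f k` on the element `k`. Since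
∂ₓ(x w_y) = w_y + x w_xy, twice the sum x w_y w + ∇(x w_y)·A∇w equals the y-derivative of the flux
x(w² + ∇w·A∇w) plus 2(α wₓ w_y + β w_y²); this is `pd_flux`. The commutator w_y supplies the control
of w_y that the equation itself does not show. Together with wₓ² and the bound α wₓ w_y ≥ -ε wₓ² -
α² w_y²/(4ε) it produces half of ∇w·B∇w. In `le_volume_terms` this is integrated: the flux becomes a
boundary integral by the divergence theorem, and one half of the term A∇wₓ·∇wₓ stays in reserve.

The fluxes meet the stabilisation pointwise on the skeleton, in `density_nonneg`. On interior faces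
`w` is continuous, and the product rule for jumps and averages makes half the sum of the two fluxes
equal to the first integrand of the stabilisation. On ∂₊Ω half the flux is half the outflow part of
the norm. On ∂₋Ω, where `w` vanishes, half the flux minus the stabilisation is -x n₂ ∇w·A∇w/2 ≥ 0.
On ∂₀Ω `w` vanishes as well but x n₂ has no sign; there [∇w]₁ = n₁∇w with |n₁| bounded below, so a
quarter of the penalty absorbs the flux once the penalty parameter is large for Ω
(`exists_le_penalty_mul`). The cross terms {A∇wₓ}·[∇w]₁ are split by Young into another quarter of
the penalty and (4/τ){∇wₓ}·A{∇wₓ}, which `IsPiecewise.integral_absorbedDensity_le` moves into the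
reserve.

That last move needs a trace inequality for polynomials with factor p² and a constant depending on
shape regularity alone, `polynomial_trace_inequality`. It comes from one dimension: on polynomials
of degree at most n, evaluation at an end point of (0, 1) is represented in L₂ by a kernel whose
value at that point is (n+1)². The bound is applied along the segments from an edge to the opposite
vertex.

For the norm property, the square of the norm is a sum of integrals of squared seminorms of
quantities linear in `w`, which `IsSqSeminorm` handles uniformly. The traces involved exist because
smooth functions are dense in H¹ of a convex set and satisfy a trace inequality on triangles. If the
norm vanishes, positive definiteness of B makes the weak gradient vanish, so `w` is constant on the
connected set Ω, and its zero trace on a set of positive length makes the constant zero.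

All boundary statements hold almost everywhere for arc length, so the finitely many vertices can be
discarded. Off them `exists_elemsAt_eq_pair` and `exists_elemsAt_eq_singleton` give the expected
picture of two elements, or one, at each point of the skeleton. -/

lemma pd_eq_zero_of_notMem_tsupport {i : Fin 2} {φ : Plane → ℝ} {z : Plane}
    (hz : z ∉ tsupport φ) : pd i φ z = 0 := by
  have : z ∉ tsupport (fderiv ℝ φ) := fun h => hz (tsupport_fderiv_subset ℝ h)
  simp [pd, image_eq_zero_of_notMem_tsupport this]

lemma continuous_pd {i : Fin 2} {φ : Plane → ℝ} (h : ContDiff ℝ ∞ φ) : Continuous (pd i φ) :=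
  (h.continuous_fderiv (by simp)).clm_apply continuous_const

lemma contDiff_pd {i : Fin 2} {φ : Plane → ℝ} (h : ContDiff ℝ ∞ φ) : ContDiff ℝ ∞ (pd i φ) :=
  (h.fderiv_right (m := ∞) (by simp)).clm_apply contDiff_const

lemma hasCompactSupport_pd {i : Fin 2} {φ : Plane → ℝ} (h : HasCompactSupport φ) :
    HasCompactSupport (pd i φ) :=
  h.mono' fun z hz => by
    by_contra hc
    exact hz (pd_eq_zero_of_notMem_tsupport hc)

lemma IsTestFunction.mono {U V : Set Plane} {φ : Plane → ℝ} (h : IsTestFunction U φ)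
    (hUV : U ⊆ V) : IsTestFunction V φ := ⟨h.1, h.2.1, h.2.2.trans hUV⟩

lemma IsTestFunction.setIntegral_mul_pd {U : Set Plane} {φ : Plane → ℝ} (h : IsTestFunction U φ)
    (f : Plane → ℝ) (i : Fin 2) : ∫ z in U, f z * pd i φ z = ∫ z, f z * pd i φ z :=
  setIntegral_eq_integral_of_forall_compl_eq_zero fun z hz => by
    rw [pd_eq_zero_of_notMem_tsupport fun hc => hz (h.2.2 hc), mul_zero]

lemma IsTestFunction.setIntegral_mul {U : Set Plane} {φ : Plane → ℝ} (h : IsTestFunction U φ)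
    (f : Plane → ℝ) : ∫ z in U, f z * φ z = ∫ z, f z * φ z :=
  setIntegral_eq_integral_of_forall_compl_eq_zero fun z hz => by
    rw [image_eq_zero_of_notMem_tsupport fun hc => hz (h.2.2 hc), mul_zero]

lemma memL2_of_continuous_compactSupport {U : Set Plane} {φ : Plane → ℝ} (h : Continuous φ)
    (hc : HasCompactSupport φ) : MemL2 U φ :=
  (h.memLp_of_hasCompactSupport hc).restrict U

lemma IsTestFunction.memL2 {U V : Set Plane} {φ : Plane → ℝ} (h : IsTestFunction U φ) :
    MemL2 V φ := memL2_of_continuous_compactSupport h.1.continuous h.2.1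

lemma IsTestFunction.memL2_pd {U V : Set Plane} {φ : Plane → ℝ} (h : IsTestFunction U φ)
    (i : Fin 2) : MemL2 V (pd i φ) :=
  memL2_of_continuous_compactSupport (continuous_pd h.1) (hasCompactSupport_pd h.2.1)

lemma MemL2.mono {U V : Set Plane} {f : Plane → ℝ} (h : MemL2 V f) (hUV : U ⊆ V) : MemL2 U f :=
  MemLp.mono_measure (Measure.restrict_mono hUV le_rfl) h

lemma MemL2.congr {U : Set Plane} {f f' : Plane → ℝ} (h : MemL2 U f)
    (hff : f =ᵐ[volume.restrict U] f') : MemL2 U f' := (memLp_congr_ae hff).1 h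

lemma MemL2.lincomb {U : Set Plane} {f f' : Plane → ℝ} (h : MemL2 U f) (h' : MemL2 U f')
    (a b : ℝ) : MemL2 U (fun z => a * f z + b * f' z) :=
  (MemLp.const_mul h a).add (MemLp.const_mul h' b)

/-- The fundamental lemma of the calculus of variations applied to the difference. This is what
makes the representative chosen by `wpd` immaterial, so that every later identity between weak
derivatives can be read almost everywhere. -/
lemma HasWeakPD.unique {U : Set Plane} (hU : IsOpen U) {i : Fin 2} {f g g' : Plane → ℝ}
    (h : HasWeakPD U i f g) (h' : HasWeakPD U i f g') : g =ᵐ[volume.restrict U] g' := by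
  have hd : MemL2 U (fun z => g z - g' z) := MemLp.sub h.1 h'.1
  have hloc : LocallyIntegrableOn (fun z => g z - g' z) U volume := by
    rw [locallyIntegrableOn_iff hU.isLocallyClosed]
    intro K hKU hK
    have : MemLp (fun z => g z - g' z) 2 (volume.restrict K) := hd.mono hKU
    have : IsFiniteMeasure (volume.restrict K) := ⟨by simpa using hK.measure_lt_top⟩
    exact MemLp.integrable (q := 2) (by norm_num) (hd.mono hKU)
  have := hU.ae_eq_zero_of_integral_contDiff_smul_eq_zero hloc (fun φ h1 h2 h3 => by
    have hφ : IsTestFunction U φ := ⟨h1, h2, h3⟩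
    have e1 := h.2 φ hφ
    have e2 := h'.2 φ hφ
    have e3 : ∫ z in U, g z * φ z = ∫ z in U, g' z * φ z := by linarith
    have e4 : ∫ z in U, (g z - g' z) * φ z = 0 := by
      have i1 : Integrable (fun z => g z * φ z) (volume.restrict U) :=
        MemLp.integrable_mul h.1 hφ.memL2
      have i2 : Integrable (fun z => g' z * φ z) (volume.restrict U) :=
        MemLp.integrable_mul h'.1 hφ.memL2
      simp only [sub_mul]
      rw [integral_sub i1 i2, e3, sub_self]
    rw [hφ.setIntegral_mul] at e4
    rw [← e4]
    exact integral_congr_ae (ae_of_all _ fun z => by simp [mul_comm]))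
  rw [Filter.EventuallyEq, ae_restrict_iff' hU.measurableSet]
  filter_upwards [this] with z hz hzU
  linarith [hz hzU]

lemma HasWeakPD.congr_left {U : Set Plane} {i : Fin 2} {f f' g : Plane → ℝ}
    (h : HasWeakPD U i f g) (hff : f =ᵐ[volume.restrict U] f') : HasWeakPD U i f' g := by
  refine ⟨h.1, fun φ hφ => ?_⟩
  rw [← h.2 φ hφ]
  refine integral_congr_ae ?_
  filter_upwards [hff] with z hz
  rw [hz]

lemma HasWeakPD.congr_right {U : Set Plane} {i : Fin 2} {f g g' : Plane → ℝ}
    (h : HasWeakPD U i f g) (hgg : g =ᵐ[volume.restrict U] g') : HasWeakPD U i f g' := by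
  refine ⟨h.1.congr hgg, fun φ hφ => ?_⟩
  rw [h.2 φ hφ]
  congr 1
  refine integral_congr_ae ?_
  filter_upwards [hgg] with z hz
  rw [hz]

/-- A test function on the smaller set is one on the larger, and all integrals involved are
integrals over the plane. This links derivatives on Ω with element-wise derivatives. -/
lemma HasWeakPD.mono {U V : Set Plane} {i : Fin 2} {f g : Plane → ℝ}
    (h : HasWeakPD V i f g) (hUV : U ⊆ V) : HasWeakPD U i f g := by
  refine ⟨h.1.mono hUV, fun φ hφ => ?_⟩
  have := h.2 φ (hφ.mono hUV)
  rw [(hφ.mono hUV).setIntegral_mul_pd, (hφ.mono hUV).setIntegral_mul] at this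
  rw [hφ.setIntegral_mul_pd, hφ.setIntegral_mul, this]

lemma HasWeakPD.lincomb {U : Set Plane} {i : Fin 2} {f g f' g' : Plane → ℝ}
    (hf : MemL2 U f) (hf' : MemL2 U f')
    (h : HasWeakPD U i f g) (h' : HasWeakPD U i f' g') (a b : ℝ) :
    HasWeakPD U i (fun z => a * f z + b * f' z) (fun z => a * g z + b * g' z) := by
  refine ⟨h.1.lincomb h'.1 a b, fun φ hφ => ?_⟩
  simp only [add_mul, mul_assoc]
  have i1 := (MemLp.integrable_mul hf (hφ.memL2_pd i)).const_mul a
  have i2 := (MemLp.integrable_mul hf' (hφ.memL2_pd i)).const_mul b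
  have i3 := (MemLp.integrable_mul h.1 hφ.memL2).const_mul a
  have i4 := (MemLp.integrable_mul h'.1 hφ.memL2).const_mul b
  simp only [Pi.mul_apply] at i1 i2 i3 i4
  rw [integral_add i1 i2, integral_add i3 i4, integral_const_mul, integral_const_mul,
    integral_const_mul, integral_const_mul, h.2 φ hφ, h'.2 φ hφ]
  ring

lemma hasWeakPD_of_contDiff {U : Set Plane} {i : Fin 2} {f : Plane → ℝ} (hf : ContDiff ℝ ∞ f)
    (h2 : MemL2 U (pd i f)) : HasWeakPD U i f (pd i f) := by
  refine ⟨h2, fun φ hφ => ?_⟩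
  rw [hφ.setIntegral_mul_pd, hφ.setIntegral_mul]
  refine integral_mul_fderiv_eq_neg_fderiv_mul_of_integrable ?_ ?_ ?_
    (fun z _ => (hf.differentiable (by simp)) z) (fun z _ => (hφ.1.differentiable (by simp)) z)
  · exact ((continuous_pd hf).mul hφ.1.continuous).integrable_of_hasCompactSupport
      (hφ.2.1.mul_left)
  · exact (hf.continuous.mul (continuous_pd hφ.1)).integrable_of_hasCompactSupport
      ((hasCompactSupport_pd hφ.2.1).mul_left)
  · exact (hf.continuous.mul hφ.1.continuous).integrable_of_hasCompactSupport
      (hφ.2.1.mul_left)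

lemma memLp_of_continuous_of_isBounded {μ : Measure Plane} {U : Set Plane} {p : ENNReal}
    (hU : Bornology.IsBounded U) (hfin : μ U < ⊤)
    (hm : MeasurableSet U) {f : Plane → ℝ} (hf : Continuous f) : MemLp f p (μ.restrict U) := by
  have : IsFiniteMeasure (μ.restrict U) := ⟨by simpa using hfin⟩
  obtain ⟨C, hC⟩ := hU.isCompact_closure.exists_bound_of_continuousOn hf.continuousOn
  refine MemLp.of_bound hf.aestronglyMeasurable C ?_
  rw [ae_restrict_iff' hm]
  exact ae_of_all _ fun z hz => hC z (subset_closure hz)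

lemma memL2_of_continuous {U : Set Plane} (hU : IsOpen U) (hb : Bornology.IsBounded U)
    {f : Plane → ℝ} (hf : Continuous f) : MemL2 U f :=
  memLp_of_continuous_of_isBounded hb hb.measure_lt_top hU.measurableSet hf

lemma hasWeakPD_wpd {U : Set Plane} {i : Fin 2} {f : Plane → ℝ} (h : ∃ g, HasWeakPD U i f g) :
    HasWeakPD U i f (wpd U i f) := by
  rw [wpd, dif_pos h]
  exact h.choose_spec

lemma HasWeakPD.wpd_ae_eq {U : Set Plane} (hU : IsOpen U) {i : Fin 2} {f g : Plane → ℝ}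
    (h : HasWeakPD U i f g) : wpd U i f =ᵐ[volume.restrict U] g :=
  (hasWeakPD_wpd ⟨g, h⟩).unique hU h

lemma MemH1.hasWeakPD {U : Set Plane} {f : Plane → ℝ} (h : MemH1 U f) (i : Fin 2) :
    HasWeakPD U i f (wpd U i f) := hasWeakPD_wpd (h.2 i)

lemma MemH1.memL2_wpd {U : Set Plane} {f : Plane → ℝ} (h : MemH1 U f) (i : Fin 2) :
    MemL2 U (wpd U i f) := (h.hasWeakPD i).1

lemma MemH1.congr {U : Set Plane} {f f' : Plane → ℝ} (h : MemH1 U f)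
    (hff : f =ᵐ[volume.restrict U] f') : MemH1 U f' :=
  ⟨h.1.congr hff, fun i => ⟨_, (h.hasWeakPD i).congr_left hff⟩⟩

lemma MemH1.lincomb {U : Set Plane} {f f' : Plane → ℝ} (h : MemH1 U f) (h' : MemH1 U f')
    (a b : ℝ) : MemH1 U (fun z => a * f z + b * f' z) :=
  ⟨h.1.lincomb h'.1 a b, fun i => ⟨_, (h.hasWeakPD i).lincomb h.1 h'.1 (h'.hasWeakPD i) a b⟩⟩

lemma MemH1.wpd_congr {U : Set Plane} (hU : IsOpen U) {f f' : Plane → ℝ} (h : MemH1 U f)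
    (hff : f =ᵐ[volume.restrict U] f') (i : Fin 2) :
    wpd U i f' =ᵐ[volume.restrict U] wpd U i f :=
  ((h.hasWeakPD i).congr_left hff).wpd_ae_eq hU

lemma MemH1.wpd_lincomb {U : Set Plane} (hU : IsOpen U) {f f' : Plane → ℝ} (h : MemH1 U f)
    (h' : MemH1 U f') (a b : ℝ) (i : Fin 2) :
    wpd U i (fun z => a * f z + b * f' z) =ᵐ[volume.restrict U]
      fun z => a * wpd U i f z + b * wpd U i f' z :=
  ((h.hasWeakPD i).lincomb h.1 h'.1 (h'.hasWeakPD i) a b).wpd_ae_eq hU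

lemma MemH1.wpd_mono {U V : Set Plane} (hU : IsOpen U) {f : Plane → ℝ} (h : MemH1 V f)
    (hUV : U ⊆ V) (i : Fin 2) : wpd U i f =ᵐ[volume.restrict U] wpd V i f :=
  ((h.hasWeakPD i).mono hUV).wpd_ae_eq hU

lemma MemH2.congr {U : Set Plane} (hU : IsOpen U) {f f' : Plane → ℝ} (h : MemH2 U f)
    (hff : f =ᵐ[volume.restrict U] f') : MemH2 U f' :=
  ⟨h.1.congr hff, fun i => (h.2 i).congr (h.1.wpd_congr hU hff i).symm⟩

lemma MemH2.lincomb {U : Set Plane} (hU : IsOpen U) {f f' : Plane → ℝ} (h : MemH2 U f)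
    (h' : MemH2 U f') (a b : ℝ) : MemH2 U (fun z => a * f z + b * f' z) :=
  ⟨h.1.lincomb h'.1 a b, fun i =>
    ((h.2 i).lincomb (h'.2 i) a b).congr (h.1.wpd_lincomb hU h'.1 a b i).symm⟩

lemma memH1_of_contDiff {U : Set Plane} (hU : IsOpen U) (hb : Bornology.IsBounded U)
    {f : Plane → ℝ} (hf : ContDiff ℝ ∞ f) : MemH1 U f :=
  ⟨memL2_of_continuous hU hb hf.continuous, fun _ => ⟨_, hasWeakPD_of_contDiff hf
    (memL2_of_continuous hU hb (continuous_pd hf))⟩⟩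

lemma wpd_of_contDiff {U : Set Plane} (hU : IsOpen U) (hb : Bornology.IsBounded U)
    {f : Plane → ℝ} (hf : ContDiff ℝ ∞ f) (i : Fin 2) :
    wpd U i f =ᵐ[volume.restrict U] pd i f :=
  (hasWeakPD_of_contDiff hf (memL2_of_continuous hU hb (continuous_pd hf))).wpd_ae_eq hU

/-! ### Triangles -/

/-- The determinant of two vectors of the plane. -/
def cross (a b : Plane) : ℝ := a 0 * b 1 - a 1 * b 0

/-- Twice the signed area of a triangle. -/
def triDet (v : Fin 3 → Plane) : ℝ := cross (v 1 - v 0) (v 2 - v 0)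

/-- Barycentric coordinates with respect to a triangle. -/
def bary (v : Fin 3 → Plane) (i : Fin 3) (z : Plane) : ℝ :=
  cross (v (i + 1) - z) (v (i + 2) - z) / triDet v

/-- The gradient of a barycentric coordinate. -/
def baryGrad (v : Fin 3 → Plane) (i : Fin 3) : Plane :=
  !₂[(v (i + 1) 1 - v (i + 2) 1) / triDet v, (v (i + 2) 0 - v (i + 1) 0) / triDet v]

lemma inner_plane (a b : Plane) : ⟪a, b⟫ = a 0 * b 0 + a 1 * b 1 := by
  simp [PiLp.inner_apply, Fin.sum_univ_two, mul_comm]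

/-- Barycentric coordinates are affine. The normals of the edges, the divergence theorem and the
inradius bound all rest on this increment formula. -/
lemma bary_sub (v : Fin 3 → Plane) (i : Fin 3) (y z : Plane) :
    bary v i y - bary v i z = ⟪y - z, baryGrad v i⟫ := by
  simp only [bary, baryGrad, inner_plane, cross, PiLp.sub_apply, Matrix.cons_val_zero,
    Matrix.cons_val_one]
  ring

lemma triDet_ne_zero {v : Fin 3 → Plane} (hv : AffineIndependent ℝ v) : triDet v ≠ 0 := by
  intro h0
  rw [affineIndependent_iff_not_collinear] at hv
  apply hv
  rw [collinear_iff_of_mem (p₀ := v 0) (mem_range_self 0)]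
  simp only [triDet, cross, PiLp.sub_apply] at h0
  by_cases ha : v 1 = v 0
  · refine ⟨v 2 - v 0, ?_⟩
    rintro _ ⟨i, rfl⟩
    fin_cases i
    · exact ⟨0, by simp⟩
    · exact ⟨0, by simp [ha]⟩
    · exact ⟨1, by simp⟩
  · refine ⟨v 1 - v 0, ?_⟩
    have hn : ⟪v 1 - v 0, v 1 - v 0⟫ ≠ 0 := fun h => ha (sub_eq_zero.1 (inner_self_eq_zero.1 h))
    rintro _ ⟨i, rfl⟩
    fin_cases i
    · exact ⟨0, by simp⟩
    · exact ⟨1, by simp⟩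
    -- With vanishing determinant the third vertex equals its orthogonal projection onto the line
    -- through the first two, which gives this coefficient.
    · refine ⟨⟪v 2 - v 0, v 1 - v 0⟫ / ⟪v 1 - v 0, v 1 - v 0⟫, ?_⟩
      simp only [inner_plane, PiLp.sub_apply] at hn ⊢
      ext j
      fin_cases j
      · simp only [Fin.reduceFinMk, Fin.zero_eta, vadd_eq_add, PiLp.add_apply, PiLp.smul_apply,
          PiLp.sub_apply, smul_eq_mul]
        rw [← sub_eq_iff_eq_add, div_mul_eq_mul_div, eq_div_iff hn]
        linear_combination -(v 1 1 - v 0 1) * h0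
      · simp only [Fin.reduceFinMk, Fin.mk_one, vadd_eq_add, PiLp.add_apply, PiLp.smul_apply,
          PiLp.sub_apply, smul_eq_mul]
        rw [← sub_eq_iff_eq_add, div_mul_eq_mul_div, eq_div_iff hn]
        linear_combination (v 1 0 - v 0 0) * h0

lemma sum_bary {v : Fin 3 → Plane} (hv : triDet v ≠ 0) (z : Plane) : ∑ i, bary v i z = 1 := by
  simp only [bary, ← Finset.sum_div]
  rw [div_eq_one_iff_eq hv]
  simp only [Fin.sum_univ_three, cross, triDet, PiLp.sub_apply, Fin.reduceAdd]
  ring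

lemma sum_bary_smul {v : Fin 3 → Plane} (hv : triDet v ≠ 0) (z : Plane) :
    ∑ i, bary v i z • v i = z := by
  ext j
  simp only [bary, Fin.sum_univ_three, PiLp.add_apply, PiLp.smul_apply, smul_eq_mul]
  field_simp
  simp only [cross, triDet, PiLp.sub_apply, Fin.reduceAdd]
  fin_cases j
  · simp only [Fin.zero_eta]; ring
  · simp only [Fin.mk_one]; ring

lemma bary_vert {v : Fin 3 → Plane} (hv : triDet v ≠ 0) (i j : Fin 3) :
    bary v i (v j) = if i = j then 1 else 0 := by
  rw [bary, div_eq_iff hv]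
  simp only [cross, triDet, PiLp.sub_apply]
  fin_cases i <;> fin_cases j <;> simp [Fin.reduceAdd] <;> ring

lemma continuous_bary (v : Fin 3 → Plane) (i : Fin 3) : Continuous (bary v i) := by
  unfold bary cross
  fun_prop

/-- The affine basis formed by the vertices of a triangle. -/
def triBasis (v : Fin 3 → Plane) (hv : AffineIndependent ℝ v) : AffineBasis (Fin 3) ℝ Plane :=
  ⟨v, hv, by rw [hv.affineSpan_eq_top_iff_card_eq_finrank_add_one]; simp⟩

/-- Identifies the explicit determinant quotient with the coordinates of an `AffineBasis`, so that
the known descriptions of a simplex and of its interior become sign conditions on `bary`. -/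
lemma triBasis_coord {v : Fin 3 → Plane} (hv : AffineIndependent ℝ v) (i : Fin 3) (z : Plane) :
    (triBasis v hv).coord i z = bary v i z := by
  have hD := triDet_ne_zero hv
  have h1 := sum_bary hD z
  have := (triBasis v hv).coord_apply_combination_of_mem (Finset.mem_univ i)
    (w := fun i => bary v i z) h1
  rwa [Finset.affineCombination_eq_linear_combination _ _ _ h1,
    show (∑ i, bary v i z • (triBasis v hv) i) = z from sum_bary_smul hD z] at this

lemma openTriangle_eq {v : Fin 3 → Plane} (hv : AffineIndependent ℝ v) :
    openTriangle v = {z | ∀ i, 0 < bary v i z} := by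
  have := (triBasis v hv).interior_convexHull
  simp only [triBasis_coord] at this
  exact this

lemma convexHull_range_eq {v : Fin 3 → Plane} (hv : AffineIndependent ℝ v) :
    convexHull ℝ (range v) = {z | ∀ i, 0 ≤ bary v i z} := by
  have := (triBasis v hv).convexHull_eq_nonneg_coord
  simp only [triBasis_coord] at this
  exact this

lemma isOpen_openTriangle (v : Fin 3 → Plane) : IsOpen (openTriangle v) := isOpen_interior

lemma convex_openTriangle (v : Fin 3 → Plane) : Convex ℝ (openTriangle v) :=
  (convex_convexHull ℝ _).interior

lemma isCompact_convexHull_range (v : Fin 3 → Plane) : IsCompact (convexHull ℝ (range v)) :=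
  Set.Finite.isCompact_convexHull (𝕜 := ℝ) (finite_range v)

lemma openTriangle_nonempty {v : Fin 3 → Plane} (hv : AffineIndependent ℝ v) :
    (openTriangle v).Nonempty :=
  ⟨Finset.univ.centroid ℝ (triBasis v hv), (triBasis v hv).centroid_mem_interior_convexHull⟩

lemma closure_openTriangle {v : Fin 3 → Plane} (hv : AffineIndependent ℝ v) :
    closure (openTriangle v) = {z | ∀ i, 0 ≤ bary v i z} := by
  rw [openTriangle, (convex_convexHull ℝ _).closure_interior_eq_closure_of_nonempty_interior
    (openTriangle_nonempty hv), (isCompact_convexHull_range v).isClosed.closure_eq,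
    convexHull_range_eq hv]

lemma isBounded_openTriangle (v : Fin 3 → Plane) : Bornology.IsBounded (openTriangle v) :=
  (isCompact_convexHull_range v).isBounded.subset interior_subset

lemma frontier_openTriangle {v : Fin 3 → Plane} (hv : AffineIndependent ℝ v) :
    frontier (openTriangle v) = {z | (∀ i, 0 ≤ bary v i z) ∧ ∃ i, bary v i z = 0} := by
  rw [(isOpen_openTriangle v).frontier_eq, closure_openTriangle hv, openTriangle_eq hv]
  ext z
  simp only [Set.mem_sdiff, mem_ofPred_eq, not_forall, not_lt]
  constructor
  · rintro ⟨h, i, hi⟩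
    exact ⟨h, i, le_antisymm hi (h i)⟩
  · rintro ⟨h, i, hi⟩
    exact ⟨h, i, hi.le⟩

/-- The `i`-th edge of a triangle, opposite to the `i`-th vertex. -/
def triEdge (v : Fin 3 → Plane) (i : Fin 3) : Set Plane := segment ℝ (v (i + 1)) (v (i + 2))

/-- The `i`-th edge of a triangle without its end points. -/
def openEdge (v : Fin 3 → Plane) (i : Fin 3) : Set Plane :=
  {z | bary v i z = 0 ∧ ∀ j, j ≠ i → 0 < bary v j z}

lemma sum_fin_three_shift (f : Fin 3 → ℝ) (i : Fin 3) :
    ∑ j, f j = f i + f (i + 1) + f (i + 2) := by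
  fin_cases i <;> simp [Fin.sum_univ_three] <;> ring

lemma bary_lineComb (v : Fin 3 → Plane) (i : Fin 3) (a b : Plane) (t : ℝ) :
    bary v i (a + t • (b - a)) = (1 - t) * bary v i a + t * bary v i b := by
  have h1 := bary_sub v i (a + t • (b - a)) a
  have h2 := bary_sub v i b a
  rw [add_sub_cancel_left, inner_smul_left, ← h2] at h1
  simp only [conj_trivial] at h1
  linarith

lemma bary_edge {v : Fin 3 → Plane} (hv : triDet v ≠ 0) (i j : Fin 3) (t : ℝ) :
    bary v j (v (i + 1) + t • (v (i + 2) - v (i + 1))) =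
      if j = i then 0 else if j = i + 1 then 1 - t else t := by
  rw [bary_lineComb, bary_vert hv, bary_vert hv]
  fin_cases i <;> fin_cases j <;> simp [Fin.reduceAdd]

lemma triEdge_eq {v : Fin 3 → Plane} (hv : triDet v ≠ 0) (i : Fin 3) :
    triEdge v i = {z | (∀ j, 0 ≤ bary v j z) ∧ bary v i z = 0} := by
  ext z
  rw [triEdge, segment_eq_image']
  constructor
  · rintro ⟨t, ⟨h0, h1⟩, rfl⟩
    refine ⟨fun j => ?_, by simp [bary_edge hv]⟩
    simp only [bary_edge hv]
    split_ifs <;> linarith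
  · rintro ⟨h, hi⟩
    have hs := sum_bary hv z
    have hz := sum_bary_smul hv z
    have hz' : ∀ c, z c = bary v i z * v i c + bary v (i+1) z * v (i+1) c
        + bary v (i+2) z * v (i+2) c := by
      intro c
      have := congrArg (fun w : Plane => w c) hz
      have e := sum_fin_three_shift (fun j => bary v j z * v j c) i
      simp only [Fin.sum_univ_three, PiLp.add_apply, PiLp.smul_apply, smul_eq_mul] at this e
      rw [← this, e]
    rw [sum_fin_three_shift _ i, hi] at hs
    refine ⟨bary v (i + 2) z, ⟨h _, by linarith [h (i+1)]⟩, ?_⟩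
    ext c
    rw [hz' c, hi]
    simp only [PiLp.add_apply, PiLp.smul_apply, PiLp.sub_apply, smul_eq_mul]
    linear_combination (- v (i+1) c) * hs

lemma frontier_openTriangle_eq_iUnion {v : Fin 3 → Plane} (hv : AffineIndependent ℝ v) :
    frontier (openTriangle v) = ⋃ i, triEdge v i := by
  ext z
  rw [frontier_openTriangle hv]
  simp [triEdge_eq (triDet_ne_zero hv)]

lemma eq_vert_of_bary_eq_zero {v : Fin 3 → Plane} (hv : triDet v ≠ 0) {i j : Fin 3} (hij : i ≠ j)
    {z : Plane} (hi : bary v i z = 0) (hj : bary v j z = 0) : z ∈ range v := by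
  have hs := sum_bary hv z
  have hz := sum_bary_smul hv z
  rw [Fin.sum_univ_three] at hs hz
  fin_cases i <;> fin_cases j <;> simp at hij hi hj <;> simp [hi, hj] at hs hz <;>
    rw [hs, one_smul] at hz <;> exact ⟨_, hz⟩

lemma exists_mem_openEdge {v : Fin 3 → Plane} (hv : AffineIndependent ℝ v) {z : Plane}
    (hz : z ∈ frontier (openTriangle v)) (hzv : z ∉ range v) : ∃ i, z ∈ openEdge v i := by
  rw [frontier_openTriangle hv] at hz
  obtain ⟨h, i, hi⟩ := hz
  refine ⟨i, hi, fun j hj => lt_of_le_of_ne (h j) fun h0 => hzv ?_⟩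
  exact eq_vert_of_bary_eq_zero (triDet_ne_zero hv) hj h0.symm hi

lemma openEdge_subset_frontier {v : Fin 3 → Plane} (hv : AffineIndependent ℝ v) (i : Fin 3) :
    openEdge v i ⊆ frontier (openTriangle v) := by
  intro z hz
  rw [frontier_openTriangle hv]
  refine ⟨fun j => ?_, i, hz.1⟩
  by_cases hj : j = i
  · rw [hj, hz.1]
  · exact (hz.2 j hj).le

lemma measurableSet_openEdge (v : Fin 3 → Plane) (i : Fin 3) : MeasurableSet (openEdge v i) := by
  have : openEdge v i = {z | bary v i z = 0} ∩ ⋂ j, {z | j ≠ i → 0 < bary v j z} := by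
    ext z; simp [openEdge]
  rw [this]
  refine (isClosed_eq (continuous_bary v i) continuous_const).measurableSet.inter
    (MeasurableSet.iInter fun j => ?_)
  by_cases hj : j = i
  · simp [hj]
  · simp only [hj, ne_eq, not_false_eq_true, forall_const]
    exact (isOpen_lt continuous_const (continuous_bary v j)).measurableSet

lemma baryGrad_ne_zero {v : Fin 3 → Plane} (hv : triDet v ≠ 0) (i : Fin 3) :
    baryGrad v i ≠ 0 := by
  intro h
  have := bary_sub v i (v i) (v (i + 1))
  rw [h, inner_zero_right, bary_vert hv, bary_vert hv] at this
  fin_cases i <;> simp at this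

/-- The outward unit normal on the `i`-th edge. -/
def edgeNormal (v : Fin 3 → Plane) (i : Fin 3) : Plane :=
  -(‖baryGrad v i‖⁻¹ • baryGrad v i)

lemma norm_edgeNormal {v : Fin 3 → Plane} (hv : triDet v ≠ 0) (i : Fin 3) :
    ‖edgeNormal v i‖ = 1 := by
  rw [edgeNormal, norm_neg, norm_smul, norm_inv, norm_norm,
    inv_mul_cancel₀ (norm_ne_zero_iff.2 (baryGrad_ne_zero hv i))]

/-- The coordinate is affine and vanishes at a point of the line carrying the edge. Sign conditions
on it thus become statements about sides of that line, the form required by `IsOuterNormal`. -/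
lemma bary_eq_neg_inner_edgeNormal {v : Fin 3 → Plane} (hv : triDet v ≠ 0) {i : Fin 3}
    {y z : Plane} (hz : bary v i z = 0) :
    bary v i y = - (‖baryGrad v i‖ * ⟪y - z, edgeNormal v i⟫) := by
  have := bary_sub v i y z
  rw [hz, sub_zero] at this
  rw [this, edgeNormal, inner_neg_right, inner_smul_right]
  have := norm_ne_zero_iff.2 (baryGrad_ne_zero hv i)
  field_simp

/-- Near a point of an open edge the triangle is a half-plane. -/
lemma exists_ball_openTriangle {v : Fin 3 → Plane} (hv : AffineIndependent ℝ v) {i : Fin 3}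
    {z : Plane} (hz : z ∈ openEdge v i) :
    ∃ r > 0, ∀ y ∈ Metric.ball z r, (y ∈ openTriangle v ↔ ⟪y - z, edgeNormal v i⟫ < 0) ∧
      (y ∈ closure (openTriangle v) ↔ ⟪y - z, edgeNormal v i⟫ ≤ 0) := by
  have hev : ∀ᶠ y in 𝓝 z, ∀ j, j ≠ i → 0 < bary v j y := by
    rw [Filter.eventually_all]
    intro j
    by_cases hj : j = i
    · simp [hj]
    · filter_upwards [(continuous_bary v j).continuousAt.eventually_const_lt (hz.2 j hj)] with y hy
      exact fun _ => hy
  obtain ⟨r, hr, h⟩ := Metric.eventually_nhds_iff_ball.1 hev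
  have hD := triDet_ne_zero hv
  have hG := norm_pos_iff.2 (baryGrad_ne_zero hD i)
  refine ⟨r, hr, fun y hy => ?_⟩
  have hb := bary_eq_neg_inner_edgeNormal hD hz.1 (y := y)
  rw [closure_openTriangle hv, openTriangle_eq hv]
  refine ⟨⟨fun H => ?_, fun H j => ?_⟩, ⟨fun H => ?_, fun H j => ?_⟩⟩
  · have := H i
    rw [hb] at this
    by_contra hc
    nlinarith
  · by_cases hj : j = i
    · rw [hj, hb]; nlinarith
    · exact h y hy j hj
  · have := H i
    rw [hb] at this
    by_contra hc
    nlinarith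
  · by_cases hj : j = i
    · rw [hj, hb]; nlinarith
    · exact (h y hy j hj).le

/-! ### Outer normals: uniqueness and their values on open edges. -/

lemma IsOuterNormal.unique {U : Set Plane} {z n n' : Plane} (h : IsOuterNormal U z n)
    (h' : IsOuterNormal U z n') : n = n' := by
  obtain ⟨h1, r, hr, hU⟩ := h
  obtain ⟨h1', r', hr', hU'⟩ := h'
  by_contra hne
  set d := n - n' with hd
  have hd0 : 0 < ‖d‖ := norm_pos_iff.2 (sub_ne_zero.2 hne)
  -- The test point is z + t(n - n'). For distinct unit vectors the inner product of n - n' with n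
  -- is positive and with n' is negative, so the two half-planes disagree about this point; t keeps
  -- it in both balls.
  set t := min r r' / (2 * ‖d‖) with ht
  have hm : 0 < min r r' := lt_min hr hr'
  have ht0 : 0 < t := by positivity
  have hdist : ‖t • d‖ < min r r' := by
    rw [norm_smul, Real.norm_of_nonneg ht0.le, ht]
    field_simp
    linarith
  have hnn : ⟪n, n⟫ = 1 := by rw [real_inner_self_eq_norm_sq, h1, one_pow]
  have hnn' : ⟪n', n'⟫ = 1 := by rw [real_inner_self_eq_norm_sq, h1', one_pow]
  have hdd : 0 < ⟪d, d⟫ := by rw [real_inner_self_eq_norm_sq]; positivity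
  have hs : ⟪n', n⟫ = ⟪n, n'⟫ := real_inner_comm _ _
  rw [hd, inner_sub_left, inner_sub_right, inner_sub_right, hnn, hnn', hs] at hdd
  have e1 := (hU (z + t • d) (by rw [mem_ball_iff_norm, add_sub_cancel_left]; exact hdist.trans_le (min_le_left _ _)))
  have e2 := (hU' (z + t • d) (by rw [mem_ball_iff_norm, add_sub_cancel_left]; exact hdist.trans_le (min_le_right _ _)))
  rw [add_sub_cancel_left, inner_smul_left] at e1 e2
  have a1 : ¬ (starRingEnd ℝ t * ⟪d, n⟫ < 0) := by
    rw [hd, inner_sub_left, hnn, hs, conj_trivial]; nlinarith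
  have a2 : (starRingEnd ℝ t * ⟪d, n'⟫ < 0) := by
    rw [hd, inner_sub_left, hnn', conj_trivial]; nlinarith
  exact a1 (e1.1 (e2.2 a2))

lemma IsOuterNormal.outerNormal_eq {U : Set Plane} {z n : Plane} (h : IsOuterNormal U z n) :
    outerNormal U z = n := by
  have hex : ∃ n, IsOuterNormal U z n := ⟨n, h⟩
  rw [outerNormal, dif_pos hex]
  exact hex.choose_spec.unique h

lemma outerNormal_openTriangle {v : Fin 3 → Plane} (hv : AffineIndependent ℝ v) {i : Fin 3}
    {z : Plane} (hz : z ∈ openEdge v i) : outerNormal (openTriangle v) z = edgeNormal v i := by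
  obtain ⟨r, hr, h⟩ := exists_ball_openTriangle hv hz
  exact IsOuterNormal.outerNormal_eq
    ⟨norm_edgeNormal (triDet_ne_zero hv) i, r, hr, fun y hy => (h y hy).1⟩

/-! ### Integrals over segments and triangles -/

instance nullSingletonClass_arcLength : NullSingletonClass arcLength :=
  Measure.nullSingletonClass_hausdorff Plane one_pos

/-- The parametrisation of a segment. -/
def segPt (a b : Plane) (t : ℝ) : Plane := a + t • (b - a)

lemma continuous_segPt (a b : Plane) : Continuous (segPt a b) := by
  unfold segPt
  fun_prop

lemma measurableSet_segment (a b : Plane) : MeasurableSet (segment ℝ a b) := by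
  rw [segment_eq_image']
  exact (isCompact_Icc.image (continuous_segPt a b)).measurableSet

/-- The unit-speed parametrisation of the line is an isometry of ℝ, and one-dimensional Hausdorff
measure on ℝ is Lebesgue measure. Rescaling to (0, 1) contributes the length. -/
lemma setIntegral_segment (a b : Plane) (f : Plane → ℝ) :
    ∫ z in segment ℝ a b, f z ∂arcLength = dist a b * ∫ t in (0 : ℝ)..1, f (segPt a b t) := by
  rcases eq_or_ne a b with rfl | hab
  · simp [segment_same, Measure.restrict_singleton]
  have hL : 0 < ‖b - a‖ := norm_pos_iff.2 (sub_ne_zero.2 hab.symm)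
  set L := ‖b - a‖ with hLdef
  set ι : ℝ → Plane := fun t => a + (t * L⁻¹) • (b - a) with hι
  have hiso : Isometry ι := by
    refine Isometry.of_dist_eq fun s t => ?_
    simp only [hι]
    rw [dist_add_left, dist_eq_norm, ← sub_smul, norm_smul, ← sub_mul, norm_mul, norm_inv,
      ← hLdef, Real.norm_of_nonneg hL.le, mul_assoc, inv_mul_cancel₀ hL.ne', mul_one,
      Real.dist_eq, Real.norm_eq_abs]
  have hemb : MeasurableEmbedding ι := hiso.isClosedEmbedding.measurableEmbedding
  have hmap : Measure.map ι volume = arcLength.restrict (range ι) := by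
    rw [← hausdorffMeasure_real]
    exact hiso.map_hausdorffMeasure (Or.inl zero_le_one)
  have himg : segment ℝ a b ⊆ range ι := by
    rw [segment_eq_image']
    rintro _ ⟨t, -, rfl⟩
    exact ⟨t * L, by simp [hι, mul_assoc, mul_inv_cancel₀ hL.ne']⟩
  have hpre : ι ⁻¹' (segment ℝ a b) = Icc 0 L := by
    ext t
    rw [mem_preimage, segment_eq_image']
    constructor
    · rintro ⟨s, ⟨h0, h1⟩, hs⟩
      simp only [hι, add_right_inj] at hs
      have : s = t * L⁻¹ := smul_left_injective ℝ (sub_ne_zero.2 hab.symm) hs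
      have ht : t = s * L := by rw [this, mul_assoc, inv_mul_cancel₀ hL.ne', mul_one]
      rw [ht]
      exact ⟨by positivity, by nlinarith⟩
    · rintro ⟨h0, h1⟩
      exact ⟨t * L⁻¹, ⟨by positivity, by rw [← div_eq_mul_inv, div_le_one hL]; exact h1⟩, rfl⟩
  have h1 : ∫ z in segment ℝ a b, f z ∂arcLength
      = ∫ z in segment ℝ a b, f z ∂(Measure.map ι volume) := by
    rw [hmap, Measure.restrict_restrict (measurableSet_segment a b), inter_eq_left.2 himg]
  rw [h1, hemb.setIntegral_map, hpre, integral_Icc_eq_integral_Ioc,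
    ← intervalIntegral.integral_of_le hL.le, dist_comm, dist_eq_norm, ← hLdef]
  have := intervalIntegral.integral_comp_mul_right (a := 0) (b := L)
    (fun s => f (a + s • (b - a))) (inv_ne_zero hL.ne')
  simp only [hι, segPt]
  rw [this, inv_inv, zero_mul, mul_inv_cancel₀ hL.ne', smul_eq_mul]

lemma arcLength_segment_lt_top (a b : Plane) : arcLength (segment ℝ a b) < ⊤ := by
  rw [hausdorffMeasure_segment]
  exact edist_lt_top a b

/-- The linear change of variables from the plane to a parallelogram spanned by `a` and `b`. -/
lemma integral_plane_eq (c a b : Plane) (hab : cross a b ≠ 0) {F : Plane → ℝ}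
    (hF : StronglyMeasurable F) :
    ∫ z, F z = |cross a b| * ∫ p : ℝ × ℝ, F (c + p.1 • a + p.2 • b) := by
  set M : Matrix (Fin 2) (Fin 2) ℝ := !![a 0, b 0; a 1, b 1] with hM
  have hdet : M.det = cross a b := by
    rw [hM, Matrix.det_fin_two_of, cross]; ring
  have hdet0 : M.det ≠ 0 := by rwa [hdet]
  have hmapM := Real.map_matrix_volume_pi_eq_smul_volume_pi hdet0
  have e1 : ∫ z, F z = ∫ z, F (c + z) := (integral_add_left_eq_self F c).symm
  have e2 : ∫ z, F (c + z) = ∫ w : Fin 2 → ℝ, F (c + WithLp.toLp 2 w) :=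
    ((EuclideanSpace.volume_preserving_symm_measurableEquiv_toLp (Fin 2)).symm.integral_comp'
      (fun z => F (c + z))).symm
  have hmeasG : StronglyMeasurable (fun w : Fin 2 → ℝ => F (c + WithLp.toLp 2 w)) :=
    hF.comp_measurable (by fun_prop)
  have e3 : ∫ w, F (c + WithLp.toLp 2 w) ∂(Measure.map (Matrix.toLin' M) volume)
      = ∫ u : Fin 2 → ℝ, F (c + WithLp.toLp 2 (Matrix.toLin' M u)) :=
    integral_map (LinearMap.continuous_of_finiteDimensional _).aemeasurable
      hmeasG.aestronglyMeasurable
  have e4 : ∫ u : Fin 2 → ℝ, F (c + WithLp.toLp 2 (Matrix.toLin' M u))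
      = ∫ p : ℝ × ℝ, F (c + p.1 • a + p.2 • b) := by
    rw [← (volume_preserving_finTwoArrow ℝ).integral_comp']
    refine integral_congr_ae (ae_of_all _ fun u => ?_)
    have : c + WithLp.toLp 2 (Matrix.toLin' M u) =
        c + (MeasurableEquiv.finTwoArrow u).1 • a + (MeasurableEquiv.finTwoArrow u).2 • b := by
      ext j
      fin_cases j <;> simp [hM, dotProduct, Fin.sum_univ_two] <;> ring
    simp only [this]
  rw [hmapM, integral_smul_measure, e4, hdet, ENNReal.toReal_ofReal (abs_nonneg _),
    smul_eq_mul, abs_inv] at e3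
  rw [e1, e2, ← e3, ← mul_assoc, mul_inv_cancel₀ (abs_ne_zero.2 hab), one_mul]

/-- A coordinate system on a triangle with origin at the vertex following the `i`-th one. -/
def triPt (v : Fin 3 → Plane) (i : Fin 3) (s t : ℝ) : Plane :=
  v (i + 1) + s • (v i - v (i + 1)) + t • (v (i + 2) - v (i + 1))

lemma continuous_triPt (v : Fin 3 → Plane) (i : Fin 3) :
    Continuous (fun p : ℝ × ℝ => triPt v i p.1 p.2) := by
  unfold triPt
  fun_prop

lemma abs_cross_eq (v : Fin 3 → Plane) (i : Fin 3) :
    |cross (v i - v (i + 1)) (v (i + 2) - v (i + 1))| = |triDet v| := by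
  rw [← abs_neg]
  congr 1
  fin_cases i <;> simp [cross, triDet, Fin.reduceAdd] <;> ring

lemma bary_triPt {v : Fin 3 → Plane} (hv : triDet v ≠ 0) (i j : Fin 3) (s t : ℝ) :
    bary v j (triPt v i s t) = if j = i then s else if j = i + 1 then 1 - s - t else t := by
  have h1 := bary_sub v j (triPt v i s t) (v (i + 1))
  have h2 := bary_sub v j (v i) (v (i + 1))
  have h3 := bary_sub v j (v (i + 2)) (v (i + 1))
  rw [triPt, add_assoc, add_sub_cancel_left, inner_add_left, inner_smul_left, inner_smul_left,
    ← h2, ← h3] at h1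
  rw [bary_vert hv, bary_vert hv, bary_vert hv] at h1
  rw [triPt, add_assoc, eq_add_of_sub_eq h1]
  fin_cases i <;> fin_cases j <;> simp [Fin.reduceAdd] <;> ring

lemma triPt_mem_iff {v : Fin 3 → Plane} (hv : AffineIndependent ℝ v) (i : Fin 3) (s t : ℝ) :
    triPt v i s t ∈ openTriangle v ↔ 0 < s ∧ 0 < t ∧ t < 1 - s := by
  rw [openTriangle_eq hv]
  have hD := triDet_ne_zero hv
  simp only [mem_ofPred_eq, bary_triPt hD]
  constructor
  · intro h
    have h0 := h i
    have h1 := h (i + 1)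
    have h2 := h (i + 2)
    have n1 : i + 1 ≠ i := by fin_cases i <;> decide
    have n2 : i + 2 ≠ i := by fin_cases i <;> decide
    have n3 : i + 2 ≠ i + 1 := by fin_cases i <;> decide
    simp only [n1, n2, n3, if_true, if_false] at h0 h1 h2
    exact ⟨h0, h2, by linarith⟩
  · rintro ⟨h0, h1, h2⟩ j
    split_ifs <;> linarith

/-- The triangle is an affine image of the unit right triangle with Jacobian `|triDet v|`; Fubini
does the rest. In these coordinates the outer variable is the barycentric coordinate of vertex `i`.
-/
lemma setIntegral_openTriangle {v : Fin 3 → Plane} (hv : AffineIndependent ℝ v) (i : Fin 3)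
    {f : Plane → ℝ} (hf : Continuous f) :
    ∫ z in openTriangle v, f z =
      |triDet v| * ∫ s in (0 : ℝ)..1, ∫ t in (0 : ℝ)..(1 - s), f (triPt v i s t) := by
  have hD := triDet_ne_zero hv
  have hm : MeasurableSet (openTriangle v) := (isOpen_openTriangle v).measurableSet
  have hab : cross (v i - v (i + 1)) (v (i + 2) - v (i + 1)) ≠ 0 := by
    rw [← abs_ne_zero, abs_cross_eq]; exact abs_ne_zero.2 hD
  rw [← integral_indicator hm, integral_plane_eq (v (i + 1)) _ _ hab
    (hf.stronglyMeasurable.indicator hm), abs_cross_eq]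
  congr 1
  set S : Set (ℝ × ℝ) := {p | 0 < p.1 ∧ 0 < p.2 ∧ p.2 < 1 - p.1} with hS
  have hSo : IsOpen S := by
    refine (isOpen_lt continuous_const continuous_fst).inter
      ((isOpen_lt continuous_const continuous_snd).inter
        (isOpen_lt continuous_snd (continuous_const.sub continuous_fst)))
  have hSsub : S ⊆ Icc 0 1 ×ˢ Icc 0 1 := by
    rintro ⟨s, t⟩ ⟨h0, h1, h2⟩
    simp only at h0 h1 h2
    exact ⟨⟨h0.le, by linarith⟩, ⟨h1.le, by linarith⟩⟩
  have hg : Continuous (fun p : ℝ × ℝ => f (triPt v i p.1 p.2)) := hf.comp (continuous_triPt v i)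
  have hint : IntegrableOn (fun p : ℝ × ℝ => f (triPt v i p.1 p.2)) S :=
    (hg.continuousOn.integrableOn_compact (isCompact_Icc.prod isCompact_Icc)).mono_set hSsub
  have e0 : (fun p : ℝ × ℝ => (openTriangle v).indicator f
      (v (i + 1) + p.1 • (v i - v (i + 1)) + p.2 • (v (i + 2) - v (i + 1)))) =
      S.indicator (fun p : ℝ × ℝ => f (triPt v i p.1 p.2)) := by
    ext ⟨s, t⟩
    have := triPt_mem_iff hv i s t
    rw [triPt] at this
    by_cases h : (s, t) ∈ S
    · rw [indicator_of_mem h, indicator_of_mem (this.2 h), triPt]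
    · rw [indicator_of_notMem h, indicator_of_notMem fun hc => h (this.1 hc)]
  rw [e0, Measure.volume_eq_prod, integral_prod _
    (by rw [← Measure.volume_eq_prod]; exact (integrable_indicator_iff hSo.measurableSet).2 hint)]
  rw [intervalIntegral.integral_of_le zero_le_one, integral_Ioc_eq_integral_Ioo,
    ← integral_indicator measurableSet_Ioo]
  refine integral_congr_ae (ae_of_all _ fun s => ?_)
  by_cases hs : s ∈ Ioo (0 : ℝ) 1
  · rw [indicator_of_mem hs]
    simp only
    rw [intervalIntegral.integral_of_le (by linarith [hs.2]), integral_Ioc_eq_integral_Ioo,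
      ← integral_indicator measurableSet_Ioo]
    refine integral_congr_ae (ae_of_all _ fun t => ?_)
    by_cases ht : t ∈ Ioo (0 : ℝ) (1 - s)
    · simp only
      rw [indicator_of_mem ht, indicator_of_mem (show (s, t) ∈ S from ⟨hs.1, ht.1, ht.2⟩)]
    · simp only
      rw [indicator_of_notMem ht, indicator_of_notMem fun hc : (s, t) ∈ S => ht ⟨hc.2.1, hc.2.2⟩]
  · rw [indicator_of_notMem hs]
    simp only
    rw [← integral_zero ℝ ℝ (μ := volume)]
    refine integral_congr_ae (ae_of_all _ fun t => ?_)
    simp only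
    rw [indicator_of_notMem]
    rintro ⟨h0, h1, h2⟩
    simp only at h0 h1 h2
    exact hs ⟨h0, by linarith⟩

/-- The parametrisation of the `i`-th edge. -/
def edgePt (v : Fin 3 → Plane) (i : Fin 3) (t : ℝ) : Plane := segPt (v (i + 1)) (v (i + 2)) t

lemma continuous_edgePt (v : Fin 3 → Plane) (i : Fin 3) : Continuous (edgePt v i) :=
  continuous_segPt _ _

/-- Collapsed coordinates on a triangle. -/
lemma setIntegral_openTriangle_collapsed {v : Fin 3 → Plane} (hv : AffineIndependent ℝ v)
    (i : Fin 3) {f : Plane → ℝ} (hf : Continuous f) :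
    ∫ z in openTriangle v, f z = |triDet v| * ∫ s in (0 : ℝ)..1, ∫ r in (0 : ℝ)..1,
      (1 - s) * f (segPt (edgePt v i r) (v i) s) := by
  rw [setIntegral_openTriangle hv i hf]
  congr 1
  refine intervalIntegral.integral_congr fun s hs => ?_
  rw [uIcc_of_le zero_le_one] at hs
  rcases eq_or_lt_of_le hs.2 with h1 | h1
  · simp [h1]
  have h2 : (1 - s) ≠ 0 := by linarith
  have := intervalIntegral.integral_comp_mul_left (a := 0) (b := 1)
    (fun t => f (triPt v i s t)) h2
  rw [mul_zero, mul_one, smul_eq_mul] at this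
  rw [intervalIntegral.integral_const_mul]
  have e : ∀ r, segPt (edgePt v i r) (v i) s = triPt v i s ((1 - s) * r) := by
    intro r
    simp only [segPt, edgePt, triPt]
    module
  simp only [e]
  rw [this, ← mul_assoc, mul_inv_cancel₀ h2, one_mul]

/-- The fundamental theorem of calculus on the lines parallel to an edge: their end points sweep the
two other edges. -/
lemma setIntegral_fderiv_edge {v : Fin 3 → Plane} (hv : AffineIndependent ℝ v) (i : Fin 3)
    {f : Plane → ℝ} (hf : ContDiff ℝ 1 f) :
    ∫ z in openTriangle v, fderiv ℝ f z (v (i + 2) - v (i + 1)) =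
      |triDet v| * ((∫ t in (0 : ℝ)..1, f (edgePt v (i + 1) t)) -
        ∫ t in (0 : ℝ)..1, f (edgePt v (i + 2) t)) := by
  have hc : Continuous (fun z => fderiv ℝ f z (v (i + 2) - v (i + 1))) :=
    (hf.continuous_fderiv one_ne_zero).clm_apply continuous_const
  rw [setIntegral_openTriangle hv i hc]
  congr 1
  have key : ∀ s : ℝ, ∫ t in (0 : ℝ)..(1 - s),
      fderiv ℝ f (triPt v i s t) (v (i + 2) - v (i + 1)) =
      f (edgePt v (i + 1) s) - f (edgePt v (i + 2) (1 - s)) := by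
    intro s
    have hd : ∀ t, HasDerivAt (fun t => f (triPt v i s t))
        (fderiv ℝ f (triPt v i s t) (v (i + 2) - v (i + 1))) t := by
      intro t
      have h1 : HasDerivAt (fun t => triPt v i s t) (v (i + 2) - v (i + 1)) t := by
        unfold triPt
        simpa using ((hasDerivAt_id t).smul_const (v (i + 2) - v (i + 1))).const_add
          (v (i + 1) + s • (v i - v (i + 1)))
      exact ((hf.differentiable one_ne_zero) _).hasFDerivAt.comp_hasDerivAt t h1
    rw [intervalIntegral.integral_eq_sub_of_hasDerivAt (fun t _ => hd t)]
    · have a1 : triPt v i s (1 - s) = edgePt v (i + 1) s := by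
        have : i + 1 + 1 = i + 2 := by fin_cases i <;> rfl
        have h3 : i + 1 + 2 = i := by fin_cases i <;> rfl
        simp only [triPt, edgePt, segPt, this, h3]
        module
      have a2 : triPt v i s 0 = edgePt v (i + 2) (1 - s) := by
        have : i + 2 + 1 = i := by fin_cases i <;> rfl
        have h3 : i + 2 + 2 = i + 1 := by fin_cases i <;> rfl
        simp only [triPt, edgePt, segPt, this, h3]
        module
      rw [a1, a2]
    · exact (hc.comp ((continuous_triPt v i).comp
        (continuous_const.prodMk continuous_id))).intervalIntegrable _ _
  simp only [key]
  rw [intervalIntegral.integral_sub]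
  · congr 1
    -- One of the two edges is traversed backwards, hence the substitution t ↦ 1 - t.
    rw [intervalIntegral.integral_comp_sub_left (fun t => f (edgePt v (i + 2) t))]
    simp
  · exact (hf.continuous.comp (continuous_edgePt v _)).intervalIntegrable _ _
  · exact (hf.continuous.comp ((continuous_edgePt v _).comp
      (continuous_const.sub continuous_id))).intervalIntegrable _ _

/-- The divergence theorem on a triangle. -/
lemma setIntegral_fderiv_openTriangle {v : Fin 3 → Plane} (hv : AffineIndependent ℝ v) (w : Plane)
    {f : Plane → ℝ} (hf : ContDiff ℝ 1 f) :
    ∫ z in openTriangle v, fderiv ℝ f z w =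
      - |triDet v| * ∑ i, ⟪w, baryGrad v i⟫ * ∫ t in (0 : ℝ)..1, f (edgePt v i t) := by
  have hD := triDet_ne_zero hv
  -- A direction is the combination of the vertices with weights ⟪w, ∇λᵢ⟫ of sum zero. Eliminating
  -- the middle weight leaves two edge vectors, for which the divergence theorem is already known.
  have hw : w = ⟪w, baryGrad v 2⟫ • (v 2 - v 1) - ⟪w, baryGrad v 0⟫ • (v 1 - v 0) := by
    ext j
    simp only [inner_plane, baryGrad, PiLp.sub_apply, PiLp.smul_apply, smul_eq_mul,
      Matrix.cons_val_zero, Matrix.cons_val_one, Fin.reduceAdd]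
    field_simp
    simp only [triDet, cross, PiLp.sub_apply]
    fin_cases j
    · simp only [Fin.zero_eta]; ring
    · simp only [Fin.mk_one]; ring
  have hsum : ⟪w, baryGrad v 0⟫ + ⟪w, baryGrad v 1⟫ + ⟪w, baryGrad v 2⟫ = 0 := by
    have h1 := sum_bary hD w
    have h2 := sum_bary hD 0
    rw [Fin.sum_univ_three] at h1 h2
    have a := bary_sub v 0 w 0
    have b := bary_sub v 1 w 0
    have c := bary_sub v 2 w 0
    rw [sub_zero] at a b c
    linarith
  have e0 := setIntegral_fderiv_edge hv 0 hf
  have e2 := setIntegral_fderiv_edge hv 2 hf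
  simp only [Fin.reduceAdd, zero_add] at e0 e2
  have hint : ∀ u : Plane, IntegrableOn (fun z => fderiv ℝ f z u) (openTriangle v) := fun u =>
    (((hf.continuous_fderiv one_ne_zero).clm_apply continuous_const).continuousOn.integrableOn_compact
      (isCompact_convexHull_range v)).mono_set interior_subset
  have : ∫ z in openTriangle v, fderiv ℝ f z w =
      ⟪w, baryGrad v 2⟫ * (∫ z in openTriangle v, fderiv ℝ f z (v 2 - v 1)) -
      ⟪w, baryGrad v 0⟫ * (∫ z in openTriangle v, fderiv ℝ f z (v 1 - v 0)) := by
    rw [← integral_const_mul, ← integral_const_mul, ← integral_sub]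
    · refine integral_congr_ae (ae_of_all _ fun z => ?_)
      conv_lhs => rw [hw]
      simp
    · exact (hint _).const_mul _
    · exact (hint _).const_mul _
  rw [this, e0, e2, Fin.sum_univ_three]
  have : ⟪w, baryGrad v 1⟫ = - ⟪w, baryGrad v 0⟫ - ⟪w, baryGrad v 2⟫ := by linarith
  rw [this]
  ring

/-! ### Boundary integrals over triangles -/

lemma measurableSet_triEdge (v : Fin 3 → Plane) (i : Fin 3) : MeasurableSet (triEdge v i) :=
  measurableSet_segment _ _

lemma arcLength_frontier_openTriangle_lt_top {v : Fin 3 → Plane} (hv : AffineIndependent ℝ v) :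
    arcLength (frontier (openTriangle v)) < ⊤ := by
  rw [frontier_openTriangle_eq_iUnion hv]
  refine (measure_iUnion_le _).trans_lt ?_
  rw [tsum_fintype]
  exact ENNReal.sum_lt_top.2 fun i _ => arcLength_segment_lt_top _ _

lemma ae_arcLength_notMem_of_finite {s : Set Plane} (hs : s.Finite) :
    ∀ᵐ z ∂arcLength, z ∉ s :=
  measure_eq_zero_iff_ae_notMem.1 (hs.measure_zero arcLength)

lemma measurableSet_frontier_openTriangle (v : Fin 3 → Plane) :
    MeasurableSet (frontier (openTriangle v)) := isClosed_frontier.measurableSet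

lemma setIntegral_frontier_eq_sum {v : Fin 3 → Plane} (hv : AffineIndependent ℝ v)
    {F : Plane → ℝ} (hF : IntegrableOn F (frontier (openTriangle v)) arcLength) :
    ∫ z in frontier (openTriangle v), F z ∂arcLength =
      ∑ i, ∫ z in triEdge v i, F z ∂arcLength := by
  rw [frontier_openTriangle_eq_iUnion hv] at hF ⊢
  rw [integral_iUnion_ae (fun i => (measurableSet_triEdge v i).nullMeasurableSet) ?_ hF,
    tsum_fintype]
  intro i j hij
  have hD := triDet_ne_zero hv
  refine measure_mono_null ?_ ((finite_range v).measure_zero arcLength)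
  rw [triEdge_eq hD, triEdge_eq hD]
  rintro z ⟨⟨-, h1⟩, ⟨-, h2⟩⟩
  exact eq_vert_of_bary_eq_zero hD hij h1 h2

lemma ae_edge_mem_openEdge {v : Fin 3 → Plane} (hv : AffineIndependent ℝ v) (i : Fin 3) :
    ∀ᵐ z ∂(arcLength.restrict (triEdge v i)), z ∈ openEdge v i := by
  have hD := triDet_ne_zero hv
  rw [ae_restrict_iff' (measurableSet_triEdge v i)]
  filter_upwards [ae_arcLength_notMem_of_finite (finite_range v)] with z hz hzi
  rw [triEdge_eq hD] at hzi
  refine ⟨hzi.2, fun j hj => lt_of_le_of_ne (hzi.1 j) fun h0 => hz ?_⟩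
  exact eq_vert_of_bary_eq_zero hD hj h0.symm hzi.2

lemma ae_frontier_mem_openEdge {v : Fin 3 → Plane} (hv : AffineIndependent ℝ v) :
    ∀ᵐ z ∂(arcLength.restrict (frontier (openTriangle v))), ∃ i, z ∈ openEdge v i := by
  rw [ae_restrict_iff' (measurableSet_frontier_openTriangle v)]
  filter_upwards [ae_arcLength_notMem_of_finite (finite_range v)] with z hz hzi
  exact exists_mem_openEdge hv hzi hz

/-- Twice the area divided by the height: the norm of a barycentric gradient is the reciprocal
height. It converts parameter integrals over edges into arc length. -/
lemma dist_edge {v : Fin 3 → Plane} (hv : triDet v ≠ 0) (i : Fin 3) :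
    dist (v (i + 1)) (v (i + 2)) = |triDet v| * ‖baryGrad v i‖ := by
  rw [EuclideanSpace.dist_eq, EuclideanSpace.norm_eq, ← Real.sqrt_sq_eq_abs,
    ← Real.sqrt_mul (sq_nonneg _)]
  congr 1
  simp only [Fin.sum_univ_two, Real.dist_eq, sq_abs, Real.norm_eq_abs, baryGrad,
    Matrix.cons_val_zero, Matrix.cons_val_one]
  field_simp
  ring

lemma setIntegral_frontier_of_continuous {v : Fin 3 → Plane} (hv : AffineIndependent ℝ v)
    {f : Plane → ℝ} (hf : Continuous f) :
    ∫ z in frontier (openTriangle v), f z ∂arcLength =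
      |triDet v| * ∑ i, ‖baryGrad v i‖ * ∫ t in (0 : ℝ)..1, f (edgePt v i t) := by
  have hfr : Bornology.IsBounded (frontier (openTriangle v)) :=
    (isBounded_openTriangle v).closure.subset frontier_subset_closure
  rw [setIntegral_frontier_eq_sum hv, Finset.mul_sum]
  · refine Finset.sum_congr rfl fun i _ => ?_
    rw [triEdge, setIntegral_segment, dist_edge (triDet_ne_zero hv)]
    simp only [edgePt, mul_assoc]
  · have : MemLp f 1 (arcLength.restrict (frontier (openTriangle v))) :=
      memLp_of_continuous_of_isBounded hfr (arcLength_frontier_openTriangle_lt_top hv)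
        (measurableSet_frontier_openTriangle v) hf
    exact memLp_one_iff_integrable.1 this

/-- The normal is defined by choice, so measurability is obtained from almost everywhere equality
with a step function that is constant on each open edge. -/
lemma aestronglyMeasurable_outerNormal {v : Fin 3 → Plane} (hv : AffineIndependent ℝ v)
    (j : Fin 2) : AEStronglyMeasurable (fun z => outerNormal (openTriangle v) z j)
      (arcLength.restrict (frontier (openTriangle v))) := by
  have hm : Measurable (fun z => ∑ i, (openEdge v i).indicator (fun _ => edgeNormal v i j) z) :=
    Finset.measurable_fun_sum _ fun i _ => measurable_const.indicator (measurableSet_openEdge v i)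
  refine (hm.aestronglyMeasurable).congr ?_
  filter_upwards [ae_frontier_mem_openEdge hv] with z hz
  obtain ⟨i, hi⟩ := hz
  rw [outerNormal_openTriangle hv hi, Finset.sum_eq_single i, indicator_of_mem hi]
  · intro k _ hk
    refine indicator_of_notMem (fun hc => ?_) _
    exact (hc.2 i (Ne.symm hk)).ne' hi.1
  · simp

lemma abs_coord_le_norm (n : Plane) (j : Fin 2) : |n j| ≤ ‖n‖ := by
  simpa using EuclideanSpace.norm_eq n ▸ Real.abs_le_sqrt (by
    rw [Fin.sum_univ_two]
    fin_cases j <;> simp <;> positivity)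

lemma norm_outerNormal_le (U : Set Plane) (z : Plane) : ‖outerNormal U z‖ ≤ 1 := by
  by_cases h : ∃ n, IsOuterNormal U z n
  · rw [outerNormal, dif_pos h]
    exact h.choose_spec.1.le
  · rw [outerNormal, dif_neg h]
    simp

lemma abs_outerNormal_le (U : Set Plane) (z : Plane) (j : Fin 2) : |outerNormal U z j| ≤ 1 :=
  (abs_coord_le_norm _ j).trans (norm_outerNormal_le U z)

lemma integrableOn_frontier_of_continuous {v : Fin 3 → Plane} (hv : AffineIndependent ℝ v)
    {f : Plane → ℝ} (hf : Continuous f) :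
    IntegrableOn f (frontier (openTriangle v)) arcLength :=
  memLp_one_iff_integrable.1 (memLp_of_continuous_of_isBounded
    ((isBounded_openTriangle v).closure.subset frontier_subset_closure)
    (arcLength_frontier_openTriangle_lt_top hv) (measurableSet_frontier_openTriangle v) hf)

lemma integrableOn_mul_outerNormal {v : Fin 3 → Plane} (hv : AffineIndependent ℝ v)
    {f : Plane → ℝ} (hf : IntegrableOn f (frontier (openTriangle v)) arcLength) (j : Fin 2) :
    IntegrableOn (fun z => f z * outerNormal (openTriangle v) z j)
      (frontier (openTriangle v)) arcLength :=
  hf.mul_bdd (c := 1) (aestronglyMeasurable_outerNormal hv j)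
    (ae_of_all _ fun z => abs_outerNormal_le _ z j)

/-- The divergence theorem on a triangle, with the boundary integral in terms of arc length. -/
lemma setIntegral_pd_openTriangle {v : Fin 3 → Plane} (hv : AffineIndependent ℝ v) (j : Fin 2)
    {f : Plane → ℝ} (hf : ContDiff ℝ 1 f) :
    ∫ z in openTriangle v, pd j f z =
      ∫ z in frontier (openTriangle v), f z * outerNormal (openTriangle v) z j ∂arcLength := by
  have hD := triDet_ne_zero hv
  rw [setIntegral_frontier_eq_sum hv (integrableOn_mul_outerNormal hv
    (integrableOn_frontier_of_continuous hv hf.continuous) j)]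
  simp only [pd]
  rw [setIntegral_fderiv_openTriangle hv _ hf, Finset.mul_sum]
  refine Finset.sum_congr rfl fun i _ => ?_
  have : ∫ z in triEdge v i, f z * outerNormal (openTriangle v) z j ∂arcLength =
      ∫ z in triEdge v i, f z * edgeNormal v i j ∂arcLength := by
    refine integral_congr_ae ?_
    filter_upwards [ae_edge_mem_openEdge hv i] with z hz
    rw [outerNormal_openTriangle hv hz]
  rw [this, integral_mul_const, triEdge, setIntegral_segment, dist_edge hD]
  have hG := norm_ne_zero_iff.2 (baryGrad_ne_zero hD i)
  simp only [edgeNormal, PiLp.neg_apply, PiLp.smul_apply, smul_eq_mul, edgePt]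
  rw [EuclideanSpace.inner_single_left]
  simp only [map_one, one_mul]
  field_simp

/-! ### Trace inequalities -/

lemma fderiv_apply_eq_pd (f : Plane → ℝ) (z w : Plane) :
    fderiv ℝ f z w = w 0 * pd 0 f z + w 1 * pd 1 f z := by
  have hw : w = w 0 • EuclideanSpace.single 0 1 + w 1 • EuclideanSpace.single 1 1 := by
    ext j; fin_cases j <;> simp
  conv_lhs => rw [hw]
  simp [pd]

lemma pd_mul {f g : Plane → ℝ} (hf : Differentiable ℝ f) (hg : Differentiable ℝ g) (i : Fin 2)
    (z : Plane) : pd i (fun y => f y * g y) z = f z * pd i g z + g z * pd i f z := by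
  simp only [pd]
  rw [fderiv_fun_mul (hf z) (hg z)]
  simp

lemma pd_coord (i j : Fin 2) (c : ℝ) (z : Plane) :
    pd i (fun y : Plane => y j - c) z = if i = j then 1 else 0 := by
  have : HasFDerivAt (fun y : Plane => y j - c) (EuclideanSpace.proj j : Plane →L[ℝ] ℝ) z :=
    ((EuclideanSpace.proj j : Plane →L[ℝ] ℝ).hasFDerivAt).sub_const c
  simp only [pd]
  rw [this.fderiv]
  simp [eq_comm]

/-- Integration of `div (f² (z - v i))` over a triangle. -/
lemma abs_triDet_mul_integral_edge_sq {v : Fin 3 → Plane} (hv : AffineIndependent ℝ v)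
    (i : Fin 3) {f : Plane → ℝ} (hf : ContDiff ℝ ∞ f) :
    |triDet v| * ∫ t in (0 : ℝ)..1, f (edgePt v i t) ^ 2 =
      ∫ z in openTriangle v, (2 * f z ^ 2 +
        2 * f z * ((z 0 - v i 0) * pd 0 f z + (z 1 - v i 1) * pd 1 f z)) := by
  have hD := triDet_ne_zero hv
  have hfd := hf.differentiable (by simp)
  have hcd : ∀ j : Fin 2, ContDiff ℝ ∞ (fun z : Plane => z j - v i j) := fun j => by fun_prop
  have hF : ∀ j : Fin 2, ContDiff ℝ ∞ (fun z : Plane => (f z * f z) * (z j - v i j)) := fun j =>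
    (hf.mul hf).mul (hcd j)
  have hpd : ∀ (j : Fin 2) z, pd j (fun z : Plane => (f z * f z) * (z j - v i j)) z =
      f z ^ 2 + (z j - v i j) * (2 * f z * pd j f z) := by
    intro j z
    rw [pd_mul (hfd.fun_mul hfd) ((hcd j).differentiable (by simp)), pd_mul hfd hfd, pd_coord]
    simp; ring
  have hI : ∀ j : Fin 2, IntegrableOn (pd j fun z : Plane => (f z * f z) * (z j - v i j))
      (openTriangle v) := fun j =>
    ((continuous_pd (hF j)).continuousOn.integrableOn_compact
      (isCompact_convexHull_range v)).mono_set interior_subset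
  have hE : ∀ (j : Fin 2) k, IntervalIntegrable (fun t => (f (edgePt v k t) * f (edgePt v k t)) *
      (edgePt v k t j - v i j)) volume 0 1 := fun j k =>
    ((hF j).continuous.comp (continuous_edgePt v k)).intervalIntegrable _ _
  have e := fun j : Fin 2 => setIntegral_fderiv_openTriangle hv (EuclideanSpace.single j 1)
    ((hF j).of_le (by simp) : ContDiff ℝ 1 _)
  have h1 : ∫ z in openTriangle v, (2 * f z ^ 2 +
        2 * f z * ((z 0 - v i 0) * pd 0 f z + (z 1 - v i 1) * pd 1 f z)) =
      (∫ z in openTriangle v, pd 0 (fun z : Plane => (f z * f z) * (z 0 - v i 0)) z) +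
      ∫ z in openTriangle v, pd 1 (fun z : Plane => (f z * f z) * (z 1 - v i 1)) z := by
    rw [← integral_add (hI 0) (hI 1)]
    refine integral_congr_ae (ae_of_all _ fun z => ?_)
    simp only [hpd]
    ring
  rw [h1]
  simp only [pd]
  rw [e 0, e 1, ← mul_add, ← Finset.sum_add_distrib]
  -- The field z - v i is tangential on both edges through the vertex `v i`. On the opposite edge
  -- its product with the barycentric gradient is the constant -1, so only this edge survives.
  have h2 : ∀ k, ⟪EuclideanSpace.single 0 1, baryGrad v k⟫ * (∫ t in (0 : ℝ)..1,
      (f (edgePt v k t) * f (edgePt v k t)) * (edgePt v k t 0 - v i 0)) +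
      ⟪EuclideanSpace.single 1 1, baryGrad v k⟫ * (∫ t in (0 : ℝ)..1,
      (f (edgePt v k t) * f (edgePt v k t)) * (edgePt v k t 1 - v i 1)) =
      if k = i then - ∫ t in (0 : ℝ)..1, f (edgePt v i t) ^ 2 else 0 := by
    intro k
    rw [← intervalIntegral.integral_const_mul, ← intervalIntegral.integral_const_mul,
      ← intervalIntegral.integral_add ((hE 0 k).const_mul _) ((hE 1 k).const_mul _)]
    have h3 : ∀ t, ⟪EuclideanSpace.single 0 1, baryGrad v k⟫ *
        ((f (edgePt v k t) * f (edgePt v k t)) * (edgePt v k t 0 - v i 0)) +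
        ⟪EuclideanSpace.single 1 1, baryGrad v k⟫ *
        ((f (edgePt v k t) * f (edgePt v k t)) * (edgePt v k t 1 - v i 1)) =
        - (if k = i then 1 else 0) * f (edgePt v k t) ^ 2 := by
      intro t
      have a1 := bary_sub v k (edgePt v k t) (v i)
      rw [edgePt, segPt, bary_edge hD, bary_vert hD, if_pos rfl, inner_plane, ← segPt,
        ← edgePt, PiLp.sub_apply, PiLp.sub_apply] at a1
      simp only [EuclideanSpace.inner_single_left, map_one, one_mul]
      linear_combination (- f (edgePt v k t) ^ 2) * a1
    simp only [h3]
    split_ifs with hk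
    · simp [hk]
    · simp
  rw [Finset.sum_congr rfl fun k _ => h2 k]
  simp

/-- Each edge is treated with the field centred at the opposite vertex; Young's inequality in the
resulting area integral gives the H¹ bound. The constant may depend on the triangle, since it serves
only the existence and uniqueness of traces. -/
lemma exists_trace_inequality {v : Fin 3 → Plane} (hv : AffineIndependent ℝ v) :
    ∃ C : ℝ, 0 ≤ C ∧ ∀ f : Plane → ℝ, ContDiff ℝ ∞ f →
      ∫ z in frontier (openTriangle v), f z ^ 2 ∂arcLength ≤
        C * ((∫ z in openTriangle v, f z ^ 2) + (∫ z in openTriangle v, pd 0 f z ^ 2) +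
          ∫ z in openTriangle v, pd 1 f z ^ 2) := by
  have hD := triDet_ne_zero hv
  obtain ⟨R, hR⟩ := (isBounded_openTriangle v).exists_norm_le
  have hI : ∀ g : Plane → ℝ, Continuous g → IntegrableOn g (openTriangle v) := fun g hg =>
    (hg.continuousOn.integrableOn_compact
      (isCompact_convexHull_range v)).mono_set interior_subset
  -- Young gives at most 4f² from the terms without derivatives and (R + ‖v i‖)² times the squared
  -- derivatives; this value dominates both coefficients.
  set K : Fin 3 → ℝ := fun i => 4 + 2 * (R + ‖v i‖) ^ 2
  have hK : ∀ i, 0 ≤ K i := fun i => by positivity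
  have main : ∀ (i : Fin 3) (f : Plane → ℝ), ContDiff ℝ ∞ f →
      |triDet v| * ∫ t in (0 : ℝ)..1, f (edgePt v i t) ^ 2 ≤
      K i * ((∫ z in openTriangle v, f z ^ 2) + (∫ z in openTriangle v, pd 0 f z ^ 2) +
          ∫ z in openTriangle v, pd 1 f z ^ 2) := by
    intro i f hf
    have c0 := hf.continuous
    have c1 := continuous_pd (i := 0) hf
    have c2 := continuous_pd (i := 1) hf
    rw [abs_triDet_mul_integral_edge_sq hv i hf, ← integral_add (hI _ (by fun_prop))
      (hI _ (by fun_prop)), ← integral_add (hI _ (by fun_prop)) (hI _ (by fun_prop)),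
      ← integral_const_mul]
    refine setIntegral_mono_on (hI _ (by fun_prop)) (hI _ (by fun_prop))
      (isOpen_openTriangle v).measurableSet fun z hz => ?_
    have hb : ∀ j : Fin 2, (z j - v i j) ^ 2 ≤ (R + ‖v i‖) ^ 2 := fun j => by
      have h1 := abs_coord_le_norm (z - v i) j
      have h2 : ‖z - v i‖ ≤ R + ‖v i‖ := (norm_sub_le _ _).trans (by linarith [hR z hz])
      rw [PiLp.sub_apply] at h1
      rw [← sq_abs]
      exact pow_le_pow_left₀ (abs_nonneg _) (h1.trans h2) 2
    have h0 := hb 0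
    have h1 := hb 1
    simp only [K]
    nlinarith [sq_nonneg (f z - (z 0 - v i 0) * pd 0 f z),
      sq_nonneg (f z - (z 1 - v i 1) * pd 1 f z),
      mul_le_mul_of_nonneg_right h0 (sq_nonneg (pd 0 f z)),
      mul_le_mul_of_nonneg_right h1 (sq_nonneg (pd 1 f z)),
      mul_nonneg (sq_nonneg (R + ‖v i‖)) (sq_nonneg (f z)),
      mul_nonneg (sq_nonneg (R + ‖v i‖)) (sq_nonneg (pd 0 f z)),
      mul_nonneg (sq_nonneg (R + ‖v i‖)) (sq_nonneg (pd 1 f z)),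
      sq_nonneg (pd 0 f z), sq_nonneg (pd 1 f z)]
  refine ⟨∑ i, ‖baryGrad v i‖ * K i,
    Finset.sum_nonneg fun i _ => mul_nonneg (norm_nonneg _) (hK i), fun f hf => ?_⟩
  rw [setIntegral_frontier_of_continuous hv (f := fun z => f z ^ 2) (hf.continuous.pow 2), Finset.mul_sum,
    Finset.sum_mul]
  refine Finset.sum_le_sum fun i _ => ?_
  have := mul_le_mul_of_nonneg_left (main i f hf) (norm_nonneg (baryGrad v i))
  linarith

/-! ### Traces -/

lemma eLpNorm_two_eq {μ : Measure Plane} {f : Plane → ℝ} (hf : MemLp f 2 μ) :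
    eLpNorm f 2 μ = ENNReal.ofReal (√(∫ z, f z ^ 2 ∂μ)) := by
  rw [hf.eLpNorm_eq_integral_rpow_norm two_ne_zero ENNReal.ofNat_ne_top, Real.sqrt_eq_rpow]
  simp

lemma eLpNorm_sub_triangle {μ : Measure Plane} {f g h : Plane → ℝ}
    (hf : AEStronglyMeasurable f μ) (hg : AEStronglyMeasurable g μ)
    (hh : AEStronglyMeasurable h μ) :
    eLpNorm (fun z => f z - h z) 2 μ ≤
      eLpNorm (fun z => f z - g z) 2 μ + eLpNorm (fun z => g z - h z) 2 μ := by
  have := eLpNorm_add_le (p := 2) (hf.sub hg) (hg.sub hh) (by norm_num)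
  rwa [sub_add_sub_cancel] at this

lemma eLpNorm_sub_symm {μ : Measure Plane} (f g : Plane → ℝ) :
    eLpNorm (fun z => f z - g z) 2 μ = eLpNorm (fun z => g z - f z) 2 μ :=
  eLpNorm_sub_comm f g 2 μ

lemma tendsto_eLpNorm_lincomb {μ : Measure Plane} {v v' : ℕ → Plane → ℝ} {f f' : Plane → ℝ}
    (hv : ∀ n, AEStronglyMeasurable (v n) μ) (hv' : ∀ n, AEStronglyMeasurable (v' n) μ)
    (hf : AEStronglyMeasurable f μ) (hf' : AEStronglyMeasurable f' μ)
    (h : Tendsto (fun n => eLpNorm (fun z => v n z - f z) 2 μ) atTop (𝓝 0))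
    (h' : Tendsto (fun n => eLpNorm (fun z => v' n z - f' z) 2 μ) atTop (𝓝 0)) (a b : ℝ) :
    Tendsto (fun n => eLpNorm (fun z => (a * v n z + b * v' n z) - (a * f z + b * f' z)) 2 μ)
      atTop (𝓝 0) := by
  have hlim : Tendsto (fun n => ‖a‖ₑ * eLpNorm (fun z => v n z - f z) 2 μ +
      ‖b‖ₑ * eLpNorm (fun z => v' n z - f' z) 2 μ) atTop (𝓝 0) := by
    have := (ENNReal.Tendsto.const_mul h (Or.inr (enorm_ne_top (x := a)))).add
      (ENNReal.Tendsto.const_mul h' (Or.inr (enorm_ne_top (x := b))))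
    simpa using this
  refine tendsto_of_tendsto_of_tendsto_of_le_of_le tendsto_const_nhds hlim (fun _ => zero_le)
    fun n => ?_
  have e : (fun z => (a * v n z + b * v' n z) - (a * f z + b * f' z)) =
      a • (fun z => v n z - f z) + b • (fun z => v' n z - f' z) := by
    ext z; simp; ring
  rw [e]
  refine (eLpNorm_add_le (((hv n).sub hf).const_smul a) (((hv' n).sub hf').const_smul b)
    (by norm_num)).trans ?_
  rw [eLpNorm_const_smul, eLpNorm_const_smul]
  exact le_rfl

/-- The `L₂(ν)`-norm of smooth functions is bounded by their norm in `H¹(U)`. -/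
def HasTraceInequality (U : Set Plane) (ν : Measure Plane) : Prop :=
  ∃ C : ENNReal, C ≠ ⊤ ∧ ∀ f : Plane → ℝ, ContDiff ℝ ∞ f → eLpNorm f 2 ν ≤
    C * (eLpNorm f 2 (volume.restrict U) + (eLpNorm (pd 0 f) 2 (volume.restrict U) +
      eLpNorm (pd 1 f) 2 (volume.restrict U)))

/-- A sequence of smooth functions that converges to `f` in `H¹(U)`. -/
def H1Approx (U : Set Plane) (f : Plane → ℝ) (v : ℕ → Plane → ℝ) : Prop :=
  (∀ n, ContDiff ℝ ∞ (v n)) ∧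
    Tendsto (fun n => eLpNorm (fun z => v n z - f z) 2 (volume.restrict U)) atTop (𝓝 0) ∧
    (∀ i, Tendsto (fun n => eLpNorm (fun z => pd i (v n) z - wpd U i f z) 2
        (volume.restrict U)) atTop (𝓝 0))

/-- Convergence in `L₂(ν)`. -/
def L2Tendsto (ν : Measure Plane) (v : ℕ → Plane → ℝ) (g : Plane → ℝ) : Prop :=
  Tendsto (fun n => eLpNorm (fun z => v n z - g z) 2 ν) atTop (𝓝 0)

lemma H1Approx.aestronglyMeasurable {U : Set Plane} {f : Plane → ℝ} {v : ℕ → Plane → ℝ}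
    (h : H1Approx U f v) (ν : Measure Plane) (n : ℕ) : AEStronglyMeasurable (v n) ν :=
  (h.1 n).continuous.aestronglyMeasurable

lemma H1Approx.mono {U V : Set Plane} (hU : IsOpen U) (hUV : U ⊆ V) {f : Plane → ℝ}
    (hf : MemH1 V f) {v : ℕ → Plane → ℝ} (h : H1Approx V f v) : H1Approx U f v := by
  refine ⟨h.1, ?_, fun i => ?_⟩
  · exact tendsto_of_tendsto_of_tendsto_of_le_of_le tendsto_const_nhds h.2.1 (fun _ => zero_le)
      fun n => eLpNorm_mono_measure _ (Measure.restrict_mono hUV le_rfl)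
  · refine tendsto_of_tendsto_of_tendsto_of_le_of_le tendsto_const_nhds (h.2.2 i)
      (fun _ => zero_le) fun n => ?_
    refine le_trans (le_of_eq ?_) (eLpNorm_mono_measure _ (Measure.restrict_mono hUV le_rfl))
    refine eLpNorm_congr_ae ?_
    filter_upwards [hf.wpd_mono hU hUV i] with z hz
    rw [hz]

lemma H1Approx.congr {U : Set Plane} (hU : IsOpen U) {f f' : Plane → ℝ} (hf : MemH1 U f)
    (hff : f =ᵐ[volume.restrict U] f') {v : ℕ → Plane → ℝ} (h : H1Approx U f v) :
    H1Approx U f' v := by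
  refine ⟨h.1, h.2.1.congr fun n => eLpNorm_congr_ae ?_,
    fun i => (h.2.2 i).congr fun n => eLpNorm_congr_ae ?_⟩
  · filter_upwards [hff] with z hz
    rw [hz]
  · filter_upwards [hf.wpd_congr hU hff i] with z hz
    rw [hz]

lemma pd_lincomb {f g : Plane → ℝ} (hf : Differentiable ℝ f) (hg : Differentiable ℝ g) (a b : ℝ)
    (i : Fin 2) (z : Plane) : pd i (fun y => a * f y + b * g y) z = a * pd i f z + b * pd i g z := by
  simp only [pd]
  rw [fderiv_fun_add ((hf z).const_mul a) ((hg z).const_mul b), fderiv_const_mul (hf z),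
    fderiv_const_mul (hg z)]
  simp

lemma H1Approx.lincomb {U : Set Plane} (hU : IsOpen U) {f f' : Plane → ℝ} (hf : MemH1 U f)
    (hf' : MemH1 U f') {v v' : ℕ → Plane → ℝ} (h : H1Approx U f v) (h' : H1Approx U f' v')
    (a b : ℝ) :
    H1Approx U (fun z => a * f z + b * f' z) (fun n z => a * v n z + b * v' n z) := by
  refine ⟨fun n => (contDiff_const.mul (h.1 n)).add (contDiff_const.mul (h'.1 n)), ?_, fun i => ?_⟩
  · exact tendsto_eLpNorm_lincomb (h.aestronglyMeasurable _) (h'.aestronglyMeasurable _) hf.1.1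
      hf'.1.1 h.2.1 h'.2.1 a b
  · have := tendsto_eLpNorm_lincomb
      (fun n => (continuous_pd (i := i) (h.1 n)).aestronglyMeasurable)
      (fun n => (continuous_pd (i := i) (h'.1 n)).aestronglyMeasurable)
      (hf.memL2_wpd i).1 (hf'.memL2_wpd i).1 (h.2.2 i) (h'.2.2 i) a b
    refine this.congr fun n => eLpNorm_congr_ae ?_
    filter_upwards [hf.wpd_lincomb hU hf' a b i] with z hz
    rw [hz, pd_lincomb ((h.1 n).differentiable (by simp)) ((h'.1 n).differentiable (by simp))]

/-- The trace inequality is applied to differences of approximations. The double index serves two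
purposes: equal sequences give the Cauchy property, different ones give independence of the trace
from the approximating sequence. -/
lemma H1Approx.tendsto_sub {U : Set Plane} {ν : Measure Plane} (hT : HasTraceInequality U ν)
    {f : Plane → ℝ} (hf : MemH1 U f) {v v' : ℕ → Plane → ℝ} (h : H1Approx U f v)
    (h' : H1Approx U f v') :
    Tendsto (fun p : ℕ × ℕ => eLpNorm (fun z => v p.1 z - v' p.2 z) 2 ν) (atTop ×ˢ atTop)
      (𝓝 0) := by
  obtain ⟨C, hC, hT⟩ := hT
  have t1 := (h.2.1.comp tendsto_fst).add (h'.2.1.comp (tendsto_snd (f := atTop (α := ℕ))))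
  have t2 := fun i => ((h.2.2 i).comp tendsto_fst).add
    ((h'.2.2 i).comp (tendsto_snd (f := atTop (α := ℕ))))
  have t3 := ENNReal.Tendsto.const_mul (t1.add ((t2 0).add (t2 1))) (Or.inr hC)
  simp only [add_zero, mul_zero] at t3
  refine tendsto_of_tendsto_of_tendsto_of_le_of_le tendsto_const_nhds t3 (fun _ => zero_le)
    fun p => ?_
  have e : (fun z => v p.1 z - v' p.2 z) = fun z => 1 * v p.1 z + (-1) * v' p.2 z := by
    ext z; ring
  have hsm : ContDiff ℝ ∞ (fun z => 1 * v p.1 z + (-1) * v' p.2 z) :=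
    (contDiff_const.mul (h.1 _)).add (contDiff_const.mul (h'.1 _))
  have hpd : ∀ i, pd i (fun z => 1 * v p.1 z + (-1) * v' p.2 z) =
      fun z => pd i (v p.1) z - pd i (v' p.2) z := by
    intro i; ext z
    rw [pd_lincomb ((h.1 _).differentiable (by simp)) ((h'.1 _).differentiable (by simp))]
    ring
  have := hT _ hsm
  rw [hpd, hpd, ← e] at this
  refine this.trans ?_
  simp only [Function.comp]
  gcongr
  · rw [eLpNorm_sub_symm (v' p.2)]
    exact eLpNorm_sub_triangle (h.aestronglyMeasurable _ _) hf.1.1 (h'.aestronglyMeasurable _ _)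
  · rw [eLpNorm_sub_symm (pd 0 (v' p.2))]
    exact eLpNorm_sub_triangle (continuous_pd (h.1 _)).aestronglyMeasurable (hf.memL2_wpd 0).1
      (continuous_pd (h'.1 _)).aestronglyMeasurable
  · rw [eLpNorm_sub_symm (pd 1 (v' p.2))]
    exact eLpNorm_sub_triangle (continuous_pd (h.1 _)).aestronglyMeasurable (hf.memL2_wpd 1).1
      (continuous_pd (h'.1 _)).aestronglyMeasurable

lemma H1Approx.l2Tendsto {U : Set Plane} {ν : Measure Plane} (hT : HasTraceInequality U ν)
    {f : Plane → ℝ} (hf : MemH1 U f) {v v' : ℕ → Plane → ℝ} (h : H1Approx U f v)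
    (h' : H1Approx U f v') {g : Plane → ℝ} (hg : MemLp g 2 ν) (hv : L2Tendsto ν v g) :
    L2Tendsto ν v' g := by
  have t1 : Tendsto (fun n => eLpNorm (fun z => v' n z - v n z) 2 ν) atTop (𝓝 0) :=
    Tendsto.comp (h'.tendsto_sub hT hf h) (f := fun n : ℕ => (n, n))
      (tendsto_id.prodMk tendsto_id)
  have t2 : Tendsto (fun n => eLpNorm (fun z => v' n z - v n z) 2 ν +
      eLpNorm (fun z => v n z - g z) 2 ν) atTop (𝓝 0) := by simpa using t1.add hv
  unfold L2Tendsto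
  refine tendsto_of_tendsto_of_tendsto_of_le_of_le tendsto_const_nhds t2 (fun _ => zero_le)
    fun n => ?_
  exact eLpNorm_sub_triangle (h'.aestronglyMeasurable ν n) (h.aestronglyMeasurable ν n) hg.1

lemma L2Tendsto.mono {ν ν' : Measure Plane} (hν : ν' ≤ ν) {v : ℕ → Plane → ℝ} {g : Plane → ℝ}
    (h : L2Tendsto ν v g) : L2Tendsto ν' v g :=
  tendsto_of_tendsto_of_tendsto_of_le_of_le tendsto_const_nhds h (fun _ => zero_le)
    fun _ => eLpNorm_mono_measure _ hν

lemma L2Tendsto.unique {ν : Measure Plane} {v : ℕ → Plane → ℝ}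
    (hv : ∀ n, AEStronglyMeasurable (v n) ν) {g g' : Plane → ℝ} (hg : AEStronglyMeasurable g ν)
    (hg' : AEStronglyMeasurable g' ν) (h : L2Tendsto ν v g) (h' : L2Tendsto ν v g') :
    g =ᵐ[ν] g' := by
  have t := h.add h'
  rw [add_zero] at t
  have hle : eLpNorm (fun z => g z - g' z) 2 ν ≤ 0 :=
    ge_of_tendsto t (Eventually.of_forall fun n => by
      have := eLpNorm_sub_triangle hg (hv n) hg'
      rwa [eLpNorm_sub_symm g (v n)] at this)
  have h0 := (eLpNorm_eq_zero_iff (hg.sub hg') two_ne_zero).1 (le_antisymm hle (zero_le))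
  filter_upwards [h0] with z hz
  simpa [sub_eq_zero] using hz

/-- Completeness of L₂(ν): the trace inequality turns convergence in H¹ into a Cauchy sequence of
boundary values. -/
lemma H1Approx.exists_l2Tendsto {U : Set Plane} {ν : Measure Plane}
    (hT : HasTraceInequality U ν) (hν : ∀ f : Plane → ℝ, Continuous f → MemLp f 2 ν)
    {f : Plane → ℝ} (hf : MemH1 U f) {v : ℕ → Plane → ℝ} (h : H1Approx U f v) :
    ∃ g, MemLp g 2 ν ∧ L2Tendsto ν v g := by
  have hm : ∀ n, MemLp (v n) 2 ν := fun n => hν _ (h.1 n).continuous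
  set F : ℕ → Lp ℝ 2 ν := fun n => (hm n).toLp (v n) with hF
  have hdist : ∀ m n, edist (F m) (F n) = eLpNorm (fun z => v m z - v n z) 2 ν := fun m n => by
    rw [hF]
    exact Lp.edist_toLp_toLp _ _ (hm m) (hm n)
  have hC : CauchySeq F := by
    rw [EMetric.cauchySeq_iff]
    intro ε hε
    have := (h.tendsto_sub hT hf h).eventually (gt_mem_nhds hε)
    rw [prod_atTop_atTop_eq, eventually_atTop_prod_self] at this
    obtain ⟨N, hN⟩ := this
    exact ⟨N, fun m hm n hn => by rw [hdist]; exact hN m n hm hn⟩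
  obtain ⟨G, hG⟩ := cauchySeq_tendsto_of_complete hC
  refine ⟨G, Lp.memLp G, ?_⟩
  rw [tendsto_iff_edist_tendsto_0] at hG
  refine hG.congr fun n => ?_
  rw [Lp.edist_def]
  refine eLpNorm_congr_ae ?_
  filter_upwards [(hm n).coeFn_toLp] with z hz
  simp [hF, hz]

lemma IsTrace.h1Approx {U : Set Plane} {f g : Plane → ℝ} (h : IsTrace U f g) :
    ∃ v, H1Approx U f v ∧ L2Tendsto (arcLength.restrict (frontier U)) v g := by
  obtain ⟨-, -, v, h1, h2, h3, h4⟩ := h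
  exact ⟨v, ⟨h1, h2, h3⟩, h4⟩

lemma IsTrace.of_h1Approx {U : Set Plane} {f g : Plane → ℝ} (hf : MemH1 U f)
    (hg : MemLp g 2 (arcLength.restrict (frontier U))) {v : ℕ → Plane → ℝ} (hv : H1Approx U f v)
    (hvg : L2Tendsto (arcLength.restrict (frontier U)) v g) : IsTrace U f g :=
  ⟨hf, hg, v, hv.1, hv.2.1, hv.2.2, hvg⟩

lemma IsTrace.unique {U : Set Plane}
    (hT : HasTraceInequality U (arcLength.restrict (frontier U))) {f g g' : Plane → ℝ}
    (h : IsTrace U f g) (h' : IsTrace U f g') : g =ᵐ[arcLength.restrict (frontier U)] g' := by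
  obtain ⟨v, hv, hvg⟩ := h.h1Approx
  obtain ⟨v', hv', hvg'⟩ := h'.h1Approx
  exact (hv.l2Tendsto hT h.1 hv' h.2.1 hvg).unique (hv'.aestronglyMeasurable _) h.2.1.1 h'.2.1.1 hvg'

/-- Traces on overlapping parts of the boundaries of a set and of a subset agree. -/
lemma IsTrace.ae_eq_of_subset {U V : Set Plane} (hU : IsOpen U) (hUV : U ⊆ V)
    (hT : HasTraceInequality U (arcLength.restrict (frontier U))) {f g g' : Plane → ℝ}
    (h : IsTrace V f g) (h' : IsTrace U f g') :
    g =ᵐ[arcLength.restrict (frontier V ∩ frontier U)] g' := by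
  obtain ⟨v, hv, hvg⟩ := h.h1Approx
  obtain ⟨v', hv', hvg'⟩ := h'.h1Approx
  have hvU := hv.mono hU hUV h.1
  have hg' := hv'.l2Tendsto hT h'.1 hvU h'.2.1 hvg'
  have m1 : arcLength.restrict (frontier V ∩ frontier U) ≤ arcLength.restrict (frontier V) :=
    Measure.restrict_mono inter_subset_left le_rfl
  have m2 : arcLength.restrict (frontier V ∩ frontier U) ≤ arcLength.restrict (frontier U) :=
    Measure.restrict_mono inter_subset_right le_rfl
  exact (hvg.mono m1).unique (hv.aestronglyMeasurable _) (h.2.1.1.mono_measure m1)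
    (h'.2.1.1.mono_measure m2) (hg'.mono m2)

/-- The traces from two disjoint subsets agree on the common boundary. -/
lemma MemH1.trace_ae_eq {U U' V : Set Plane} (hU : IsOpen U) (hUV : U ⊆ V) (hU' : IsOpen U')
    (hUV' : U' ⊆ V) (hT : HasTraceInequality U (arcLength.restrict (frontier U)))
    (hT' : HasTraceInequality U' (arcLength.restrict (frontier U'))) {f g₀ g g' : Plane → ℝ}
    (h₀ : IsTrace V f g₀) (h : IsTrace U f g) (h' : IsTrace U' f g') :
    g =ᵐ[arcLength.restrict (frontier U ∩ frontier U')] g' := by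
  obtain ⟨w, hw, -⟩ := h₀.h1Approx
  obtain ⟨v, hv, hvg⟩ := h.h1Approx
  obtain ⟨v', hv', hvg'⟩ := h'.h1Approx
  have a := hv.l2Tendsto hT h.1 (hw.mono hU hUV h₀.1) h.2.1 hvg
  have a' := hv'.l2Tendsto hT' h'.1 (hw.mono hU' hUV' h₀.1) h'.2.1 hvg'
  have m1 : arcLength.restrict (frontier U ∩ frontier U') ≤ arcLength.restrict (frontier U) :=
    Measure.restrict_mono inter_subset_left le_rfl
  have m2 : arcLength.restrict (frontier U ∩ frontier U') ≤ arcLength.restrict (frontier U') :=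
    Measure.restrict_mono inter_subset_right le_rfl
  exact (a.mono m1).unique (hw.aestronglyMeasurable _) (h.2.1.1.mono_measure m1)
    (h'.2.1.1.mono_measure m2) (a'.mono m2)

lemma isTrace_bdTrace {U : Set Plane} {f : Plane → ℝ} (h : ∃ g, IsTrace U f g) :
    IsTrace U f (bdTrace U f) := by
  rw [bdTrace, dif_pos h]
  exact h.choose_spec

lemma IsTrace.bdTrace_ae_eq {U : Set Plane}
    (hT : HasTraceInequality U (arcLength.restrict (frontier U))) {f g : Plane → ℝ}
    (h : IsTrace U f g) : bdTrace U f =ᵐ[arcLength.restrict (frontier U)] g :=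
  (isTrace_bdTrace ⟨g, h⟩).unique hT h

lemma IsTrace.congr {U : Set Plane} (hU : IsOpen U) {f f' g : Plane → ℝ} (h : IsTrace U f g)
    (hff : f =ᵐ[volume.restrict U] f') : IsTrace U f' g := by
  obtain ⟨v, hv, hvg⟩ := h.h1Approx
  exact .of_h1Approx (h.1.congr hff) h.2.1 (hv.congr hU h.1 hff) hvg

lemma IsTrace.lincomb {U : Set Plane} (hU : IsOpen U) {f f' g g' : Plane → ℝ}
    (h : IsTrace U f g) (h' : IsTrace U f' g') (a b : ℝ) :
    IsTrace U (fun z => a * f z + b * f' z) (fun z => a * g z + b * g' z) := by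
  obtain ⟨v, hv, hvg⟩ := h.h1Approx
  obtain ⟨v', hv', hvg'⟩ := h'.h1Approx
  refine .of_h1Approx (h.1.lincomb h'.1 a b) ((h.2.1.const_mul a).add (h'.2.1.const_mul b))
    (hv.lincomb hU h.1 h'.1 hv' a b) ?_
  exact tendsto_eLpNorm_lincomb (hv.aestronglyMeasurable _) (hv'.aestronglyMeasurable _) h.2.1.1
    h'.2.1.1 hvg hvg' a b

/-- The trace of a smooth function is its restriction. -/
lemma isTrace_of_contDiff {U : Set Plane} (hU : IsOpen U) (hb : Bornology.IsBounded U)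
    (hfin : arcLength (frontier U) < ⊤) {f : Plane → ℝ} (hf : ContDiff ℝ ∞ f) :
    IsTrace U f f := by
  refine .of_h1Approx (v := fun _ => f) (memH1_of_contDiff hU hb hf)
    (memLp_of_continuous_of_isBounded (hb.closure.subset frontier_subset_closure) hfin
      isClosed_frontier.measurableSet hf.continuous) ⟨fun _ => hf, ?_, fun i => ?_⟩ ?_
  · simp
  · refine (tendsto_const_nhds (x := (0 : ENNReal))).congr fun n => ?_
    rw [eLpNorm_congr_ae (g := fun _ => (0 : ℝ)), eLpNorm_zero']
    filter_upwards [wpd_of_contDiff hU hb hf i] with z hz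
    rw [hz, sub_self]
  · simp [L2Tendsto]

lemma hasTraceInequality_openTriangle {v : Fin 3 → Plane} (hv : AffineIndependent ℝ v) :
    HasTraceInequality (openTriangle v) (arcLength.restrict (frontier (openTriangle v))) := by
  obtain ⟨C, hC, h⟩ := exists_trace_inequality hv
  refine ⟨ENNReal.ofReal √C, ENNReal.ofReal_ne_top, fun f hf => ?_⟩
  have hm : ∀ g : Plane → ℝ, Continuous g → MemLp g 2 (volume.restrict (openTriangle v)) :=
    fun g hg => memL2_of_continuous (isOpen_openTriangle v) (isBounded_openTriangle v) hg
  rw [eLpNorm_two_eq (memLp_of_continuous_of_isBounded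
      ((isBounded_openTriangle v).closure.subset frontier_subset_closure)
      (arcLength_frontier_openTriangle_lt_top hv) (measurableSet_frontier_openTriangle v)
      hf.continuous), eLpNorm_two_eq (hm f hf.continuous), eLpNorm_two_eq (hm _ (continuous_pd hf)),
    eLpNorm_two_eq (hm _ (continuous_pd hf)), ← ENNReal.ofReal_add (by positivity) (by positivity),
    ← ENNReal.ofReal_add (by positivity) (by positivity), ← ENNReal.ofReal_mul (by positivity)]
  refine ENNReal.ofReal_le_ofReal ?_
  have h0 : 0 ≤ ∫ z in openTriangle v, f z ^ 2 := integral_nonneg fun z => sq_nonneg _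
  have h1 : 0 ≤ ∫ z in openTriangle v, pd 0 f z ^ 2 := integral_nonneg fun z => sq_nonneg _
  have h2 : 0 ≤ ∫ z in openTriangle v, pd 1 f z ^ 2 := integral_nonneg fun z => sq_nonneg _
  rw [Real.sqrt_le_left (by positivity), mul_pow, Real.sq_sqrt hC]
  refine (h f hf).trans (mul_le_mul_of_nonneg_left ?_ hC)
  have s0 := Real.sq_sqrt h0
  have s1 := Real.sq_sqrt h1
  have s2 := Real.sq_sqrt h2
  nlinarith [mul_nonneg (Real.sqrt_nonneg (∫ z in openTriangle v, f z ^ 2))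
      (Real.sqrt_nonneg (∫ z in openTriangle v, pd 0 f z ^ 2)),
    mul_nonneg (Real.sqrt_nonneg (∫ z in openTriangle v, f z ^ 2))
      (Real.sqrt_nonneg (∫ z in openTriangle v, pd 1 f z ^ 2)),
    mul_nonneg (Real.sqrt_nonneg (∫ z in openTriangle v, pd 0 f z ^ 2))
      (Real.sqrt_nonneg (∫ z in openTriangle v, pd 1 f z ^ 2))]

/-! ### Density of smooth functions in `H¹` of a convex domain -/

/-- Convolution of a function with a kernel. -/
def conv (h K : Plane → ℝ) (w : Plane) : ℝ := ∫ t, h t * K (w - t)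

lemma conv_eq_convolution (h K : Plane → ℝ) :
    conv h K = convolution h K (ContinuousLinearMap.mul ℝ ℝ) volume := rfl

lemma conv_eq_convolution_lsmul (h K : Plane → ℝ) :
    conv h K = convolution K h (ContinuousLinearMap.lsmul ℝ ℝ) volume := by
  ext w
  rw [conv, convolution, ← integral_sub_left_eq_self _ volume w]
  simp [mul_comm]

/-- Continuous probability densities with support in the ball of radius `r`. -/
structure IsMollifier (K : Plane → ℝ) (r : ℝ) : Prop where
  contDiff : ContDiff ℝ ∞ K
  nonneg : ∀ z, 0 ≤ K z
  integral_eq : ∫ z, K z = 1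
  support_subset : Function.support K ⊆ Metric.ball 0 r

lemma exists_isMollifier {r : ℝ} (hr : 0 < r) : ∃ K, IsMollifier K r := by
  let φ : ContDiffBump (0 : Plane) := ⟨r / 2, r, by positivity, by linarith⟩
  exact ⟨φ.normed volume, φ.contDiff_normed, φ.nonneg_normed, φ.integral_normed,
    φ.support_normed_eq.subset⟩

lemma IsMollifier.hasCompactSupport {K : Plane → ℝ} {r : ℝ} (hK : IsMollifier K r) :
    HasCompactSupport K :=
  HasCompactSupport.of_support_subset_isCompact (isCompact_closedBall (0 : Plane) r)
    (hK.support_subset.trans Metric.ball_subset_closedBall)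

lemma eLpNorm_two_sq {μ : Measure Plane} (f : Plane → ℝ) :
    eLpNorm f 2 μ ^ 2 = ∫⁻ z, ‖f z‖ₑ ^ 2 ∂μ := by
  have := eLpNorm_nnreal_pow_eq_lintegral (f := f) (μ := μ) (p := 2) two_ne_zero
  simpa using this

/-- The Jacobian of the dilation contributes (1 - ε)⁻², which is at most 4 when ε ≤ 1/2. -/
lemma lintegral_dilation_le {ε : ℝ} (h1 : ε ≤ 1 / 2) (c : Plane) {F : Plane → ENNReal}
    (hF : Measurable F) : ∫⁻ z, F ((1 - ε) • z + ε • c) ≤ 4 * ∫⁻ z, F z := by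
  have h0 : (1 - ε) ≠ 0 := by linarith
  have e1 : ∫⁻ z, F ((1 - ε) • z + ε • c) = ∫⁻ y, F (y + ε • c) ∂(Measure.map ((1 - ε) • ·)
      (volume : Measure Plane)) :=
    (lintegral_map (hF.comp (measurable_add_const _)) (measurable_const_smul _)).symm
  rw [e1, Measure.map_addHaar_smul _ h0, lintegral_smul_measure,
    lintegral_add_right_eq_self (fun y => F y), smul_eq_mul]
  gcongr
  rw [finrank_euclideanSpace_fin, abs_of_nonneg (by positivity)]
  rw [show (4 : ENNReal) = ENNReal.ofReal 4 by simp]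
  refine ENNReal.ofReal_le_ofReal ?_
  rw [inv_le_comm₀ (by positivity) (by norm_num)]
  nlinarith

/-- Convolution averages translates against a probability measure. Jensen, in the form of
monotonicity of the Lᵖ norms for a probability measure, together with Tonelli and translation
invariance bounds the norm; the factor 2 is the cost of the dilation. The bound is uniform in the
kernel and in ε, as the density argument requires. -/
lemma IsMollifier.eLpNorm_conv_le {K : Plane → ℝ} {r : ℝ} (hK : IsMollifier K r)
    {h : Plane → ℝ} (hm : StronglyMeasurable h) :
    ∀ {ε : ℝ} (_ : ε ≤ 1 / 2) (c : Plane),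
    eLpNorm (fun z => conv h K ((1 - ε) • z + ε • c)) 2 volume ≤ 2 * eLpNorm h 2 volume := by
  intro ε hε c
  set ν : Measure Plane := volume.withDensity (fun t => ENNReal.ofReal (K t)) with hν
  have hKm : Measurable K := hK.contDiff.continuous.measurable
  have hKint : Integrable K := integrable_of_integral_eq_one hK.integral_eq
  have hprob : IsProbabilityMeasure ν := by
    constructor
    rw [hν, withDensity_apply _ MeasurableSet.univ, setLIntegral_univ,
      ← ofReal_integral_eq_lintegral_ofReal hKint (ae_of_all _ hK.nonneg), hK.integral_eq,
      ENNReal.ofReal_one]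
  have hconv : ∀ w, conv h K w = ∫ t, h (w - t) ∂ν := by
    intro w
    rw [hν, integral_withDensity_eq_integral_toReal_smul hKm.ennreal_ofReal
      (ae_of_all _ fun _ => ENNReal.ofReal_lt_top), conv, ← integral_sub_left_eq_self _ volume w]
    refine integral_congr_ae (ae_of_all _ fun t => ?_)
    simp [ENNReal.toReal_ofReal (hK.nonneg _), mul_comm]
  have hsm : Measurable (fun p : Plane × Plane => ‖h (p.1 - p.2)‖ₑ ^ 2) :=
    ((hm.measurable.comp (measurable_fst.sub measurable_snd)).enorm).pow_const 2
  have hptw : ∀ w, ‖conv h K w‖ₑ ^ 2 ≤ ∫⁻ t, ‖h (w - t)‖ₑ ^ 2 ∂ν := by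
    intro w
    have hmw : AEStronglyMeasurable (fun t => h (w - t)) ν :=
      (hm.comp_measurable (measurable_const.sub measurable_id)).aestronglyMeasurable
    rw [hconv, ← eLpNorm_two_sq (μ := ν) (fun t => h (w - t))]
    gcongr
    refine (enorm_integral_le_lintegral_enorm _).trans ?_
    rw [← eLpNorm_one_eq_lintegral_enorm]
    exact eLpNorm_le_eLpNorm_of_exponent_le (by norm_num) hmw
  have hsq : eLpNorm (fun z => conv h K ((1 - ε) • z + ε • c)) 2 volume ^ 2 ≤
      (2 * eLpNorm h 2 volume) ^ 2 := by
    rw [eLpNorm_two_sq, mul_pow, eLpNorm_two_sq]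
    calc ∫⁻ z, ‖conv h K ((1 - ε) • z + ε • c)‖ₑ ^ 2
        ≤ ∫⁻ z, ∫⁻ t, ‖h (((1 - ε) • z + ε • c) - t)‖ₑ ^ 2 ∂ν := lintegral_mono fun z => hptw _
      _ ≤ 4 * ∫⁻ z, ∫⁻ t, ‖h (z - t)‖ₑ ^ 2 ∂ν :=
          lintegral_dilation_le hε c (F := fun z => ∫⁻ t, ‖h (z - t)‖ₑ ^ 2 ∂ν)
            hsm.lintegral_prod_right'
      _ = 4 * ∫⁻ t, ∫⁻ z, ‖h (z - t)‖ₑ ^ 2 ∂volume ∂ν := by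
          rw [lintegral_lintegral_swap hsm.aemeasurable]
      _ = 2 ^ 2 * ∫⁻ z, ‖h z‖ₑ ^ 2 := by
          have : ∀ t : Plane, ∫⁻ z, ‖h (z - t)‖ₑ ^ 2 = ∫⁻ z, ‖h z‖ₑ ^ 2 := fun t =>
            lintegral_sub_right_eq_self (fun z => ‖h z‖ₑ ^ 2) t
          simp only [this, lintegral_const, measure_univ, mul_one]
          norm_num
  exact (ENNReal.pow_le_pow_left_iff two_ne_zero).1 hsq

lemma IsMollifier.conv_sub {K : Plane → ℝ} {r : ℝ} (hK : IsMollifier K r) {h g : Plane → ℝ}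
    (hh : LocallyIntegrable h) (hg : LocallyIntegrable g) (w : Plane) :
    conv (fun t => h t - g t) K w = conv h K w - conv g K w := by
  have e1 : Integrable (fun t => h t * K (w - t)) :=
    hK.hasCompactSupport.convolutionExists_right (ContinuousLinearMap.mul ℝ ℝ) hh
      hK.contDiff.continuous w
  have e2 : Integrable (fun t => g t * K (w - t)) :=
    hK.hasCompactSupport.convolutionExists_right (ContinuousLinearMap.mul ℝ ℝ) hg
      hK.contDiff.continuous w
  simp only [conv, sub_mul]
  exact integral_sub e1 e2

lemma IsMollifier.contDiff_conv {K : Plane → ℝ} {r : ℝ} (hK : IsMollifier K r) {h : Plane → ℝ}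
    (hh : LocallyIntegrable h) : ContDiff ℝ ∞ (conv h K) :=
  hK.hasCompactSupport.contDiff_convolution_right (ContinuousLinearMap.mul ℝ ℝ) hh hK.contDiff

/-- The mollified and dilated function at z averages g over points within ρ + |ε|(R + ‖c‖) of z.
Uniform continuity then gives uniform convergence on the bounded set U. -/
lemma tendsto_eLpNorm_conv_of_continuous {U : Set Plane} (hUo : IsOpen U)
    (hU : Bornology.IsBounded U)
    {ε ρ : ℕ → ℝ} (hε : Tendsto ε atTop (𝓝 0)) (hρ : Tendsto ρ atTop (𝓝 0)) {K : ℕ → Plane → ℝ}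
    (hK : ∀ n, IsMollifier (K n) (ρ n)) (c : Plane) {g : Plane → ℝ} (hg : Continuous g)
    (hgc : HasCompactSupport g) :
    Tendsto (fun n => eLpNorm (fun z => conv g (K n) ((1 - ε n) • z + ε n • c) - g z) 2
      (volume.restrict U)) atTop (𝓝 0) := by
  have : IsFiniteMeasure (volume.restrict U) := ⟨by simpa using hU.measure_lt_top⟩
  have huc := hgc.uniformContinuous_of_continuous hg
  rw [Metric.uniformContinuous_iff] at huc
  obtain ⟨R, hR⟩ := hU.exists_norm_le
  have hsmall : ∀ η > 0, ∀ᶠ n in atTop, eLpNorm (fun z => conv g (K n)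
      ((1 - ε n) • z + ε n • c) - g z) 2 (volume.restrict U) ≤
      (volume.restrict U) univ ^ (2 : ENNReal).toReal⁻¹ * ENNReal.ofReal η := by
    intro η hη
    obtain ⟨δ, hδ, hd⟩ := huc η hη
    have hlim : Tendsto (fun n => ρ n + |ε n| * (R + ‖c‖)) atTop (𝓝 0) := by
      simpa using hρ.add (hε.abs.mul_const (R + ‖c‖))
    filter_upwards [hlim.eventually (gt_mem_nhds hδ)] with n hn
    refine eLpNorm_le_of_ae_bound ?_
    rw [ae_restrict_iff' hUo.measurableSet]
    refine ae_of_all _ fun z hz => ?_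
    rw [← dist_eq_norm, conv_eq_convolution_lsmul]
    refine dist_convolution_le hη.le (hK n).support_subset (hK n).nonneg (hK n).integral_eq
      hg.aestronglyMeasurable fun x hx => (hd ?_).le
    rw [mem_ball_iff_norm] at hx
    rw [dist_eq_norm]
    have e : x - z = (x - ((1 - ε n) • z + ε n • c)) + ε n • (c - z) := by module
    rw [e]
    refine (norm_add_le _ _).trans_lt ?_
    have h1 : ‖ε n • (c - z)‖ ≤ |ε n| * (R + ‖c‖) := by
      rw [norm_smul, Real.norm_eq_abs]
      gcongr
      exact (norm_sub_le _ _).trans (by linarith [hR z hz])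
    linarith
  set M : ENNReal := (volume.restrict U) univ ^ (2 : ENNReal).toReal⁻¹ with hM
  have hMtop : M ≠ ⊤ := ENNReal.rpow_ne_top_of_nonneg (by simp) (measure_ne_top _ _)
  rw [ENNReal.tendsto_nhds_zero]
  intro η hη
  have hc : Tendsto (fun t : ℝ => M * ENNReal.ofReal t) (𝓝[>] 0) (𝓝 0) := by
    have := ENNReal.Tendsto.const_mul (a := M)
      (ENNReal.tendsto_ofReal (tendsto_id.mono_left (nhdsWithin_le_nhds (a := (0 : ℝ)) (s := Ioi 0))))
      (Or.inr hMtop)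
    simpa using this
  obtain ⟨t, ht, ht0⟩ := ((hc.eventually (gt_mem_nhds hη)).and self_mem_nhdsWithin).exists
  filter_upwards [hsmall t ht0] with n hn
  exact hn.trans ht.le

lemma tendsto_eLpNorm_conv {U : Set Plane} (hUo : IsOpen U) (hU : Bornology.IsBounded U)
    {ε ρ : ℕ → ℝ} (hε2 : ∀ n, ε n ≤ 1 / 2)
    (hε : Tendsto ε atTop (𝓝 0)) (hρ : Tendsto ρ atTop (𝓝 0)) {K : ℕ → Plane → ℝ}
    (hK : ∀ n, IsMollifier (K n) (ρ n)) (c : Plane) {h : Plane → ℝ} (hm : StronglyMeasurable h)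
    (hh : MemLp h 2 volume) :
    Tendsto (fun n => eLpNorm (fun z => conv h (K n) ((1 - ε n) • z + ε n • c) - h z) 2
      (volume.restrict U)) atTop (𝓝 0) := by
  rw [ENNReal.tendsto_nhds_zero]
  intro η hη
  -- The error is split into three parts: mollified h - g, contributing twice η/4 by the uniform
  -- bound, the error for g, and g - h. Hence the tolerance η/4.
  obtain ⟨g, hgc, hgη, hg, hgL⟩ := hh.exists_hasCompactSupport_eLpNorm_sub_le
    ENNReal.ofNat_ne_top (ε := η / 4) (ENNReal.div_pos hη.ne' (by norm_num)).ne'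
  have hhloc : LocallyIntegrable h := hh.locallyIntegrable (by norm_num)
  have hgloc : LocallyIntegrable g := hg.locallyIntegrable
  have hev := (ENNReal.tendsto_nhds_zero.1
    (tendsto_eLpNorm_conv_of_continuous hUo hU hε hρ hK c hg hgc)) (η / 4)
    (ENNReal.div_pos hη.ne' (by norm_num))
  filter_upwards [hev] with n hn
  have hA : Continuous fun z : Plane => (1 - ε n) • z + ε n • c := by fun_prop
  have m1 : AEStronglyMeasurable (fun z => conv h (K n) ((1 - ε n) • z + ε n • c))
      (volume.restrict U) :=
    (((hK n).contDiff_conv hhloc).continuous.comp hA).aestronglyMeasurable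
  have m2 : AEStronglyMeasurable (fun z => conv g (K n) ((1 - ε n) • z + ε n • c))
      (volume.restrict U) :=
    (((hK n).contDiff_conv hgloc).continuous.comp hA).aestronglyMeasurable
  have m3 : AEStronglyMeasurable g (volume.restrict U) := hg.aestronglyMeasurable
  have m4 : AEStronglyMeasurable h (volume.restrict U) := hm.aestronglyMeasurable
  have b1 : eLpNorm (fun z => conv h (K n) ((1 - ε n) • z + ε n • c) -
      conv g (K n) ((1 - ε n) • z + ε n • c)) 2 (volume.restrict U) ≤ 2 * (η / 4) := by
    simp only [← (hK n).conv_sub hhloc hgloc]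
    refine (eLpNorm_mono_measure _ Measure.restrict_le_self).trans ?_
    refine ((hK n).eLpNorm_conv_le (hm.sub hg.stronglyMeasurable) (hε2 n) c).trans ?_
    gcongr
  have b3 : eLpNorm (fun z => g z - h z) 2 (volume.restrict U) ≤ η / 4 := by
    rw [eLpNorm_sub_symm]
    exact (eLpNorm_mono_measure _ Measure.restrict_le_self).trans hgη
  calc _ ≤ _ := eLpNorm_sub_triangle m1 m2 m4
    _ ≤ 2 * (η / 4) + (η / 4 + η / 4) := by
      gcongr
      exact (eLpNorm_sub_triangle m2 m3 m4).trans (add_le_add hn b3)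
    _ = 4 * (η / 4) := by ring
    _ = η := ENNReal.mul_div_cancel (by norm_num) (by norm_num)

/-- When the ball of radius r around the dilated point lies in U, the reflected and shifted kernel
is a test function on U. The derivative falling on the kernel can therefore be moved onto the weak
derivative; the factor 1 - ε is the chain rule for the dilation. -/
lemma pd_conv_dilation {U : Set Plane} (hUo : IsOpen U) {f g : Plane → ℝ} {i : Fin 2}
    (hf : LocallyIntegrable (U.indicator f)) (h : HasWeakPD U i f g) {K : Plane → ℝ} {r : ℝ}
    (hK : IsMollifier K r) {ε : ℝ} {c z : Plane}
    (hz : Metric.closedBall ((1 - ε) • z + ε • c) r ⊆ U) :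
    pd i (fun y => conv (U.indicator f) K ((1 - ε) • y + ε • c)) z =
      (1 - ε) * conv (U.indicator g) K ((1 - ε) • z + ε • c) := by
  set w := (1 - ε) • z + ε • c with hw
  have hA : HasFDerivAt (fun y : Plane => (1 - ε) • y + ε • c)
      ((1 - ε) • ContinuousLinearMap.id ℝ Plane) z :=
    (((hasFDerivAt_id z).const_smul (1 - ε))).add_const _
  have hKd : Differentiable ℝ K := hK.contDiff.differentiable (by simp)
  have hC := hK.hasCompactSupport.hasFDerivAt_convolution_right (ContinuousLinearMap.mul ℝ ℝ) hf
    (hK.contDiff.of_le (by simp)) w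
  have hcomp := hC.comp z hA
  have e1 : pd i (fun y => conv (U.indicator f) K ((1 - ε) • y + ε • c)) z =
      (1 - ε) * ∫ t, U.indicator f t * pd i K (w - t) := by
    rw [pd, conv_eq_convolution]
    change fderiv ℝ (convolution (U.indicator f) K (ContinuousLinearMap.mul ℝ ℝ) volume ∘
      fun y : Plane => (1 - ε) • y + ε • c) z _ = _
    rw [hcomp.fderiv]
    simp only [ContinuousLinearMap.comp_smul, ContinuousLinearMap.comp_id,
      smul_apply, smul_eq_mul]
    congr 1
    rw [convolution_precompR_apply (ContinuousLinearMap.mul ℝ ℝ) hf (hK.hasCompactSupport.fderiv ℝ)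
      (hK.contDiff.continuous_fderiv (by simp))]
    rfl
  rw [e1]
  congr 1
  have hφ : IsTestFunction U (fun t => K (w - t)) := by
    refine ⟨hK.contDiff.comp (contDiff_const.sub contDiff_id), ?_, ?_⟩
    · exact hK.hasCompactSupport.comp_homeomorph (Homeomorph.subLeft w)
    · refine (closure_minimal ?_ Metric.isClosed_closedBall).trans hz
      intro t ht
      have := hK.support_subset (show w - t ∈ Function.support K from ht)
      rw [mem_ball_zero_iff, ← dist_eq_norm] at this
      rw [Metric.mem_closedBall, dist_comm]
      exact this.le
  have hpd : ∀ t, pd i (fun t => K (w - t)) t = - pd i K (w - t) := by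
    intro t
    have h1 : HasFDerivAt (fun t : Plane => w - t) (-ContinuousLinearMap.id ℝ Plane) t :=
      (hasFDerivAt_id t).const_sub w
    have h2 := ((hKd (w - t)).hasFDerivAt).comp t h1
    rw [pd]
    change fderiv ℝ (K ∘ fun t : Plane => w - t) t _ = _
    rw [h2.fderiv]
    simp [pd]
  have hint := h.2 _ hφ
  simp only [hpd, mul_neg, integral_neg, neg_inj] at hint
  rw [conv, ← integral_indicator hUo.measurableSet, ← integral_indicator hUo.measurableSet] at *
  simpa only [indicator_mul_left] using hint

/-- Contracting towards an interior point c leaves room of size ερ around each contracted point, by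
convexity. Mollifying at exactly this scale never sees values outside U, so no extension operator is
needed. -/
lemma exists_h1Approx_of_convex {U : Set Plane} (hUo : IsOpen U) (hUb : Bornology.IsBounded U)
    (hUc : Convex ℝ U) (hne : U.Nonempty) {f : Plane → ℝ} (hf : MemH1 U f) :
    ∃ v, H1Approx U f v := by
  obtain ⟨c, hc⟩ := hne
  -- A closed ball around c inside U sets the ratio between the mollification radius and the
  -- contraction parameter.
  obtain ⟨ρ, hρ, hball⟩ := Metric.nhds_basis_closedBall.mem_iff.1 (hUo.mem_nhds hc)
  set f₀ : Plane → ℝ := hf.1.1.mk f with hf₀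
  have hff : f =ᵐ[volume.restrict U] f₀ := hf.1.1.ae_eq_mk
  have hfL := hf.congr hff
  set g : Fin 2 → Plane → ℝ := fun i => (hfL.memL2_wpd i).1.mk _ with hg
  have hgg : ∀ i, wpd U i f₀ =ᵐ[volume.restrict U] g i := fun i => (hfL.memL2_wpd i).1.ae_eq_mk
  have hgw : ∀ i, HasWeakPD U i f₀ (g i) := fun i => (hfL.hasWeakPD i).congr_right (hgg i)
  have hFm : StronglyMeasurable (U.indicator f₀) :=
    (hf.1.1.stronglyMeasurable_mk).indicator hUo.measurableSet
  have hGm : ∀ i, StronglyMeasurable (U.indicator (g i)) := fun i =>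
    ((hfL.memL2_wpd i).1.stronglyMeasurable_mk).indicator hUo.measurableSet
  have hFL : MemLp (U.indicator f₀) 2 volume :=
    (memLp_indicator_iff_restrict hUo.measurableSet).2 hfL.1
  have hGL : ∀ i, MemLp (U.indicator (g i)) 2 volume := fun i =>
    (memLp_indicator_iff_restrict hUo.measurableSet).2 (hgw i).1
  have hFloc : LocallyIntegrable (U.indicator f₀) := hFL.locallyIntegrable (by norm_num)
  set ε : ℕ → ℝ := fun n => 1 / ((n : ℝ) + 2) with hεdef
  have hε0 : ∀ n, 0 < ε n := fun n => by positivity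
  have hε2 : ∀ n, ε n ≤ 1 / 2 := fun n => by
    simp only [hεdef]
    gcongr
    linarith [(Nat.cast_nonneg n : (0 : ℝ) ≤ n)]
  have hε : Tendsto ε atTop (𝓝 0) :=
    tendsto_const_nhds.div_atTop (tendsto_atTop_add_const_right _ _ tendsto_natCast_atTop_atTop)
  have hρ' : Tendsto (fun n => ε n * ρ) atTop (𝓝 0) := by simpa using hε.mul_const ρ
  choose K hK using fun n => exists_isMollifier (mul_pos (hε0 n) hρ)
  have hsub : ∀ n, ∀ z ∈ U, Metric.closedBall ((1 - ε n) • z + ε n • c) (ε n * ρ) ⊆ U := by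
    intro n z hz y hy
    -- A point y close to the contracted z is the convex combination of z and this u with weights 1
    -- - ε and ε, and u lies in the ball around c.
    set u := c + (ε n)⁻¹ • (y - ((1 - ε n) • z + ε n • c)) with hu
    have huU : u ∈ U := hball (by
      rw [mem_closedBall_iff_norm] at hy ⊢
      rw [hu, add_sub_cancel_left, norm_smul, norm_inv, Real.norm_of_nonneg (hε0 n).le,
        inv_mul_le_iff₀ (hε0 n)]
      exact hy)
    have := hUc hz huU (a := 1 - ε n) (b := ε n) (by linarith [hε2 n]) (hε0 n).le (by ring)
    convert this using 1
    rw [hu, smul_add, smul_smul, mul_inv_cancel₀ (hε0 n).ne']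
    module
  refine ⟨fun n z => conv (U.indicator f₀) (K n) ((1 - ε n) • z + ε n • c),
    H1Approx.congr hUo hfL hff.symm ⟨fun n => ?_, ?_, fun i => ?_⟩⟩
  · exact ((hK n).contDiff_conv hFloc).comp (by fun_prop)
  · refine (tendsto_eLpNorm_conv hUo hUb hε2 hε hρ' hK c hFm hFL).congr fun n => ?_
    refine eLpNorm_congr_ae ?_
    rw [Filter.EventuallyEq, ae_restrict_iff' hUo.measurableSet]
    exact ae_of_all _ fun z hz => by rw [indicator_of_mem hz]
  · have t1 := tendsto_eLpNorm_conv hUo hUb hε2 hε hρ' hK c (hGm i) (hGL i)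
    -- The chain rule factor 1 - ε leaves the additional error ε times the derivative, which tends
    -- to zero in L₂.
    have t2 : Tendsto (fun n => ENNReal.ofReal (ε n) *
        eLpNorm (U.indicator (g i)) 2 (volume.restrict U)) atTop (𝓝 0) := by
      have := ENNReal.Tendsto.mul_const (b := eLpNorm (U.indicator (g i)) 2 (volume.restrict U))
        (ENNReal.tendsto_ofReal hε) (Or.inr ((hGL i).restrict U).eLpNorm_ne_top)
      simpa using this
    have t3 := t1.add t2
    rw [add_zero] at t3
    refine tendsto_of_tendsto_of_tendsto_of_le_of_le tendsto_const_nhds t3 (fun _ => zero_le)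
      fun n => ?_
    have hA : Continuous fun z : Plane => (1 - ε n) • z + ε n • c := by fun_prop
    have hcm : Continuous (fun z => conv (U.indicator (g i)) (K n) ((1 - ε n) • z + ε n • c)) :=
      ((hK n).contDiff_conv ((hGL i).locallyIntegrable (by norm_num))).continuous.comp hA
    have e : eLpNorm (fun z => pd i (fun z => conv (U.indicator f₀) (K n)
          ((1 - ε n) • z + ε n • c)) z - wpd U i f₀ z) 2 (volume.restrict U) =
        eLpNorm ((1 - ε n) • (fun z => conv (U.indicator (g i)) (K n) ((1 - ε n) • z + ε n • c) -
          U.indicator (g i) z) + (-ε n) • (U.indicator (g i))) 2 (volume.restrict U) := by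
      refine eLpNorm_congr_ae ?_
      filter_upwards [hgg i, ae_restrict_mem hUo.measurableSet] with z hz hzU
      rw [hz, pd_conv_dilation hUo hFloc (hgw i) (hK n) (hsub n z hzU)]
      simp only [Pi.add_apply, Pi.smul_apply, smul_eq_mul, indicator_of_mem hzU]
      ring
    simp only
    rw [e]
    refine (eLpNorm_add_le ?_ ?_ (by norm_num)).trans (add_le_add ?_ ?_)
    · exact ((hcm.aestronglyMeasurable).sub ((hGL i).1.restrict)).const_smul _
    · exact ((hGL i).1.restrict).const_smul _
    · rw [eLpNorm_const_smul]
      refine mul_le_of_le_one_left zero_le ?_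
      rw [Real.enorm_eq_ofReal (by linarith [hε2 n]), ENNReal.ofReal_le_one]
      linarith [hε0 n]
    · rw [eLpNorm_const_smul, enorm_neg, Real.enorm_eq_ofReal (hε0 n).le]

/-- Functions in `H¹` of a triangle have a trace. -/
lemma MemH1.exists_isTrace {v : Fin 3 → Plane} (hv : AffineIndependent ℝ v) {f : Plane → ℝ}
    (hf : MemH1 (openTriangle v) f) : ∃ g, IsTrace (openTriangle v) f g := by
  obtain ⟨w, hw⟩ := exists_h1Approx_of_convex (isOpen_openTriangle v) (isBounded_openTriangle v)
    (convex_openTriangle v) (openTriangle_nonempty hv) hf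
  obtain ⟨g, hg, hgv⟩ := hw.exists_l2Tendsto (hasTraceInequality_openTriangle hv)
    (fun f hf => memLp_of_continuous_of_isBounded
      ((isBounded_openTriangle v).closure.subset frontier_subset_closure)
      (arcLength_frontier_openTriangle_lt_top hv) (measurableSet_frontier_openTriangle v) hf) hf
  exact ⟨g, .of_h1Approx hf hg hw hgv⟩

/-! ### A trace inequality for polynomials -/

/-- The coefficients of the polynomial that reproduces the value at `0` of polynomials of degree
at most `n` in `L₂(0, 1)`. -/
lemma exists_kernel_coeff (n : ℕ) : ∃ c : ℕ → ℝ, c 0 = ((n : ℝ) + 1) ^ 2 ∧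
    ∀ m ≤ n, ∑ j ∈ Finset.range (n + 1), c j * ((m : ℝ) + j + 1)⁻¹ = if m = 0 then 1 else 0 := by
  set s := Finset.range (n + 1) with hs
  set x : ℕ → ℝ := fun j => -((j : ℝ) + 1) with hx
  -- The sum over j is the partial fraction expansion of N(t)/∏(t + j + 1). The zeros of N at 1, …,
  -- n give the orthogonality relations, and its normalisation makes the quotient 1 at t = 0. The
  -- coefficients c j are the residues, obtained from Lagrange interpolation of N at the poles -(j +
  -- 1).
  set N : Polynomial ℝ := Polynomial.C ((-1) ^ n * ((n : ℝ) + 1)) *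
    ∏ i ∈ Finset.range n, (Polynomial.X - Polynomial.C ((i : ℝ) + 1)) with hN
  have hinj : Set.InjOn x s := fun i _ j _ h => by
    simp only [hx, neg_inj, add_left_inj, Nat.cast_inj] at h
    exact h
  have hdeg : N.degree < s.card := by
    have hn1 : ((-1) ^ n * ((n : ℝ) + 1)) ≠ 0 := by positivity
    rw [hN, Polynomial.degree_C_mul hn1, Polynomial.degree_prod,
      Finset.sum_congr rfl fun i _ => Polynomial.degree_X_sub_C _]
    simp only [hs, Finset.sum_const, Finset.card_range, nsmul_eq_mul, mul_one]
    exact_mod_cast Nat.lt_succ_self n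
  have hint := Lagrange.eq_interpolate hinj hdeg
  have hNeval : ∀ t : ℝ, N.eval t = (n + 1) * ∏ i ∈ Finset.range n, ((i : ℝ) + 1 - t) := by
    intro t
    rw [hN, Polynomial.eval_mul, Polynomial.eval_C, Polynomial.eval_prod]
    have : ∏ i ∈ Finset.range n, Polynomial.eval t (Polynomial.X - Polynomial.C ((i : ℝ) + 1)) =
        (-1) ^ n * ∏ i ∈ Finset.range n, ((i : ℝ) + 1 - t) := by
      rw [← Finset.card_range n, ← Finset.prod_const, Finset.card_range, ← Finset.prod_mul_distrib]
      refine Finset.prod_congr rfl fun i _ => ?_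
      simp
    rw [this]
    have h1 : ((-1 : ℝ) ^ n) * (-1) ^ n = 1 := by rw [← mul_pow]; simp
    linear_combination ((n : ℝ) + 1) * (∏ i ∈ Finset.range n, ((i : ℝ) + 1 - t)) * h1
  refine ⟨fun j => Lagrange.nodalWeight s x j * N.eval (x j), ?_, fun m hm => ?_⟩
  · simp only [hNeval, Lagrange.nodalWeight]
    have he : s.erase 0 = (Finset.range n).map ⟨Nat.succ, Nat.succ_injective⟩ := by
      rw [hs, Finset.range_eq_Ico, Finset.range_eq_Ico]
      ext j
      simp only [Finset.mem_erase, Finset.mem_Ico, Finset.mem_map, Function.Embedding.coeFn_mk]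
      constructor
      · rintro ⟨h0, -, h2⟩
        exact ⟨j - 1, by omega, by omega⟩
      · rintro ⟨k, hk, rfl⟩
        omega
    rw [he, Finset.prod_map]
    simp only [hx, Function.Embedding.coeFn_mk, Nat.cast_succ, Nat.cast_zero]
    have h1 : ∀ k : ℕ, ∏ i ∈ Finset.range k, ((i : ℝ) + 1 - -(0 + 1)) =
        (k + 1) * ∏ i ∈ Finset.range k, ((i : ℝ) + 1) := by
      intro k
      induction k with
      | zero => simp
      | succ k ih => rw [Finset.prod_range_succ, Finset.prod_range_succ, ih]; push_cast; ring
    have h2 : ∏ i ∈ Finset.range n, (-(0 + 1) - -((i : ℝ) + 1 + 1))⁻¹ =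
        (∏ i ∈ Finset.range n, ((i : ℝ) + 1))⁻¹ := by
      rw [← Finset.prod_inv_distrib]
      refine Finset.prod_congr rfl fun i _ => ?_
      congr 1; ring
    rw [h1, h2]
    have h3 : ∏ i ∈ Finset.range n, ((i : ℝ) + 1) ≠ 0 :=
      Finset.prod_ne_zero_iff.2 fun i _ => by positivity
    field_simp
  · have hne : ∀ i ∈ s, (m : ℝ) ≠ x i := fun i _ h => by
      simp only [hx] at h
      have : (0 : ℝ) ≤ m := Nat.cast_nonneg m
      have : (0 : ℝ) ≤ i := Nat.cast_nonneg i
      linarith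
    have h1 := Lagrange.eval_interpolate_not_at_node (fun i => N.eval (x i)) hne
    rw [← hint] at h1
    have hnodal : Polynomial.eval (m : ℝ) (Lagrange.nodal s x) =
        ∏ i ∈ s, ((m : ℝ) + i + 1) := by
      rw [Lagrange.eval_nodal]
      refine Finset.prod_congr rfl fun i _ => ?_
      simp only [hx]; ring
    have hnodal0 : Polynomial.eval (m : ℝ) (Lagrange.nodal s x) ≠ 0 := by
      rw [hnodal]
      exact Finset.prod_ne_zero_iff.2 fun i _ => by positivity
    have h2 : ∑ j ∈ s, Lagrange.nodalWeight s x j * N.eval (x j) * ((m : ℝ) + j + 1)⁻¹ =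
        ∑ i ∈ s, Lagrange.nodalWeight s x i * ((m : ℝ) - x i)⁻¹ * N.eval (x i) := by
      refine Finset.sum_congr rfl fun j _ => ?_
      simp only [hx]
      rw [show (m : ℝ) - -((j : ℝ) + 1) = (m : ℝ) + j + 1 by ring]
      ring
    rw [h2]
    apply mul_left_cancel₀ hnodal0
    rw [← h1, hNeval, hnodal]
    split_ifs with h0
    · subst h0
      simp only [Nat.cast_zero, sub_zero, zero_add, mul_one]
      rw [hs, Finset.prod_range_succ]
      ring
    · rw [mul_zero]
      obtain ⟨k, rfl⟩ := Nat.exists_eq_succ_of_ne_zero h0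
      rw [Finset.prod_eq_zero (i := k) (Finset.mem_range.2 (by omega)) (by push_cast; ring),
        mul_zero]

/-- The coefficients of `exists_kernel_coeff` define a polynomial K that reproduces the value at 0
in L₂(0, 1) and has K(0) = (n+1)². The bound is Cauchy–Schwarz against K. -/
lemma sq_eval_zero_le (n : ℕ) (f : Polynomial ℝ) (hf : f.natDegree ≤ n) :
    f.eval 0 ^ 2 ≤ ((n : ℝ) + 1) ^ 2 * ∫ t in (0 : ℝ)..1, f.eval t ^ 2 := by
  obtain ⟨c, hc0, hc⟩ := exists_kernel_coeff n
  set K : Polynomial ℝ := ∑ j ∈ Finset.range (n + 1), Polynomial.C (c j) * Polynomial.X ^ j with hK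
  have hKdeg : K.natDegree ≤ n := by
    refine Polynomial.natDegree_sum_le_of_forall_le _ _ fun j hj => ?_
    refine (Polynomial.natDegree_C_mul_X_pow_le _ _).trans ?_
    have := Finset.mem_range.1 hj
    omega
  have hK0 : K.eval 0 = ((n : ℝ) + 1) ^ 2 := by
    rw [hK, Polynomial.eval_finsetSum, Finset.sum_eq_single 0]
    · simp [hc0]
    · intro j _ hj
      simp [hj]
    · simp
  have hI : ∀ g : Polynomial ℝ, IntervalIntegrable (fun t => g.eval t) volume 0 1 := fun g =>
    g.continuous.intervalIntegrable _ _
  have hrep : ∀ g : Polynomial ℝ, g.natDegree ≤ n →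
      ∫ t in (0 : ℝ)..1, g.eval t * K.eval t = g.eval 0 := by
    intro g hg
    have e : ∀ t : ℝ, g.eval t * K.eval t = ∑ m ∈ Finset.range (n + 1),
        ∑ j ∈ Finset.range (n + 1), g.coeff m * (c j * t ^ (m + j)) := by
      intro t
      rw [Polynomial.eval_eq_sum_range' (Nat.lt_succ_of_le hg), hK, Polynomial.eval_finsetSum,
        Finset.sum_mul_sum]
      refine Finset.sum_congr rfl fun m _ => Finset.sum_congr rfl fun j _ => ?_
      simp only [Polynomial.eval_mul, Polynomial.eval_C, Polynomial.eval_pow, Polynomial.eval_X]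
      ring
    simp only [e]
    rw [intervalIntegral.integral_finsetSum fun m _ => by
      exact (by fun_prop : Continuous _).intervalIntegrable _ _]
    have e2 : ∀ m ∈ Finset.range (n + 1), (∫ t in (0 : ℝ)..1, ∑ j ∈ Finset.range (n + 1),
        g.coeff m * (c j * t ^ (m + j))) = if m = 0 then g.coeff m else 0 := by
      intro m hm
      rw [intervalIntegral.integral_finsetSum fun j _ => by
        exact (by fun_prop : Continuous _).intervalIntegrable _ _]
      simp only [intervalIntegral.integral_const_mul, integral_pow]
      rw [← Finset.mul_sum]
      have := hc m (Nat.lt_succ_iff.1 (Finset.mem_range.1 hm))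
      have e3 : ∑ j ∈ Finset.range (n + 1), c j * ((1 ^ (m + j + 1) - 0 ^ (m + j + 1)) /
          (((m + j : ℕ) : ℝ) + 1)) = ∑ j ∈ Finset.range (n + 1), c j * ((m : ℝ) + j + 1)⁻¹ := by
        refine Finset.sum_congr rfl fun j _ => ?_
        push_cast
        simp
      rw [e3, this]
      split_ifs <;> simp
    rw [Finset.sum_congr rfl e2, Finset.sum_ite_eq']
    simp [Polynomial.coeff_zero_eq_eval_zero]
  have hn : (0 : ℝ) < ((n : ℝ) + 1) ^ 2 := by positivity
  -- The value of b that minimises the L₂ distance of f from bK; non-negativity of this minimum is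
  -- the claim.
  set b : ℝ := f.eval 0 / ((n : ℝ) + 1) ^ 2 with hb
  have hpos : 0 ≤ ∫ t in (0 : ℝ)..1, (f.eval t - b * K.eval t) ^ 2 :=
    intervalIntegral.integral_nonneg zero_le_one fun t _ => sq_nonneg _
  have hexp : ∫ t in (0 : ℝ)..1, (f.eval t - b * K.eval t) ^ 2 =
      (∫ t in (0 : ℝ)..1, f.eval t ^ 2) - 2 * b * f.eval 0 + b ^ 2 * K.eval 0 := by
    rw [← hrep f hf, ← hrep K hKdeg, ← intervalIntegral.integral_const_mul,
      ← intervalIntegral.integral_const_mul, ← intervalIntegral.integral_sub,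
      ← intervalIntegral.integral_add]
    · refine intervalIntegral.integral_congr fun t _ => ?_
      ring
    all_goals exact (by fun_prop : Continuous _).intervalIntegrable _ _
  rw [hexp, hK0] at hpos
  have : b * ((n : ℝ) + 1) ^ 2 = f.eval 0 := div_mul_cancel₀ _ hn.ne'
  rw [← this] at hpos ⊢
  nlinarith

/-- On (0, 1/2) the weight is at least 1/2, and rescaling f to this interval costs another factor 2.
The weight 1 - t is the area element of the collapsed coordinates. -/
lemma sq_eval_zero_le_weighted (n : ℕ) (f : Polynomial ℝ) (hf : f.natDegree ≤ n) :
    f.eval 0 ^ 2 ≤ 4 * ((n : ℝ) + 1) ^ 2 * ∫ t in (0 : ℝ)..1, (1 - t) * f.eval t ^ 2 := by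
  set g : Polynomial ℝ := f.comp (Polynomial.C (1 / 2) * Polynomial.X) with hg
  have hgd : g.natDegree ≤ n := by
    refine (Polynomial.natDegree_comp_le).trans ?_
    have := (Polynomial.natDegree_C_mul_le (1 / 2 : ℝ) Polynomial.X).trans Polynomial.natDegree_X_le
    calc _ ≤ f.natDegree * 1 := Nat.mul_le_mul_left _ this
      _ ≤ n := by omega
  have hge : ∀ t, g.eval t = f.eval (1 / 2 * t) := fun t => by simp [hg]
  have h1 := sq_eval_zero_le n g hgd
  simp only [hge, mul_zero] at h1
  have h2 := intervalIntegral.integral_comp_mul_left (a := 0) (b := 1) (fun t => f.eval t ^ 2)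
    (c := 1 / 2) (by norm_num)
  rw [h2] at h1
  have hcont : Continuous fun t : ℝ => (1 - t) * f.eval t ^ 2 := by fun_prop
  have hcont2 : Continuous fun t : ℝ => f.eval t ^ 2 := by fun_prop
  have h3 : ∫ t in (0 : ℝ)..(1 / 2), f.eval t ^ 2 ≤
      2 * ∫ t in (0 : ℝ)..(1 / 2), (1 - t) * f.eval t ^ 2 := by
    rw [← intervalIntegral.integral_const_mul]
    refine intervalIntegral.integral_mono_on (by norm_num) (hcont2.intervalIntegrable _ _)
      ((hcont.intervalIntegrable _ _).const_mul _) fun t ht => ?_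
    nlinarith [sq_nonneg (f.eval t), ht.2]
  have h4 : ∫ t in (0 : ℝ)..(1 / 2), (1 - t) * f.eval t ^ 2 ≤
      ∫ t in (0 : ℝ)..1, (1 - t) * f.eval t ^ 2 := by
    rw [← intervalIntegral.integral_add_adjacent_intervals (hcont.intervalIntegrable 0 (1 / 2))
      (hcont.intervalIntegrable (1 / 2) 1), le_add_iff_nonneg_right]
    exact intervalIntegral.integral_nonneg (by norm_num) fun t ht =>
      mul_nonneg (by linarith [ht.2]) (sq_nonneg _)
  refine h1.trans ?_
  rw [mul_zero, mul_one, smul_eq_mul]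
  have hn : (0 : ℝ) ≤ ((n : ℝ) + 1) ^ 2 := by positivity
  have : (1 / 2 : ℝ)⁻¹ * ∫ t in (0 : ℝ)..(1 / 2), f.eval t ^ 2 ≤
      4 * ∫ t in (0 : ℝ)..1, (1 - t) * f.eval t ^ 2 := by
    norm_num
    linarith
  nlinarith [mul_le_mul_of_nonneg_left this hn]

/-- The polynomial function on the plane given by a polynomial in two variables. -/
def polyFun (P : MvPolynomial (Fin 2) ℝ) (z : Plane) : ℝ := MvPolynomial.eval (fun i => z i) P

lemma contDiff_polyFun (P : MvPolynomial (Fin 2) ℝ) : ContDiff ℝ ∞ (polyFun P) := by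
  induction P using MvPolynomial.induction_on with
  | C a =>
    have : polyFun (MvPolynomial.C a) = fun _ => a := by ext; simp [polyFun]
    rw [this]
    exact contDiff_const
  | add p q hp hq =>
    have : polyFun (p + q) = fun z => polyFun p z + polyFun q z := by ext; simp [polyFun]
    rw [this]
    exact hp.add hq
  | mul_X p i hp =>
    have hX : ContDiff ℝ ∞ (fun z : Plane => z i) := by fun_prop
    have : polyFun (p * MvPolynomial.X i) = fun z => polyFun p z * z i := by ext; simp [polyFun]
    rw [this]
    exact hp.mul hX

lemma exists_polynomial_segPt (P : MvPolynomial (Fin 2) ℝ) {p : ℕ} (hP : P.totalDegree ≤ p)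
    (a b : Plane) : ∃ f : Polynomial ℝ, f.natDegree ≤ p ∧
      ∀ t, f.eval t = polyFun P (segPt a b t) := by
  refine ⟨MvPolynomial.aeval (fun i => Polynomial.C (b i - a i) * Polynomial.X +
    Polynomial.C (a i)) P, ?_, fun t => ?_⟩
  · have := MvPolynomial.aeval_natDegree_le P hP (fun i => Polynomial.C (b i - a i) * Polynomial.X +
      Polynomial.C (a i)) (n := 1) fun i => Polynomial.natDegree_linear_le
    simpa using this
  · rw [polyFun, ← Polynomial.coe_evalRingHom, MvPolynomial.aeval_def, MvPolynomial.eval₂_eq_eval_map,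
      MvPolynomial.eval_map, ← MvPolynomial.eval₂_id, MvPolynomial.hom_eval₂]
    congr 1
    · ext; simp
    · ext i
      simp [segPt, mul_comm, add_comm]

/-- For each point of the edge, the polynomial is restricted to the segment to the opposite vertex,
where the one-dimensional bound controls the value on the edge. Integration over the edge recovers
the area integral in collapsed coordinates. -/
lemma abs_mul_integral_edge_sq_le {v : Fin 3 → Plane} (hv : AffineIndependent ℝ v) (i : Fin 3)
    (P : MvPolynomial (Fin 2) ℝ) {p : ℕ} (hP : P.totalDegree ≤ p) :
    |triDet v| * ∫ r in (0 : ℝ)..1, polyFun P (edgePt v i r) ^ 2 ≤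
      4 * ((p : ℝ) + 1) ^ 2 * ∫ z in openTriangle v, polyFun P z ^ 2 := by
  have hPc := (contDiff_polyFun P).continuous
  have hc2 : Continuous fun z => polyFun P z ^ 2 := hPc.pow 2
  rw [setIntegral_openTriangle_collapsed hv i hc2, ← mul_assoc, mul_comm _ |triDet v|, mul_assoc]
  refine mul_le_mul_of_nonneg_left ?_ (abs_nonneg _)
  have hcont : Continuous (fun q : ℝ × ℝ =>
      (1 - q.1) * polyFun P (segPt (edgePt v i q.2) (v i) q.1) ^ 2) := by
    refine (continuous_const.sub continuous_fst).mul ((hPc.comp ?_).pow 2)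
    unfold segPt
    have := (continuous_edgePt v i).comp (continuous_snd (X := ℝ) (Y := ℝ))
    simp only [Function.comp_def] at this
    fun_prop
  have hswap : ∫ s in (0 : ℝ)..1, ∫ r in (0 : ℝ)..1,
      (1 - s) * polyFun P (segPt (edgePt v i r) (v i) s) ^ 2 =
      ∫ r in (0 : ℝ)..1, ∫ s in (0 : ℝ)..1,
      (1 - s) * polyFun P (segPt (edgePt v i r) (v i) s) ^ 2 := by
    simp only [intervalIntegral.integral_of_le zero_le_one]
    refine integral_integral_swap ?_
    rw [Measure.prod_restrict]
    refine (hcont.continuousOn.integrableOn_compact (isCompact_Icc.prod isCompact_Icc)).mono_set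
      (prod_mono Ioc_subset_Icc_self Ioc_subset_Icc_self)
  rw [hswap, ← intervalIntegral.integral_const_mul]
  have hc3 : Continuous fun r => ∫ s in (0 : ℝ)..1,
      (1 - s) * polyFun P (segPt (edgePt v i r) (v i) s) ^ 2 :=
    intervalIntegral.continuous_parametric_intervalIntegral_of_continuous'
      (f := fun r s => (1 - s) * polyFun P (segPt (edgePt v i r) (v i) s) ^ 2)
      (hcont.comp continuous_swap) 0 1
  refine intervalIntegral.integral_mono_on zero_le_one
    ((hc2.comp (continuous_edgePt v i)).intervalIntegrable _ _)
    ((hc3.intervalIntegrable _ _).const_mul _) fun r _ => ?_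
  obtain ⟨f, hf, hfe⟩ := exists_polynomial_segPt P hP (edgePt v i r) (v i)
  have := sq_eval_zero_le_weighted p f hf
  simp only [hfe] at this
  simpa [segPt] using this

/-- The radius of an inscribed disc does not exceed any height, and the height is the reciprocal of
the norm of the barycentric gradient. -/
lemma inradius_mul_norm_baryGrad_le {v : Fin 3 → Plane} (hv : AffineIndependent ℝ v) (i : Fin 3) :
    inradius (openTriangle v) * ‖baryGrad v i‖ ≤ 1 := by
  have hD := triDet_ne_zero hv
  have hG := norm_pos_iff.2 (baryGrad_ne_zero hD i)
  rw [← le_div_iff₀ hG]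
  refine csSup_le ⟨0, le_rfl, 0, by simp⟩ ?_
  rintro r ⟨hr0, c, hc⟩
  rw [le_div_iff₀ hG]
  by_contra hcon
  push Not at hcon
  have hr : 0 < r := by
    rcases hr0.eq_or_lt with h | h
    · rw [← h] at hcon; linarith
    · exact h
  have hlt : ‖baryGrad v i‖⁻¹ < r := by rwa [inv_lt_iff_one_lt_mul₀ hG]
  have hcT : c ∈ openTriangle v := hc (Metric.mem_ball_self hr)
  -- If the radius exceeded the height, moving from the centre by the height against the gradient
  -- would stay in the triangle. But it lowers the barycentric coordinate by 1, and that coordinate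
  -- is less than 1 at the centre.
  have hyT : c - (‖baryGrad v i‖⁻¹ ^ 2) • baryGrad v i ∈ openTriangle v := hc (by
    rw [mem_ball_iff_norm, sub_sub_cancel_left, norm_neg, norm_smul, norm_pow, norm_inv, norm_norm,
      pow_two, mul_assoc, inv_mul_cancel₀ hG.ne', mul_one]
    exact hlt)
  rw [openTriangle_eq hv] at hcT hyT
  have h1 := bary_sub v i (c - (‖baryGrad v i‖⁻¹ ^ 2) • baryGrad v i) c
  rw [sub_sub_cancel_left, inner_neg_left, inner_smul_left, real_inner_self_eq_norm_sq] at h1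
  simp only [conj_trivial] at h1
  rw [← mul_pow, inv_mul_cancel₀ hG.ne', one_pow] at h1
  have hs := sum_bary hD c
  rw [sum_fin_three_shift _ i] at hs
  have := hcT (i + 1)
  have := hcT (i + 2)
  have := hyT i
  linarith

/-- The trace inequality for polynomials on shape-regular triangles, explicit in the degree. -/
lemma polynomial_trace_inequality {v : Fin 3 → Plane} (hv : AffineIndependent ℝ v) {σ : ℝ}
    (hσ : Metric.diam (openTriangle v) ≤ σ * inradius (openTriangle v))
    (P : MvPolynomial (Fin 2) ℝ) {p : ℕ} (hp : 1 ≤ p) (hP : P.totalDegree ≤ p) :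
    Metric.diam (openTriangle v) * ∫ z in frontier (openTriangle v), polyFun P z ^ 2 ∂arcLength ≤
      48 * |σ| * (p : ℝ) ^ 2 * ∫ z in openTriangle v, polyFun P z ^ 2 := by
  have hc2 : Continuous fun z => polyFun P z ^ 2 := (contDiff_polyFun P).continuous.pow 2
  have hT : 0 ≤ ∫ z in openTriangle v, polyFun P z ^ 2 := integral_nonneg fun z => sq_nonneg _
  have hrho : 0 ≤ inradius (openTriangle v) := Real.sSup_nonneg fun r hr => hr.1
  have hp1 : (1 : ℝ) ≤ p := by exact_mod_cast hp
  have hh : ∀ i, Metric.diam (openTriangle v) * ‖baryGrad v i‖ ≤ |σ| := by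
    intro i
    have h1 := inradius_mul_norm_baryGrad_le hv i
    have h2 : Metric.diam (openTriangle v) ≤ |σ| * inradius (openTriangle v) :=
      hσ.trans (mul_le_mul_of_nonneg_right (le_abs_self σ) hrho)
    calc _ ≤ |σ| * inradius (openTriangle v) * ‖baryGrad v i‖ := by gcongr
      _ = |σ| * (inradius (openTriangle v) * ‖baryGrad v i‖) := by ring
      _ ≤ |σ| * 1 := by gcongr
      _ = |σ| := mul_one _
  rw [setIntegral_frontier_of_continuous hv hc2, Finset.mul_sum, Finset.mul_sum]
  have hi : ∀ i ∈ Finset.univ, Metric.diam (openTriangle v) * (|triDet v| * (‖baryGrad v i‖ *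
      ∫ t in (0 : ℝ)..1, polyFun P (edgePt v i t) ^ 2)) ≤
      |σ| * (16 * (p : ℝ) ^ 2 * ∫ z in openTriangle v, polyFun P z ^ 2) := by
    intro i _
    have h1 := abs_mul_integral_edge_sq_le hv i P hP
    have h2 : 4 * ((p : ℝ) + 1) ^ 2 * ∫ z in openTriangle v, polyFun P z ^ 2 ≤
        -- Uses p + 1 ≤ 2p, which needs p ≥ 1; the final constant 48 is 16 for each of three edges.
        16 * (p : ℝ) ^ 2 * ∫ z in openTriangle v, polyFun P z ^ 2 := by
      refine mul_le_mul_of_nonneg_right ?_ hT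
      nlinarith
    calc _ = (Metric.diam (openTriangle v) * ‖baryGrad v i‖) *
        (|triDet v| * ∫ t in (0 : ℝ)..1, polyFun P (edgePt v i t) ^ 2) := by ring
      _ ≤ |σ| * (16 * (p : ℝ) ^ 2 * ∫ z in openTriangle v, polyFun P z ^ 2) := by
        refine mul_le_mul (hh i) (h1.trans h2) (mul_nonneg (abs_nonneg _) ?_) (abs_nonneg _)
        exact intervalIntegral.integral_nonneg zero_le_one fun t _ => sq_nonneg _
  refine (Finset.sum_le_sum hi).trans (le_of_eq ?_)
  rw [Finset.sum_const, Finset.card_univ, Fintype.card_fin]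
  simp only [nsmul_eq_mul]
  push_cast
  ring

/-! ### The structure of triangulations -/

/-- The Lipschitz property excludes slits and punctures: near a boundary point, the points strictly
above the graph are outside the closure and accumulate at that point. It is needed because a
triangulation prescribes only the closure of Ω. -/
lemma IsPolygonalDomain.interior_closure_subset {Ω : Set Plane} (hΩ : IsPolygonalDomain Ω) :
    interior (closure Ω) ⊆ Ω := by
  intro z hz
  by_contra hzΩ
  have hzf : z ∈ frontier Ω := by
    rw [hΩ.isOpen.frontier_eq]
    exact ⟨interior_subset hz, hzΩ⟩
  obtain ⟨R, r, K, f, hr, hf, h⟩ := hΩ.lipschitz z hzf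
  have hz0 : f ((R z) 0) ≤ (R z) 1 := by
    by_contra hc
    exact hzΩ ((h z (Metric.mem_ball_self hr)).2 (not_le.1 hc))
  set W : Set Plane := Metric.ball z r ∩ {y | f ((R y) 0) < (R y) 1} with hW
  have hWo : IsOpen W := by
    refine Metric.isOpen_ball.inter (isOpen_lt ?_ ?_)
    · exact hf.continuous.comp (by fun_prop)
    · fun_prop
  have hdisj : Disjoint W (closure Ω) := by
    refine Disjoint.closure_right ?_ hWo
    rw [Set.disjoint_left]
    rintro y ⟨hy1, hy2⟩ hyΩ
    exact lt_asymm hy2 ((h y hy1).1 hyΩ)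
  set u : Plane := R.symm (EuclideanSpace.single 1 1) with hu
  have hlim : Tendsto (fun t : ℝ => z + t • u) (𝓝[>] 0) (𝓝 z) := by
    have : Tendsto (fun t : ℝ => z + t • u) (𝓝 0) (𝓝 (z + (0 : ℝ) • u)) :=
      (by fun_prop : Continuous fun t : ℝ => z + t • u).tendsto 0
    rw [zero_smul, add_zero] at this
    exact this.mono_left nhdsWithin_le_nhds
  have h1 := hlim.eventually (isOpen_interior.mem_nhds hz)
  have h2 := hlim.eventually (Metric.ball_mem_nhds z hr)
  obtain ⟨t, ⟨ht1, ht2⟩, ht0⟩ := ((h1.and h2).and self_mem_nhdsWithin).exists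
  refine Set.disjoint_left.1 hdisj ⟨ht2, ?_⟩ (interior_subset ht1)
  have e : R (z + t • u) = R z + t • EuclideanSpace.single 1 1 := by
    rw [map_add, map_smul, hu, LinearIsometryEquiv.apply_symm_apply]
  have ht0' : 0 < t := ht0
  rw [mem_ofPred_eq, e]
  simp
  linarith

namespace Triangulation

variable {Ω : Set Plane} (𝒯 : Triangulation Ω)

lemma isOpen_elem (k : Fin 𝒯.card) : IsOpen (𝒯.elem k) := isOpen_openTriangle _

lemma isBounded_elem (k : Fin 𝒯.card) : Bornology.IsBounded (𝒯.elem k) := isBounded_openTriangle _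

lemma closure_elem_subset (k : Fin 𝒯.card) : closure (𝒯.elem k) ⊆ closure Ω := by
  rw [← 𝒯.cover]
  exact subset_iUnion (fun k => closure (openTriangle (𝒯.vert k))) k

lemma elem_subset (hΩ : IsPolygonalDomain Ω) (k : Fin 𝒯.card) : 𝒯.elem k ⊆ Ω :=
  (interior_maximal (subset_closure.trans (𝒯.closure_elem_subset k)) (𝒯.isOpen_elem k)).trans
    hΩ.interior_closure_subset

lemma volume_frontier_elem (k : Fin 𝒯.card) : volume (frontier (𝒯.elem k)) = 0 :=
  (convex_openTriangle (𝒯.vert k)).addHaar_frontier volume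

lemma ae_mem_elem : ∀ᵐ z ∂(volume : Measure Plane), z ∈ closure Ω → ∃ k, z ∈ 𝒯.elem k := by
  have : ∀ᵐ z ∂(volume : Measure Plane), ∀ k, z ∉ frontier (𝒯.elem k) :=
    ae_all_iff.2 fun k => measure_eq_zero_iff_ae_notMem.1 (𝒯.volume_frontier_elem k)
  filter_upwards [this] with z hz hzΩ
  rw [← 𝒯.cover, mem_iUnion] at hzΩ
  obtain ⟨k, hk⟩ := hzΩ
  refine ⟨k, ?_⟩
  by_contra hc
  exact hz k (by rw [(𝒯.isOpen_elem k).frontier_eq]; exact ⟨hk, hc⟩)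

lemma setIntegral_eq_sum_elem (hΩ : IsPolygonalDomain Ω) {f : Plane → ℝ} (hf : IntegrableOn f Ω) :
    ∫ z in Ω, f z = ∑ k, ∫ z in 𝒯.elem k, f z := by
  have hae : Ω =ᵐ[volume] (⋃ k, 𝒯.elem k : Set Plane) := by
    filter_upwards [𝒯.ae_mem_elem] with z hz
    refine propext ⟨fun h => ?_, fun h => ?_⟩
    · exact mem_iUnion.2 (hz (subset_closure h))
    · obtain ⟨k, hk⟩ := mem_iUnion.1 h
      exact 𝒯.elem_subset hΩ k hk
  rw [setIntegral_congr_set hae, integral_iUnion_fintype (fun k => (𝒯.isOpen_elem k).measurableSet)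
    (fun k l hkl => 𝒯.disjoint k l hkl) fun k => hf.mono_set (𝒯.elem_subset hΩ k)]

/-- The set of all vertices. -/
def vertices : Set Plane := ⋃ k, range (𝒯.vert k)

lemma finite_vertices : 𝒯.vertices.Finite := finite_iUnion fun _ => finite_range _

lemma ae_notMem_vertices : ∀ᵐ z ∂arcLength, z ∉ 𝒯.vertices :=
  ae_arcLength_notMem_of_finite 𝒯.finite_vertices

/-! ### Local structure of the skeleton away from the vertices. -/

variable {𝒯}

lemma exists_openEdge {z : Plane} (hz : z ∉ 𝒯.vertices) {k : Fin 𝒯.card}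
    (hk : z ∈ frontier (𝒯.elem k)) : ∃ i, z ∈ openEdge (𝒯.vert k) i :=
  exists_mem_openEdge (𝒯.nondegenerate k) hk fun h => hz (mem_iUnion.2 ⟨k, h⟩)

lemma exists_ball_elem {z : Plane} (hz : z ∉ 𝒯.vertices) {k : Fin 𝒯.card}
    (hk : z ∈ frontier (𝒯.elem k)) : ‖outerNormal (𝒯.elem k) z‖ = 1 ∧
    ∀ᶠ y in 𝓝 z, (y ∈ 𝒯.elem k ↔ ⟪y - z, outerNormal (𝒯.elem k) z⟫ < 0) ∧
      (y ∈ closure (𝒯.elem k) ↔ ⟪y - z, outerNormal (𝒯.elem k) z⟫ ≤ 0) := by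
  obtain ⟨i, hi⟩ := exists_openEdge hz hk
  have e : outerNormal (𝒯.elem k) z = edgeNormal (𝒯.vert k) i :=
    outerNormal_openTriangle (𝒯.nondegenerate k) hi
  rw [e]
  refine ⟨norm_edgeNormal (triDet_ne_zero (𝒯.nondegenerate k)) i, ?_⟩
  obtain ⟨r, hr, h⟩ := exists_ball_openTriangle (𝒯.nondegenerate k) hi
  exact Metric.eventually_nhds_iff_ball.2 ⟨r, hr, h⟩

/-- If n + m were nonzero, the points z - t(n + m) with small t > 0 would have negative product with
both normals and lie in both elements. -/
lemma outerNormal_opposite {z : Plane} (hz : z ∉ 𝒯.vertices) {k l : Fin 𝒯.card} (hkl : k ≠ l)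
    (hk : z ∈ frontier (𝒯.elem k)) (hl : z ∈ frontier (𝒯.elem l)) :
    outerNormal (𝒯.elem l) z = - outerNormal (𝒯.elem k) z := by
  obtain ⟨hnk, hbk⟩ := exists_ball_elem hz hk
  obtain ⟨hnl, hbl⟩ := exists_ball_elem hz hl
  set n := outerNormal (𝒯.elem k) z
  set m := outerNormal (𝒯.elem l) z
  by_contra hne
  have hd : 0 < ⟪n + m, n + m⟫ := by
    rw [real_inner_self_eq_norm_sq]
    have : n + m ≠ 0 := fun h => hne (eq_neg_of_add_eq_zero_right h)
    positivity
  have hnn : ⟪n, n⟫ = 1 := by rw [real_inner_self_eq_norm_sq, hnk, one_pow]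
  have hmm : ⟪m, m⟫ = 1 := by rw [real_inner_self_eq_norm_sq, hnl, one_pow]
  have hmn : ⟪m, n⟫ = ⟪n, m⟫ := real_inner_comm _ _
  rw [inner_add_left, inner_add_right, inner_add_right, hnn, hmm, hmn] at hd
  have hlim : Tendsto (fun t : ℝ => z + t • (-(n + m))) (𝓝[>] 0) (𝓝 z) := by
    have : Tendsto (fun t : ℝ => z + t • (-(n + m))) (𝓝 0) (𝓝 (z + (0 : ℝ) • (-(n + m)))) :=
      (by fun_prop : Continuous fun t : ℝ => z + t • (-(n + m))).tendsto 0
    rw [zero_smul, add_zero] at this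
    exact this.mono_left nhdsWithin_le_nhds
  obtain ⟨t, ⟨h1, h2⟩, ht0⟩ := ((hlim.eventually (hbk.and hbl)).and self_mem_nhdsWithin).exists
  have ht : 0 < t := ht0
  rw [add_sub_cancel_left] at h1 h2
  have e1 : z + t • (-(n + m)) ∈ 𝒯.elem k := h1.1.2 (by
    rw [inner_smul_left, inner_neg_left, inner_add_left, hnn, hmn, conj_trivial]
    nlinarith)
  have e2 : z + t • (-(n + m)) ∈ 𝒯.elem l := h2.1.2 (by
    rw [inner_smul_left, inner_neg_left, inner_add_left, hmm, conj_trivial]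
    nlinarith)
  exact Set.disjoint_left.1 (𝒯.disjoint k l hkl) e1 e2

lemma mem_elemsAt {z : Plane} {k : Fin 𝒯.card} :
    k ∈ 𝒯.elemsAt z ↔ z ∈ frontier (𝒯.elem k) := by
  simp [elemsAt]

/-- Three pairwise opposite unit vectors do not exist. Hanging nodes cause no trouble, being
vertices of some element. -/
lemma eq_or_eq_of_mem_elemsAt {z : Plane} (hz : z ∉ 𝒯.vertices) {k l m : Fin 𝒯.card}
    (hkl : k ≠ l) (hk : z ∈ frontier (𝒯.elem k)) (hl : z ∈ frontier (𝒯.elem l))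
    (hm : z ∈ frontier (𝒯.elem m)) : m = k ∨ m = l := by
  by_contra hc
  push Not at hc
  have h1 := outerNormal_opposite hz hkl hk hl
  have h2 := outerNormal_opposite hz hc.1.symm hk hm
  have h3 := outerNormal_opposite hz hc.2.symm hl hm
  have h4 := (exists_ball_elem hz hk).1
  rw [h2, h1, neg_neg, neg_eq_iff_add_eq_zero, ← two_smul ℝ, smul_eq_zero] at h3
  rcases h3 with h | h
  · norm_num at h
  · rw [h] at h4
    simp at h4

lemma eventually_notMem_closure {z : Plane} {k : Fin 𝒯.card} (hz : z ∉ closure (𝒯.elem k)) :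
    ∀ᶠ y in 𝓝 z, y ∉ closure (𝒯.elem k) :=
  isClosed_closure.isOpen_compl.mem_nhds hz

lemma notMem_closure_of_mem_frontier {z : Plane} {k l : Fin 𝒯.card}
    (hk : z ∈ frontier (𝒯.elem k)) (hl : z ∉ frontier (𝒯.elem l)) :
    z ∉ closure (𝒯.elem l) := by
  intro hc
  have hzl : z ∈ 𝒯.elem l := by
    by_contra h
    exact hl (by rw [(𝒯.isOpen_elem l).frontier_eq]; exact ⟨hc, h⟩)
  have hkl : k ≠ l := by
    rintro rfl
    exact hl hk
  have hd : Disjoint (closure (𝒯.elem k)) (𝒯.elem l) :=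
    (𝒯.disjoint k l hkl).closure_left (𝒯.isOpen_elem l)
  exact Set.disjoint_left.1 hd (frontier_subset_closure hk) hzl

/-- At a point off the vertices that lies on the boundary of two elements, the domain fills a
neighbourhood; in particular the point is in the domain. -/
lemma mem_of_two_elems (hΩ : IsPolygonalDomain Ω) {z : Plane} (hz : z ∉ 𝒯.vertices)
    {k l : Fin 𝒯.card} (hkl : k ≠ l) (hk : z ∈ frontier (𝒯.elem k))
    (hl : z ∈ frontier (𝒯.elem l)) : z ∈ Ω := by
  apply hΩ.interior_closure_subset
  rw [mem_interior_iff_mem_nhds]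
  obtain ⟨-, hbk⟩ := exists_ball_elem hz hk
  obtain ⟨-, hbl⟩ := exists_ball_elem hz hl
  rw [outerNormal_opposite hz hkl hk hl] at hbl
  filter_upwards [hbk, hbl] with y h1 h2
  rcases le_total ⟪y - z, outerNormal (𝒯.elem k) z⟫ 0 with h | h
  · exact 𝒯.closure_elem_subset k (h1.2.2 h)
  · exact 𝒯.closure_elem_subset l (h2.2.2 (by rw [inner_neg_right]; linarith))

lemma mem_skeleton {z : Plane} : z ∈ 𝒯.skeleton ↔ ∃ k, z ∈ frontier (𝒯.elem k) := by
  simp [skeleton]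

/-- At a point off the vertices that lies on the boundary of exactly one element, the domain is
the same half-plane as the element. -/
lemma isOuterNormal_of_one_elem (hΩ : IsPolygonalDomain Ω) {z : Plane} (hz : z ∉ 𝒯.vertices)
    {k : Fin 𝒯.card} (hk : z ∈ frontier (𝒯.elem k))
    (hone : ∀ l, z ∈ frontier (𝒯.elem l) → l = k) :
    IsOuterNormal Ω z (outerNormal (𝒯.elem k) z) := by
  obtain ⟨hn, hb⟩ := exists_ball_elem hz hk
  have hcl : ∀ᶠ y in 𝓝 z, (y ∈ closure Ω ↔ ⟪y - z, outerNormal (𝒯.elem k) z⟫ ≤ 0) := by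
    have hother : ∀ᶠ y in 𝓝 z, ∀ l, l ≠ k → y ∉ closure (𝒯.elem l) := by
      rw [Filter.eventually_all]
      intro l
      by_cases hlk : l = k
      · simp [hlk]
      · filter_upwards [eventually_notMem_closure
          (notMem_closure_of_mem_frontier hk fun h => hlk (hone l h))] with y hy _
        exact hy
    filter_upwards [hb, hother] with y h1 h2
    rw [← h1.2]
    refine ⟨fun h => ?_, fun h => 𝒯.closure_elem_subset k h⟩
    rw [← 𝒯.cover, mem_iUnion] at h
    obtain ⟨l, hl⟩ := h
    by_cases hlk : l = k
    · rw [← hlk]; exact hl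
    · exact absurd hl (h2 l hlk)
  refine ⟨hn, ?_⟩
  obtain ⟨r, hr, h⟩ := Metric.eventually_nhds_iff_ball.1 (hcl.eventually_nhds.and hb)
  refine ⟨r, hr, fun y hy => ?_⟩
  obtain ⟨h1, h2⟩ := h y hy
  refine ⟨fun hyΩ => ?_, fun hlt => 𝒯.elem_subset hΩ k (h2.1.2 hlt)⟩
  have hle : ⟪y - z, outerNormal (𝒯.elem k) z⟫ ≤ 0 := h1.self_of_nhds.1 (subset_closure hyΩ)
  -- A point of Ω on the bounding line is impossible: Ω is open, so small steps along the normal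
  -- would stay in Ω but leave the half-plane that contains its closure locally.
  refine lt_of_le_of_ne hle fun heq => ?_
  have hlim : Tendsto (fun t : ℝ => y + t • outerNormal (𝒯.elem k) z) (𝓝[>] 0) (𝓝 y) := by
    have : Tendsto (fun t : ℝ => y + t • outerNormal (𝒯.elem k) z) (𝓝 0)
        (𝓝 (y + (0 : ℝ) • outerNormal (𝒯.elem k) z)) :=
      (by fun_prop : Continuous fun t : ℝ => y + t • outerNormal (𝒯.elem k) z).tendsto 0
    rw [zero_smul, add_zero] at this
    exact this.mono_left nhdsWithin_le_nhds
  obtain ⟨t, ⟨ht1, ht2⟩, ht0⟩ := (((hlim.eventually h1).and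
    (hlim.eventually (hΩ.isOpen.mem_nhds hyΩ))).and self_mem_nhdsWithin).exists
  have ht : 0 < t := ht0
  have := ht1.1 (subset_closure ht2)
  rw [add_sub_right_comm, inner_add_left, heq, inner_smul_left, real_inner_self_eq_norm_sq, hn,
    conj_trivial] at this
  linarith

lemma notMem_of_one_elem (hΩ : IsPolygonalDomain Ω) {z : Plane} (hz : z ∉ 𝒯.vertices)
    {k : Fin 𝒯.card} (hk : z ∈ frontier (𝒯.elem k))
    (hone : ∀ l, z ∈ frontier (𝒯.elem l) → l = k) : z ∉ Ω := by
  obtain ⟨-, r, hr, h⟩ := isOuterNormal_of_one_elem hΩ hz hk hone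
  rw [h z (Metric.mem_ball_self hr)]
  simp

lemma frontier_subset_skeleton (hΩ : IsPolygonalDomain Ω) : frontier Ω ⊆ 𝒯.skeleton := by
  intro z hz
  rw [hΩ.isOpen.frontier_eq] at hz
  have := hz.1
  rw [← 𝒯.cover, mem_iUnion] at this
  obtain ⟨k, hk⟩ := this
  rw [mem_skeleton]
  refine ⟨k, ?_⟩
  rw [(𝒯.isOpen_elem k).frontier_eq]
  exact ⟨hk, fun h => hz.2 (𝒯.elem_subset hΩ k h)⟩

/-- Boundary points off the vertices belong to exactly one element. -/
lemma exists_elemsAt_eq_singleton (hΩ : IsPolygonalDomain Ω) {z : Plane} (hz : z ∉ 𝒯.vertices)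
    (hzΩ : z ∈ frontier Ω) : ∃ k, 𝒯.elemsAt z = {k} ∧
      outerNormal Ω z = outerNormal (𝒯.elem k) z ∧ ‖outerNormal Ω z‖ = 1 := by
  obtain ⟨k, hk⟩ := mem_skeleton.1 (frontier_subset_skeleton (𝒯 := 𝒯) hΩ hzΩ)
  rw [hΩ.isOpen.frontier_eq] at hzΩ
  have hone : ∀ l, z ∈ frontier (𝒯.elem l) → l = k := by
    intro l hl
    by_contra hlk
    exact hzΩ.2 (mem_of_two_elems hΩ hz hlk hl hk)
  have hn := (isOuterNormal_of_one_elem hΩ hz hk hone).outerNormal_eq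
  refine ⟨k, ?_, hn, ?_⟩
  · ext l
    rw [mem_elemsAt, Finset.mem_singleton]
    exact ⟨hone l, fun h => h ▸ hk⟩
  · rw [hn]
    exact (exists_ball_elem hz hk).1

/-- Interior points of the skeleton off the vertices belong to exactly two elements, which have
opposite normals. -/
lemma exists_elemsAt_eq_pair (hΩ : IsPolygonalDomain Ω) {z : Plane} (hz : z ∉ 𝒯.vertices)
    (hzΓ : z ∈ 𝒯.interiorSkeleton) : ∃ k l, k ≠ l ∧ 𝒯.elemsAt z = {k, l} ∧
      outerNormal (𝒯.elem l) z = - outerNormal (𝒯.elem k) z := by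
  obtain ⟨k, hk⟩ := mem_skeleton.1 hzΓ.1
  have hex : ∃ l, z ∈ frontier (𝒯.elem l) ∧ l ≠ k := by
    by_contra hc
    push Not at hc
    have h1 := notMem_of_one_elem hΩ hz hk hc
    refine hzΓ.2 ?_
    rw [hΩ.isOpen.frontier_eq]
    exact ⟨𝒯.closure_elem_subset k (frontier_subset_closure hk), h1⟩
  obtain ⟨l, hl, hlk⟩ := hex
  refine ⟨k, l, hlk.symm, ?_, outerNormal_opposite hz hlk.symm hk hl⟩
  ext m
  rw [mem_elemsAt, Finset.mem_insert, Finset.mem_singleton]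
  refine ⟨fun hm => eq_or_eq_of_mem_elemsAt hz hlk.symm hk hl hm, ?_⟩
  rintro (rfl | rfl) <;> assumption

/-! ### Measurability of the boundary portions and of the normal of the domain. -/

lemma measurableSet_frontier_elem (k : Fin 𝒯.card) : MeasurableSet (frontier (𝒯.elem k)) :=
  isClosed_frontier.measurableSet

lemma measurableSet_skeleton : MeasurableSet 𝒯.skeleton :=
  MeasurableSet.iUnion fun k => measurableSet_frontier_elem k

lemma measurableSet_interiorSkeleton : MeasurableSet 𝒯.interiorSkeleton :=
  measurableSet_skeleton.diff isClosed_frontier.measurableSet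

lemma arcLength_frontier_elem_lt_top (k : Fin 𝒯.card) : arcLength (frontier (𝒯.elem k)) < ⊤ :=
  arcLength_frontier_openTriangle_lt_top (𝒯.nondegenerate k)

lemma arcLength_skeleton_lt_top : arcLength 𝒯.skeleton < ⊤ := by
  refine (measure_iUnion_le _).trans_lt ?_
  rw [tsum_fintype]
  exact ENNReal.sum_lt_top.2 fun k _ => arcLength_frontier_elem_lt_top k

lemma isBounded_skeleton : Bornology.IsBounded 𝒯.skeleton := by
  rw [skeleton, Bornology.isBounded_iUnion]
  exact fun k => (𝒯.isBounded_elem k).closure.subset frontier_subset_closure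

/-- Subsets of the boundary that are defined in terms of the position and the normal are
measurable. -/
lemma measurableSet_setOf_outerNormal (𝒯 : Triangulation Ω) (hΩ : IsPolygonalDomain Ω)
    {Q : Plane → Plane → Prop} (hQ : ∀ n, MeasurableSet {z | Q z n}) :
    MeasurableSet {z | z ∈ frontier Ω ∧ Q z (outerNormal Ω z)} := by
  -- The normal is constant on the part of an open edge lying on the boundary, away from vertices.
  -- What remains is a subset of the finite vertex set, measurable whatever the chosen values there.
  have e : {z | z ∈ frontier Ω ∧ Q z (outerNormal Ω z)} =
      ({z | z ∈ frontier Ω ∧ Q z (outerNormal Ω z)} ∩ 𝒯.vertices) ∪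
      ⋃ k, ⋃ i, ((frontier Ω ∩ openEdge (𝒯.vert k) i) \ 𝒯.vertices) ∩
        {z | Q z (edgeNormal (𝒯.vert k) i)} := by
    ext z
    simp only [mem_union, mem_inter_iff, mem_iUnion, mem_ofPred_eq, Set.mem_sdiff]
    have key : ∀ k i, z ∈ frontier Ω → z ∈ openEdge (𝒯.vert k) i → z ∉ 𝒯.vertices →
        outerNormal Ω z = edgeNormal (𝒯.vert k) i := by
      intro k i hzΩ hzi hzv
      obtain ⟨l, hl, hn, -⟩ := exists_elemsAt_eq_singleton (𝒯 := 𝒯) hΩ hzv hzΩ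
      have hk : k ∈ 𝒯.elemsAt z :=
        mem_elemsAt.2 (openEdge_subset_frontier (𝒯.nondegenerate k) i hzi)
      rw [hl, Finset.mem_singleton] at hk
      subst hk
      rw [hn]
      exact outerNormal_openTriangle (𝒯.nondegenerate k) hzi
    constructor
    · rintro ⟨h1, h2⟩
      by_cases hzv : z ∈ 𝒯.vertices
      · exact Or.inl ⟨⟨h1, h2⟩, hzv⟩
      · obtain ⟨k, hk⟩ := mem_skeleton.1 (frontier_subset_skeleton (𝒯 := 𝒯) hΩ h1)
        obtain ⟨i, hi⟩ := exists_openEdge hzv hk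
        exact Or.inr ⟨k, i, ⟨⟨h1, hi⟩, hzv⟩, key k i h1 hi hzv ▸ h2⟩
    · rintro (⟨h, -⟩ | ⟨k, i, ⟨⟨h1, hi⟩, hzv⟩, h2⟩)
      · exact h
      · exact ⟨h1, (key k i h1 hi hzv).symm ▸ h2⟩
  rw [e]
  refine MeasurableSet.union ?_ (MeasurableSet.iUnion fun k => MeasurableSet.iUnion fun i => ?_)
  · exact (𝒯.finite_vertices.subset inter_subset_right).measurableSet
  · exact ((isClosed_frontier.measurableSet.inter (measurableSet_openEdge _ _)).diff
      𝒯.finite_vertices.measurableSet).inter (hQ _)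

lemma measurableSet_bdryZero (𝒯 : Triangulation Ω) (hΩ : IsPolygonalDomain Ω) :
    MeasurableSet (bdryZero Ω) :=
  measurableSet_setOf_outerNormal 𝒯 hΩ (Q := fun _ n => n 0 ≠ 0) fun n => by
    by_cases h : n 0 = 0 <;> simp [h]

lemma measurableSet_bdryMinus (𝒯 : Triangulation Ω) (hΩ : IsPolygonalDomain Ω) :
    MeasurableSet (bdryMinus Ω) := by
  have e : bdryMinus Ω = (frontier Ω \ bdryZero Ω) ∩
      {z | z ∈ frontier Ω ∧ z 0 * outerNormal Ω z 1 < 0} := by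
    ext z
    simp only [bdryMinus, mem_inter_iff, mem_ofPred_eq, Set.mem_sdiff]
    tauto
  rw [e]
  refine (isClosed_frontier.measurableSet.diff (measurableSet_bdryZero 𝒯 hΩ)).inter
    (measurableSet_setOf_outerNormal 𝒯 hΩ (Q := fun z n => z 0 * n 1 < 0) fun n => ?_)
  exact (isOpen_lt (by fun_prop) continuous_const).measurableSet

lemma measurableSet_bdryPlus (𝒯 : Triangulation Ω) (hΩ : IsPolygonalDomain Ω) :
    MeasurableSet (bdryPlus Ω) := by
  have e : bdryPlus Ω = (frontier Ω \ bdryZero Ω) ∩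
      {z | z ∈ frontier Ω ∧ 0 ≤ z 0 * outerNormal Ω z 1} := by
    ext z
    simp only [bdryPlus, mem_inter_iff, mem_ofPred_eq, Set.mem_sdiff]
    tauto
  rw [e]
  refine (isClosed_frontier.measurableSet.diff (measurableSet_bdryZero 𝒯 hΩ)).inter
    (measurableSet_setOf_outerNormal 𝒯 hΩ (Q := fun z n => 0 ≤ z 0 * n 1) fun n => ?_)
  exact (isClosed_le continuous_const (by fun_prop)).measurableSet

lemma measurable_indicator_outerNormal (𝒯 : Triangulation Ω) (hΩ : IsPolygonalDomain Ω)
    (j : Fin 2) : Measurable ((frontier Ω).indicator fun z => outerNormal Ω z j) := by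
  refine measurable_of_Ioi fun a => ?_
  have h := measurableSet_setOf_outerNormal 𝒯 hΩ (Q := fun _ n => a < n j) fun n => by
    by_cases h : a < n j <;> simp [h]
  have e : (frontier Ω).indicator (fun z => outerNormal Ω z j) ⁻¹' Ioi a =
      {z | z ∈ frontier Ω ∧ a < outerNormal Ω z j} ∪ ((frontier Ω)ᶜ ∩ {_z | a < 0}) := by
    ext z
    by_cases hz : z ∈ frontier Ω <;> simp [hz, Set.indicator]
  rw [e]
  refine h.union (isClosed_frontier.measurableSet.compl.inter ?_)
  by_cases h : a < 0 <;> simp [h]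

lemma aestronglyMeasurable_outerNormal_domain (𝒯 : Triangulation Ω) (hΩ : IsPolygonalDomain Ω)
    (j : Fin 2) : AEStronglyMeasurable (fun z => outerNormal Ω z j)
      (arcLength.restrict (frontier Ω)) := by
  refine (measurable_indicator_outerNormal 𝒯 hΩ j).aestronglyMeasurable.congr ?_
  filter_upwards [ae_restrict_mem isClosed_frontier.measurableSet] with z hz
  rw [indicator_of_mem hz]

/-- The nonzero first components of the normals are bounded away from zero. -/
lemma exists_le_abs_outerNormal (𝒯 : Triangulation Ω) (hΩ : IsPolygonalDomain Ω) :
    ∃ δ > 0, ∀ᵐ z ∂(arcLength.restrict (frontier Ω)), outerNormal Ω z 0 ≠ 0 →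
      δ ≤ |outerNormal Ω z 0| := by
  have hev : ∀ᶠ δ : ℝ in 𝓝[>] 0, ∀ k i, edgeNormal (𝒯.vert k) i 0 ≠ 0 →
      δ ≤ |edgeNormal (𝒯.vert k) i 0| := by
    simp only [Filter.eventually_all]
    intro k i h
    filter_upwards [nhdsWithin_le_nhds (Iio_mem_nhds (abs_pos.2 h))] with δ hδ
    exact le_of_lt hδ
  obtain ⟨δ, hδ, h0⟩ := (hev.and self_mem_nhdsWithin).exists
  refine ⟨δ, h0, ?_⟩
  rw [ae_restrict_iff' isClosed_frontier.measurableSet]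
  filter_upwards [𝒯.ae_notMem_vertices] with z hzv hz
  obtain ⟨k, hk, hn, -⟩ := exists_elemsAt_eq_singleton (𝒯 := 𝒯) hΩ hzv hz
  have hkf : z ∈ frontier (𝒯.elem k) := mem_elemsAt.1 (by rw [hk]; simp)
  obtain ⟨i, hi⟩ := exists_openEdge hzv hkf
  have e : outerNormal (𝒯.elem k) z = edgeNormal (𝒯.vert k) i :=
    outerNormal_openTriangle (𝒯.nondegenerate k) hi
  rw [hn, e]
  exact hδ k i

/-! ### Trace inequalities on elements and domain, and conversion of element sums into skeleton
integrals. -/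

lemma hasTraceInequality_elem (k : Fin 𝒯.card) :
    HasTraceInequality (𝒯.elem k) (arcLength.restrict (frontier (𝒯.elem k))) :=
  hasTraceInequality_openTriangle (𝒯.nondegenerate k)

/-- The trace inequality on a triangulated domain. -/
lemma hasTraceInequality_domain (𝒯 : Triangulation Ω) (hΩ : IsPolygonalDomain Ω) :
    HasTraceInequality Ω (arcLength.restrict (frontier Ω)) := by
  choose C hC h using fun k => hasTraceInequality_elem (𝒯 := 𝒯) k
  refine ⟨∑ k, C k, (ENNReal.sum_lt_top.2 fun k _ => (hC k).lt_top).ne, fun f hf => ?_⟩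
  have h1 : eLpNorm f 2 (arcLength.restrict (frontier Ω)) ≤
      ∑ k, eLpNorm f 2 (arcLength.restrict (frontier (𝒯.elem k))) := by
    refine (ENNReal.pow_le_pow_left_iff two_ne_zero).1 ?_
    rw [eLpNorm_two_sq]
    calc ∫⁻ z, ‖f z‖ₑ ^ 2 ∂(arcLength.restrict (frontier Ω))
        ≤ ∫⁻ z in ⋃ k, frontier (𝒯.elem k), ‖f z‖ₑ ^ 2 ∂arcLength :=
          lintegral_mono_set (frontier_subset_skeleton hΩ)
      _ ≤ ∑' k, ∫⁻ z in frontier (𝒯.elem k), ‖f z‖ₑ ^ 2 ∂arcLength := lintegral_iUnion_le _ _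
      _ = ∑ k, eLpNorm f 2 (arcLength.restrict (frontier (𝒯.elem k))) ^ 2 := by
          rw [tsum_fintype]
          exact Finset.sum_congr rfl fun k _ => (eLpNorm_two_sq f).symm
      _ ≤ (∑ k, eLpNorm f 2 (arcLength.restrict (frontier (𝒯.elem k)))) ^ 2 := by
          rw [sq, Finset.sum_mul]
          refine Finset.sum_le_sum fun k hk => ?_
          rw [sq]
          gcongr
          exact Finset.single_le_sum
            (f := fun k => eLpNorm f 2 (arcLength.restrict (frontier (𝒯.elem k))))
            (fun _ _ => zero_le) hk
  refine h1.trans ?_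
  rw [Finset.sum_mul]
  refine Finset.sum_le_sum fun k _ => (h k f hf).trans ?_
  have hm : volume.restrict (𝒯.elem k) ≤ volume.restrict Ω :=
    Measure.restrict_mono (𝒯.elem_subset hΩ k) le_rfl
  gcongr

lemma arcLength_frontier_lt_top (𝒯 : Triangulation Ω) (hΩ : IsPolygonalDomain Ω) :
    arcLength (frontier Ω) < ⊤ :=
  (measure_mono (frontier_subset_skeleton hΩ)).trans_lt 𝒯.arcLength_skeleton_lt_top

open Classical in
-- The index set on the left varies with the point. As a sum of indicators over all elements it
-- becomes accessible to measurability and integrability arguments.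
lemma sum_elemsAt_eq {M : Type*} [AddCommMonoid M] (F : Fin 𝒯.card → Plane → M) (z : Plane) :
    ∑ k ∈ 𝒯.elemsAt z, F k z = ∑ k, (frontier (𝒯.elem k)).indicator (F k) z := by
  rw [elemsAt, Finset.sum_filter]
  exact Finset.sum_congr rfl fun k _ => by simp [Set.indicator]

lemma integrableOn_sum_elemsAt {F : Fin 𝒯.card → Plane → ℝ}
    (hF : ∀ k, IntegrableOn (F k) (frontier (𝒯.elem k)) arcLength) :
    Integrable (fun z => ∑ k ∈ 𝒯.elemsAt z, F k z) arcLength := by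
  simp only [sum_elemsAt_eq]
  exact integrable_finsetSum _ fun k _ =>
    (integrable_indicator_iff (measurableSet_frontier_elem k)).2 (hF k)

lemma sum_setIntegral_frontier {F : Fin 𝒯.card → Plane → ℝ}
    (hF : ∀ k, IntegrableOn (F k) (frontier (𝒯.elem k)) arcLength) :
    ∑ k, ∫ z in frontier (𝒯.elem k), F k z ∂arcLength =
      ∫ z in 𝒯.skeleton, ∑ k ∈ 𝒯.elemsAt z, F k z ∂arcLength := by
  rw [setIntegral_eq_integral_of_forall_compl_eq_zero]
  · simp only [sum_elemsAt_eq]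
    rw [integral_finsetSum _ fun k _ =>
      (integrable_indicator_iff (measurableSet_frontier_elem k)).2 (hF k)]
    exact Finset.sum_congr rfl fun k _ =>
      (integral_indicator (measurableSet_frontier_elem k)).symm
  · intro z hz
    refine Finset.sum_eq_zero fun k hk => absurd ?_ hz
    exact mem_skeleton.2 ⟨k, mem_elemsAt.1 hk⟩

end Triangulation

/-! ### Functions with vanishing weak gradient -/

/-- Mollifications have zero classical gradient on the ball, hence are constant there; a subsequence
converges almost everywhere to f. The ball of twice the radius leaves room for the kernels, and no
dilation is needed (ε = 0). -/
lemma exists_ae_eq_const_ball {U : Set Plane} (hU : IsOpen U) {f : Plane → ℝ} (hf : MemL2 U f)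
    (h : ∀ i, HasWeakPD U i f 0) {x : Plane} {r : ℝ} (hr : 0 < r)
    (hx : Metric.ball x (2 * r) ⊆ U) :
    ∃ c, ∀ᵐ z ∂(volume.restrict (Metric.ball x r)), f z = c := by
  set f₀ : Plane → ℝ := hf.1.mk f with hf₀
  have hff : f =ᵐ[volume.restrict U] f₀ := hf.1.ae_eq_mk
  have hFm : StronglyMeasurable (U.indicator f₀) :=
    (hf.1.stronglyMeasurable_mk).indicator hU.measurableSet
  have hFL : MemLp (U.indicator f₀) 2 volume :=
    (memLp_indicator_iff_restrict hU.measurableSet).2 (hf.congr hff)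
  have hFloc : LocallyIntegrable (U.indicator f₀) := hFL.locallyIntegrable (by norm_num)
  have hρ0 : ∀ n : ℕ, 0 < r / ((n : ℝ) + 2) := fun n => by positivity
  have hρ : Tendsto (fun n : ℕ => r / ((n : ℝ) + 2)) atTop (𝓝 0) :=
    tendsto_const_nhds.div_atTop (tendsto_atTop_add_const_right _ _ tendsto_natCast_atTop_atTop)
  choose K hK using fun n => exists_isMollifier (hρ0 n)
  set v : ℕ → Plane → ℝ := fun n z =>
    conv (U.indicator f₀) (K n) ((1 - (0 : ℝ)) • z + (0 : ℝ) • (0 : Plane)) with hv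
  have hvd : ∀ n, ContDiff ℝ ∞ (v n) := fun n => ((hK n).contDiff_conv hFloc).comp (by fun_prop)
  have ht : Tendsto (fun n => eLpNorm (fun z => v n z - U.indicator f₀ z) 2
      (volume.restrict (Metric.ball x r))) atTop (𝓝 0) :=
    tendsto_eLpNorm_conv (ε := fun _ => 0) Metric.isOpen_ball Metric.isBounded_ball
      (fun _ => by norm_num) tendsto_const_nhds hρ hK 0 hFm hFL
  have hconst : ∀ n, ∃ c, ∀ z ∈ Metric.ball x r, v n z = c := by
    intro n
    refine Metric.isOpen_ball.exists_is_const_of_fderiv_eq_zero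
      (convex_ball x r).isPreconnected ((hvd n).differentiable (by simp)).differentiableOn ?_
    intro z hz
    have hpd : ∀ i, pd i (v n) z = 0 := by
      intro i
      rw [hv, pd_conv_dilation hU hFloc ((h i).congr_left hff) (hK n)]
      · simp [conv]
      · refine Subset.trans ?_ hx
        simp only [sub_zero, one_smul, smul_zero, add_zero]
        intro y hy
        rw [Metric.mem_closedBall] at hy
        rw [Metric.mem_ball] at hz ⊢
        have : r / ((n : ℝ) + 2) ≤ r :=
          div_le_self hr.le (by linarith [(Nat.cast_nonneg n : (0 : ℝ) ≤ n)])
        linarith [dist_triangle y z x]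
    ext u
    rw [fderiv_apply_eq_pd]
    simp [hpd]
  choose c hc using hconst
  obtain ⟨ns, -, hns⟩ := (tendstoInMeasure_of_tendsto_eLpNorm (by norm_num)
    (fun n => (hvd n).continuous.aestronglyMeasurable) hFm.aestronglyMeasurable
    ht).exists_seq_tendsto_ae
  have hae : ∀ᵐ z ∂(volume.restrict (Metric.ball x r)),
      Tendsto (fun i => c (ns i)) atTop (𝓝 (f z)) := by
    have hsub : Metric.ball x r ⊆ U :=
      (Metric.ball_subset_ball (by linarith)).trans hx
    filter_upwards [hns, ae_restrict_of_ae_restrict_of_subset hsub hff,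
      ae_restrict_mem measurableSet_ball] with z h1 h2 h3
    rw [indicator_of_mem (hsub h3), ← h2] at h1
    exact h1.congr fun i => hc _ z h3
  have hne : (ae (volume.restrict (Metric.ball x r))).NeBot := by
    rw [ae_neBot, Ne, Measure.restrict_eq_zero]
    exact (Metric.measure_ball_pos volume x hr).ne'
  obtain ⟨z₀, hz₀⟩ := hae.exists
  exact ⟨f z₀, hae.mono fun z hz => tendsto_nhds_unique hz hz₀⟩

/-- A function with vanishing weak gradient on a connected open set is constant. -/
lemma exists_ae_eq_const {U : Set Plane} (hU : IsOpen U) (hUc : IsConnected U) {f : Plane → ℝ}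
    (hf : MemL2 U f) (h : ∀ i, HasWeakPD U i f 0) :
    ∃ c, ∀ᵐ z ∂(volume.restrict U), f z = c := by
  have hloc : ∀ x ∈ U, ∃ r > 0, Metric.ball x r ⊆ U ∧
      ∃ c, ∀ᵐ z ∂(volume.restrict (Metric.ball x r)), f z = c := by
    intro x hx
    obtain ⟨r, hr, hrU⟩ := Metric.isOpen_iff.1 hU x hx
    refine ⟨r / 2, by positivity, (Metric.ball_subset_ball (by linarith)).trans hrU, ?_⟩
    exact exists_ae_eq_const_ball hU hf h (by positivity) (by rwa [mul_div_cancel₀ _ two_ne_zero])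
  obtain ⟨x₀, hx₀⟩ := hUc.nonempty
  obtain ⟨r₀, hr₀, hrU₀, c, hc⟩ := hloc x₀ hx₀
  refine ⟨c, ?_⟩
  -- The points near which f is almost everywhere constant with a value satisfying Q. The cases
  -- "value c" and "value other than c" give two disjoint open sets covering U, so connectedness
  -- decides.
  set E : (ℝ → Prop) → Set Plane := fun Q => {x | ∃ r > 0, ∃ c', Q c' ∧
    ∀ᵐ z ∂(volume.restrict (Metric.ball x r)), f z = c'} with hE
  have hEo : ∀ Q, IsOpen (E Q) := by
    intro Q
    rw [Metric.isOpen_iff]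
    rintro x ⟨r, hr, c', hQ, hc'⟩
    refine ⟨r / 2, by positivity, fun y hy => ⟨r / 2, by positivity, c', hQ, ?_⟩⟩
    refine ae_restrict_of_ae_restrict_of_subset ?_ hc'
    refine Metric.ball_subset_ball' ?_
    rw [Metric.mem_ball] at hy
    linarith
  have hdisj : Disjoint (E (· = c)) (E (· ≠ c)) := by
    rw [Set.disjoint_left]
    rintro x ⟨r, hr, c₁, rfl, h1⟩ ⟨s, hs, c₂, hne, h2⟩
    have h1' := ae_restrict_of_ae_restrict_of_subset
      (Metric.ball_subset_ball (min_le_left r s)) h1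
    have h2' := ae_restrict_of_ae_restrict_of_subset
      (Metric.ball_subset_ball (min_le_right r s)) h2
    have : (ae (volume.restrict (Metric.ball x (min r s)))).NeBot := by
      rw [ae_neBot, Ne, Measure.restrict_eq_zero]
      exact (Metric.measure_ball_pos volume x (lt_min hr hs)).ne'
    obtain ⟨z, hz1, hz2⟩ := (h1'.and h2').exists
    exact hne (hz2.symm.trans hz1)
  have hsub : U ⊆ E (· = c) := by
    refine hUc.isPreconnected.subset_left_of_subset_union (hEo _) (hEo _) hdisj ?_
      ⟨x₀, hx₀, r₀, hr₀, c, rfl, hc⟩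
    intro x hx
    obtain ⟨r, hr, -, c', hc'⟩ := hloc x hx
    by_cases e : c' = c
    · exact Or.inl ⟨r, hr, c', e, hc'⟩
    · exact Or.inr ⟨r, hr, c', e, hc'⟩
  rw [ae_restrict_iff' hU.measurableSet]
  change volume {z | ¬ (z ∈ U → f z = c)} = 0
  refine measure_null_of_locally_null _ fun x hx => ?_
  simp only [Classical.not_imp, mem_ofPred_eq] at hx
  obtain ⟨r, hr, c', rfl, hc'⟩ := hsub hx.1
  refine ⟨_, inter_mem_nhdsWithin _ (Metric.ball_mem_nhds x hr), ?_⟩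
  rw [ae_restrict_iff' measurableSet_ball] at hc'
  refine measure_mono_null ?_ (show volume {z | ¬ (z ∈ Metric.ball x r → f z = c')} = 0 from hc')
  rintro z ⟨h1, h2⟩ h3
  exact h1 fun _ => h3 h2

/-! ### Squares of seminorms -/

/-- Squares of seminorms on a real vector space, characterised by Young's inequality. -/
structure IsSqSeminorm {E : Type*} [AddCommGroup E] [Module ℝ E] (Q : E → ℝ) : Prop where
  nonneg : ∀ x, 0 ≤ Q x
  smul : ∀ (c : ℝ) (x : E), Q (c • x) = c ^ 2 * Q x
  add_le : ∀ (x y : E) (t : ℝ), 0 < t → Q (x + y) ≤ (1 + t) * Q x + (1 + t⁻¹) * Q y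

namespace IsSqSeminorm

variable {E : Type*} [AddCommGroup E] [Module ℝ E] {Q Q' : E → ℝ}

lemma add (h : IsSqSeminorm Q) (h' : IsSqSeminorm Q') : IsSqSeminorm (fun x => Q x + Q' x) where
  nonneg x := add_nonneg (h.nonneg x) (h'.nonneg x)
  smul c x := by rw [h.smul, h'.smul]; ring
  add_le x y t ht := by linarith [h.add_le x y t ht, h'.add_le x y t ht]

lemma const_mul (h : IsSqSeminorm Q) {c : ℝ} (hc : 0 ≤ c) : IsSqSeminorm (fun x => c * Q x) where
  nonneg x := mul_nonneg hc (h.nonneg x)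
  smul a x := by rw [h.smul]; ring
  add_le x y t ht := by linarith [mul_le_mul_of_nonneg_left (h.add_le x y t ht) hc]

lemma sum {ι : Type*} (s : Finset ι) {Q : ι → E → ℝ} (h : ∀ i, IsSqSeminorm (Q i)) :
    IsSqSeminorm (fun x => ∑ i ∈ s, Q i x) where
  nonneg x := Finset.sum_nonneg fun i _ => (h i).nonneg x
  smul a x := by rw [Finset.mul_sum]; exact Finset.sum_congr rfl fun i _ => (h i).smul a x
  add_le x y t ht := by
    rw [Finset.mul_sum, Finset.mul_sum, ← Finset.sum_add_distrib]
    exact Finset.sum_le_sum fun i _ => (h i).add_le x y t ht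

/-- Young's inequality is non-negativity of the form at t x - y, divided by t. Symmetry is not
required, since only b x y + b y x enters. -/
lemma of_bilin {b : E → E → ℝ} (hQ : ∀ x, 0 ≤ b x x)
    (hb : ∀ (a c : ℝ) (x y : E), b (a • x + c • y) (a • x + c • y) =
      a ^ 2 * b x x + a * c * (b x y + b y x) + c ^ 2 * b y y) : IsSqSeminorm (fun x => b x x) where
  nonneg := hQ
  smul c x := by simpa using hb c 0 x 0
  add_le x y t ht := by
    have h1 := hb 1 1 x y
    have h2 := hQ (t • x + (-1 : ℝ) • y)
    rw [hb t (-1) x y] at h2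
    simp only [one_smul] at h1
    rw [h1]
    have h3 : 0 ≤ t⁻¹ * (t ^ 2 * b x x + t * -1 * (b x y + b y x) + (-1) ^ 2 * b y y) :=
      mul_nonneg (inv_nonneg.2 ht.le) h2
    have h4 : t⁻¹ * (t ^ 2 * b x x + t * -1 * (b x y + b y x) + (-1) ^ 2 * b y y) =
        t * b x x - (b x y + b y x) + t⁻¹ * b y y := by
      field_simp
      ring
    linarith

lemma matrix {M : Matrix (Fin 2) (Fin 2) ℝ} (hM : M.PosSemidef) :
    IsSqSeminorm (fun ξ : Fin 2 → ℝ => ξ ⬝ᵥ (M *ᵥ ξ)) := by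
  refine of_bilin (b := fun ξ η => ξ ⬝ᵥ (M *ᵥ η)) (fun ξ => ?_) fun a c x y => ?_
  · simpa using hM.dotProduct_mulVec_nonneg ξ
  · simp only [Matrix.mulVec_add, Matrix.mulVec_smul, add_dotProduct, dotProduct_add,
      smul_dotProduct, dotProduct_smul, smul_eq_mul]
    ring

lemma sq : IsSqSeminorm (fun x : ℝ => x ^ 2) where
  nonneg := sq_nonneg
  smul c x := by rw [smul_eq_mul, mul_pow]
  add_le x y t ht := by
    have := (of_bilin (b := fun x y : ℝ => x * y) mul_self_nonneg
      fun a c x y => by simp only [smul_eq_mul]; ring).add_le x y t ht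
    simpa only [pow_two] using this

lemma inner : IsSqSeminorm (fun x : Plane => ⟪x, x⟫) := by
  refine of_bilin (b := fun x y : Plane => ⟪x, y⟫) (fun x => real_inner_self_nonneg)
    fun a c x y => ?_
  simp only [inner_add_left, inner_add_right, real_inner_smul_left, real_inner_smul_right]
  ring

lemma comp_linearMap {F : Type*} [AddCommGroup F] [Module ℝ F] (h : IsSqSeminorm Q)
    (L : F →ₗ[ℝ] E) : IsSqSeminorm (fun x => Q (L x)) where
  nonneg x := h.nonneg _
  smul c x := by rw [map_smul, h.smul]
  add_le x y t ht := by rw [map_add]; exact h.add_le _ _ t ht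

/-- Integrals of squares of seminorms. -/
lemma integral {F : Type*} [AddCommGroup F] [Module ℝ F] {μ : Measure Plane} {Q : Plane → F → ℝ}
    (hQ : ∀ᵐ z ∂μ, IsSqSeminorm (Q z)) {ξ : E → Plane → F}
    (hadd : ∀ u v, ∀ᵐ z ∂μ, ξ (u + v) z = ξ u z + ξ v z)
    (hsmul : ∀ (c : ℝ) u, ∀ᵐ z ∂μ, ξ (c • u) z = c • ξ u z)
    (hint : ∀ u, Integrable (fun z => Q z (ξ u z)) μ) :
    IsSqSeminorm (fun u => ∫ z, Q z (ξ u z) ∂μ) where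
  nonneg u := integral_nonneg_of_ae (hQ.mono fun z hz => hz.nonneg _)
  smul c u := by
    rw [← integral_const_mul]
    refine integral_congr_ae ?_
    filter_upwards [hQ, hsmul c u] with z hz h
    rw [h, hz.smul]
  add_le u v t ht := by
    have h1 : Integrable (fun z => (1 + t) * Q z (ξ u z)) μ := (hint u).const_mul _
    have h2 : Integrable (fun z => (1 + t⁻¹) * Q z (ξ v z)) μ := (hint v).const_mul _
    rw [← integral_const_mul, ← integral_const_mul, ← integral_add h1 h2]
    refine integral_mono_ae (hint _) (h1.add h2) ?_
    filter_upwards [hQ, hadd u v] with z hz h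
    simp only [h]
    exact hz.add_le _ _ t ht

lemma sqrt_smul (h : IsSqSeminorm Q) (c : ℝ) (x : E) : √(Q (c • x)) = |c| * √(Q x) := by
  rw [h.smul, Real.sqrt_mul (sq_nonneg c), Real.sqrt_sq_eq_abs]

lemma sqrt_add_le (h : IsSqSeminorm Q) (x y : E) : √(Q (x + y)) ≤ √(Q x) + √(Q y) := by
  refine le_of_forall_pos_le_add fun δ hδ => ?_
  -- The shift by δ/2 keeps both numbers positive, so that the optimal Young parameter t = b/a is
  -- available even when a seminorm vanishes.
  set a := √(Q x) + δ / 2 with ha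
  set b := √(Q y) + δ / 2 with hb
  have ha0 : 0 < a := by positivity
  have hb0 : 0 < b := by positivity
  have hQa : Q x ≤ a ^ 2 := by
    rw [← Real.sq_sqrt (h.nonneg x)]
    gcongr
    linarith
  have hQb : Q y ≤ b ^ 2 := by
    rw [← Real.sq_sqrt (h.nonneg y)]
    gcongr
    linarith
  have : √(Q x) + √(Q y) + δ = a + b := by ring
  rw [this]
  refine Real.sqrt_le_iff.2 ⟨by positivity, (h.add_le x y (b / a) (by positivity)).trans ?_⟩
  calc (1 + b / a) * Q x + (1 + (b / a)⁻¹) * Q y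
      ≤ (1 + b / a) * a ^ 2 + (1 + (b / a)⁻¹) * b ^ 2 := by gcongr
    _ = (a + b) ^ 2 := by field_simp; ring

lemma map_zero (h : IsSqSeminorm Q) : Q 0 = 0 := by
  simpa using h.smul 0 0

/-- The norm whose square is a definite `Q`. -/
def toAddGroupNorm (h : IsSqSeminorm Q) (hdef : ∀ x, Q x = 0 → x = 0) : AddGroupNorm E where
  toFun x := √(Q x)
  map_zero' := by rw [h.map_zero, Real.sqrt_zero]
  add_le' := h.sqrt_add_le
  neg' x := by
    have := h.sqrt_smul (-1) x
    simpa using this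
  eq_zero_of_map_eq_zero' x hx := hdef x ((Real.sqrt_eq_zero (h.nonneg x)).1 hx)

end IsSqSeminorm

lemma integrable_mul_dotProduct {μ : Measure Plane} {m : Plane → ℝ} {ξ η : Plane → Fin 2 → ℝ}
    (hm : AEStronglyMeasurable m μ) {C : ℝ} (hC : ∀ᵐ z ∂μ, |m z| ≤ C)
    (hξ : ∀ i, MemLp (fun z => ξ z i) 2 μ) (hη : ∀ i, MemLp (fun z => η z i) 2 μ)
    (M : Matrix (Fin 2) (Fin 2) ℝ) :
    Integrable (fun z => m z * (ξ z ⬝ᵥ (M *ᵥ η z))) μ := by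
  refine Integrable.bdd_mul (c := C) ?_ hm hC
  simp only [dotProduct, Matrix.mulVec]
  refine integrable_finsetSum _ fun i _ => ?_
  simp only [Finset.mul_sum]
  refine integrable_finsetSum _ fun j _ => ?_
  have := ((hξ i).integrable_mul (hη j)).const_mul (M i j)
  refine this.congr (ae_of_all _ fun z => ?_)
  simp only [Pi.mul_apply]
  ring

/-! ### Square integrability of boundary data -/

namespace Triangulation

variable {Ω : Set Plane} {𝒯 : Triangulation Ω}

/-- A family of square integrable boundary values on the boundaries of the elements. -/
def MemBdL2 (𝒯 : Triangulation Ω) (φ : Fin 𝒯.card → Plane → ℝ) : Prop :=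
  ∀ k, MemLp (φ k) 2 (arcLength.restrict (frontier (𝒯.elem k)))

lemma MemBdL2.sum_elemsAt {φ : Fin 𝒯.card → Plane → ℝ} (h : 𝒯.MemBdL2 φ) :
    MemLp (fun z => ∑ k ∈ 𝒯.elemsAt z, φ k z) 2 arcLength := by
  simp only [sum_elemsAt_eq]
  exact memLp_finsetSum _ fun k _ =>
    (memLp_indicator_iff_restrict (measurableSet_frontier_elem k)).2 (h k)

lemma memBdL2_of_continuous {φ : Fin 𝒯.card → Plane → ℝ} (h : ∀ k, Continuous (φ k)) :
    𝒯.MemBdL2 φ := fun k =>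
  memLp_of_continuous_of_isBounded ((𝒯.isBounded_elem k).closure.subset frontier_subset_closure)
    (arcLength_frontier_elem_lt_top k) (measurableSet_frontier_elem k) (h k)

lemma MemBdL2.mul_outerNormal {φ : Fin 𝒯.card → Plane → ℝ} (h : 𝒯.MemBdL2 φ) (j : Fin 2) :
    𝒯.MemBdL2 (fun k z => φ k z * outerNormal (𝒯.elem k) z j) := fun k => by
  refine (h k).of_le ((h k).1.mul (aestronglyMeasurable_outerNormal (𝒯.nondegenerate k) j))
    (ae_of_all _ fun z => ?_)
  rw [norm_mul]
  exact mul_le_of_le_one_right (norm_nonneg _) (abs_outerNormal_le _ _ _)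

lemma aestronglyMeasurable_card_elemsAt :
    AEStronglyMeasurable (fun z => ((𝒯.elemsAt z).card : ℝ)) arcLength := by
  have := (memBdL2_of_continuous (𝒯 := 𝒯) (φ := fun _ _ => 1)
    fun _ => continuous_const).sum_elemsAt.1
  simpa using this

lemma MemBdL2.avg {φ : Fin 𝒯.card → Plane → ℝ} (h : 𝒯.MemBdL2 φ) :
    MemLp (𝒯.avg φ) 2 arcLength := by
  refine h.sum_elemsAt.of_le (h.sum_elemsAt.1.aemeasurable.div
    aestronglyMeasurable_card_elemsAt.aemeasurable).aestronglyMeasurable (ae_of_all _ fun z => ?_)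
  rw [Triangulation.avg, norm_div, Real.norm_natCast]
  rcases Nat.eq_zero_or_pos (𝒯.elemsAt z).card with h0 | h0
  · rw [h0]
    simp
  · exact div_le_self (norm_nonneg _) (by exact_mod_cast h0)

lemma abs_avg_le {φ : Fin 𝒯.card → Plane → ℝ} {C : ℝ} (hC : 0 ≤ C) {z : Plane}
    (h : ∀ k ∈ 𝒯.elemsAt z, |φ k z| ≤ C) : |𝒯.avg φ z| ≤ C := by
  rw [Triangulation.avg, abs_div, Nat.abs_cast]
  refine div_le_of_le_mul₀ (Nat.cast_nonneg _) hC ?_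
  refine (Finset.abs_sum_le_sum_abs _ _).trans ((Finset.sum_le_card_nsmul _ _ _ h).trans ?_)
  rw [nsmul_eq_mul, mul_comm]

lemma avg_nonneg {φ : Fin 𝒯.card → Plane → ℝ} {z : Plane} (h : ∀ k ∈ 𝒯.elemsAt z, 0 ≤ φ k z) :
    0 ≤ 𝒯.avg φ z :=
  div_nonneg (Finset.sum_nonneg h) (Nat.cast_nonneg _)

lemma jump_apply (φ : Fin 𝒯.card → Plane → ℝ) (z : Plane) (j : Fin 2) :
    𝒯.jump φ z j = ∑ k ∈ 𝒯.elemsAt z, φ k z * outerNormal (𝒯.elem k) z j := by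
  simp [jump]

lemma MemBdL2.jump {φ : Fin 𝒯.card → Plane → ℝ} (h : 𝒯.MemBdL2 φ) (j : Fin 2) :
    MemLp (fun z => 𝒯.jump φ z j) 2 arcLength := by
  simp only [jump_apply]
  exact (h.mul_outerNormal j).sum_elemsAt

lemma MemBdL2.jump1 {φ : Fin 𝒯.card → Plane → ℝ} (h : 𝒯.MemBdL2 φ) :
    MemLp (𝒯.jump1 φ) 2 arcLength :=
  (h.mul_outerNormal 0).sum_elemsAt

lemma exists_norm_le (𝒯 : Triangulation Ω) : ∃ R, 0 ≤ R ∧ ∀ z ∈ 𝒯.skeleton, ‖z‖ ≤ R := by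
  obtain ⟨R, hR⟩ := 𝒯.isBounded_skeleton.exists_norm_le
  exact ⟨max R 0, le_max_right _ _, fun z hz => (hR z hz).trans (le_max_left _ _)⟩

lemma absXN2_nonneg (z : Plane) : 0 ≤ 𝒯.absXN2 z := avg_nonneg fun _ _ => abs_nonneg _

lemma exists_absXN2_le (𝒯 : Triangulation Ω) : ∃ R, ∀ z, |𝒯.absXN2 z| ≤ R := by
  obtain ⟨R, hR0, hR⟩ := 𝒯.exists_norm_le
  refine ⟨R, fun z => abs_avg_le hR0 fun k hk => ?_⟩
  rw [abs_abs, abs_mul]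
  refine (mul_le_of_le_one_right (abs_nonneg _) (abs_outerNormal_le _ _ _)).trans
    ((abs_coord_le_norm _ _).trans (hR z (mem_skeleton.2 ⟨k, mem_elemsAt.1 hk⟩)))

lemma aestronglyMeasurable_absXN2 : AEStronglyMeasurable 𝒯.absXN2 arcLength := by
  refine (MemBdL2.avg (φ := fun k z => |z 0 * outerNormal (𝒯.elem k) z 1|) ?_).1
  exact fun k => ((memBdL2_of_continuous (φ := fun _ z => z 0)
    fun _ => by fun_prop).mul_outerNormal 1 k).abs

lemma aestronglyMeasurable_penalty (Cτ : ℝ) (p : ℕ) :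
    AEStronglyMeasurable (𝒯.penalty Cτ p) arcLength := by
  have := (memBdL2_of_continuous (𝒯 := 𝒯) (φ := fun k _ => 𝒯.meshSize k)
    fun _ => continuous_const).avg.1
  exact (aemeasurable_const.div this.aemeasurable).aestronglyMeasurable

lemma exists_penalty_le (𝒯 : Triangulation Ω) (Cτ : ℝ) (p : ℕ) :
    ∃ C, ∀ z, |𝒯.penalty Cτ p z| ≤ C := by
  -- The penalty depends on the point only through the set of elements meeting there, so it takes
  -- finitely many values.
  set g : Finset (Fin 𝒯.card) → ℝ := fun s =>
    |Cτ * (p : ℝ) ^ 2 / ((∑ k ∈ s, 𝒯.meshSize k) / s.card)|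
  exact ⟨∑ s, g s, fun z => Finset.single_le_sum (f := g) (fun s _ => abs_nonneg _)
    (Finset.mem_univ (𝒯.elemsAt z))⟩

lemma penalty_nonneg {Cτ : ℝ} (hC : 0 ≤ Cτ) (p : ℕ) (z : Plane) : 0 ≤ 𝒯.penalty Cτ p z :=
  div_nonneg (by positivity) (avg_nonneg fun _ _ => Metric.diam_nonneg)

/-! ### Boundary values of piecewise smooth functions -/

lemma MemBrokenH2.isTrace {w : Plane → ℝ} (h : 𝒯.MemBrokenH2 w) (i : Fin 2) (k : Fin 𝒯.card) :
    IsTrace (𝒯.elem k) (wpd (𝒯.elem k) i w) (𝒯.bdPD i w k) :=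
  isTrace_bdTrace (((h k).2 i).exists_isTrace (𝒯.nondegenerate k))

lemma MemBrokenH2.memBdL2 {w : Plane → ℝ} (h : 𝒯.MemBrokenH2 w) (i : Fin 2) :
    𝒯.MemBdL2 (𝒯.bdPD i w) := fun k => (h.isTrace i k).2.1

/-- Almost everywhere equality of boundary values. -/
def BdEq (𝒯 : Triangulation Ω) (φ ψ : Fin 𝒯.card → Plane → ℝ) : Prop :=
  ∀ᵐ z ∂arcLength, ∀ k ∈ 𝒯.elemsAt z, φ k z = ψ k z

lemma bdEq_of_forall {φ ψ : Fin 𝒯.card → Plane → ℝ}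
    (h : ∀ k, φ k =ᵐ[arcLength.restrict (frontier (𝒯.elem k))] ψ k) : 𝒯.BdEq φ ψ := by
  refine ae_all_iff.2 fun k => ?_
  have := (ae_restrict_iff' (measurableSet_frontier_elem k)).1 (h k)
  filter_upwards [this] with z hz hk using hz (mem_elemsAt.1 hk)

lemma avg_congr {φ ψ : Fin 𝒯.card → Plane → ℝ} {z : Plane}
    (h : ∀ k ∈ 𝒯.elemsAt z, φ k z = ψ k z) : 𝒯.avg φ z = 𝒯.avg ψ z := by
  rw [avg, avg, Finset.sum_congr rfl h]

lemma jump_congr {φ ψ : Fin 𝒯.card → Plane → ℝ} {z : Plane}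
    (h : ∀ k ∈ 𝒯.elemsAt z, φ k z = ψ k z) : 𝒯.jump φ z = 𝒯.jump ψ z := by
  rw [jump, jump]
  exact Finset.sum_congr rfl fun k hk => by rw [h k hk]

lemma jump1_congr {φ ψ : Fin 𝒯.card → Plane → ℝ} {z : Plane}
    (h : ∀ k ∈ 𝒯.elemsAt z, φ k z = ψ k z) : 𝒯.jump1 φ z = 𝒯.jump1 ψ z := by
  rw [jump1, jump1]
  exact Finset.sum_congr rfl fun k hk => by rw [h k hk]

lemma avg_lincomb (φ ψ : Fin 𝒯.card → Plane → ℝ) (a b : ℝ) (z : Plane) :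
    𝒯.avg (fun k z => a * φ k z + b * ψ k z) z = a * 𝒯.avg φ z + b * 𝒯.avg ψ z := by
  simp only [avg, Finset.sum_add_distrib, ← Finset.mul_sum]
  ring

lemma jump_lincomb (φ ψ : Fin 𝒯.card → Plane → ℝ) (a b : ℝ) (z : Plane) :
    𝒯.jump (fun k z => a * φ k z + b * ψ k z) z = a • 𝒯.jump φ z + b • 𝒯.jump ψ z := by
  simp only [jump, add_smul, mul_smul, Finset.sum_add_distrib, ← Finset.smul_sum]

lemma jump1_lincomb (φ ψ : Fin 𝒯.card → Plane → ℝ) (a b : ℝ) (z : Plane) :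
    𝒯.jump1 (fun k z => a * φ k z + b * ψ k z) z = a * 𝒯.jump1 φ z + b * 𝒯.jump1 ψ z := by
  simp only [jump1, add_mul, mul_assoc, Finset.sum_add_distrib, ← Finset.mul_sum]

lemma ae_elem_of_ae (hΩ : IsPolygonalDomain Ω) {W f : Plane → ℝ} (h : W =ᵐ[volume.restrict Ω] f)
    (k : Fin 𝒯.card) : W =ᵐ[volume.restrict (𝒯.elem k)] f :=
  ae_restrict_of_ae_restrict_of_subset (𝒯.elem_subset hΩ k) h

/-- Here and below the combination is given up to null sets, because the representative of a sum in
`Lp` is determined only almost everywhere. -/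
lemma MemBrokenH2.wpd_lincomb (hΩ : IsPolygonalDomain Ω) {u v W : Plane → ℝ}
    (hu : 𝒯.MemBrokenH2 u) (hv : 𝒯.MemBrokenH2 v) {a b : ℝ}
    (h : W =ᵐ[volume.restrict Ω] fun z => a * u z + b * v z) (i : Fin 2) (k : Fin 𝒯.card) :
    wpd (𝒯.elem k) i W =ᵐ[volume.restrict (𝒯.elem k)]
      fun z => a * wpd (𝒯.elem k) i u z + b * wpd (𝒯.elem k) i v z :=
  (((hu k).1.lincomb (hv k).1 a b).wpd_congr (𝒯.isOpen_elem k) (ae_elem_of_ae hΩ h k).symm i).trans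
    ((hu k).1.wpd_lincomb (𝒯.isOpen_elem k) (hv k).1 a b i)

lemma MemBrokenH2.wpd_wpd_lincomb (hΩ : IsPolygonalDomain Ω) {u v W : Plane → ℝ}
    (hu : 𝒯.MemBrokenH2 u) (hv : 𝒯.MemBrokenH2 v) {a b : ℝ}
    (h : W =ᵐ[volume.restrict Ω] fun z => a * u z + b * v z) (i j : Fin 2) (k : Fin 𝒯.card) :
    wpd (𝒯.elem k) j (wpd (𝒯.elem k) i W) =ᵐ[volume.restrict (𝒯.elem k)]
      fun z => a * wpd (𝒯.elem k) j (wpd (𝒯.elem k) i u) z +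
        b * wpd (𝒯.elem k) j (wpd (𝒯.elem k) i v) z :=
  ((((hu k).2 i).lincomb ((hv k).2 i) a b).wpd_congr (𝒯.isOpen_elem k)
    (hu.wpd_lincomb hΩ hv h i k).symm j).trans
      (((hu k).2 i).wpd_lincomb (𝒯.isOpen_elem k) ((hv k).2 i) a b j)

lemma MemBrokenH2.lincomb (hΩ : IsPolygonalDomain Ω) {u v W : Plane → ℝ}
    (hu : 𝒯.MemBrokenH2 u) (hv : 𝒯.MemBrokenH2 v) {a b : ℝ}
    (h : W =ᵐ[volume.restrict Ω] fun z => a * u z + b * v z) : 𝒯.MemBrokenH2 W := fun k =>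
  ((hu k).lincomb (𝒯.isOpen_elem k) (hv k) a b).congr (𝒯.isOpen_elem k)
    (ae_elem_of_ae hΩ h k).symm

lemma MemBrokenH2.bdPD_lincomb (hΩ : IsPolygonalDomain Ω) {u v W : Plane → ℝ}
    (hu : 𝒯.MemBrokenH2 u) (hv : 𝒯.MemBrokenH2 v) {a b : ℝ}
    (h : W =ᵐ[volume.restrict Ω] fun z => a * u z + b * v z) (i : Fin 2) :
    𝒯.BdEq (𝒯.bdPD i W) (fun k z => a * 𝒯.bdPD i u k z + b * 𝒯.bdPD i v k z) := by
  refine bdEq_of_forall fun k => IsTrace.bdTrace_ae_eq (hasTraceInequality_elem k) ?_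
  exact ((hu.isTrace i k).lincomb (𝒯.isOpen_elem k) (hv.isTrace i k) a b).congr (𝒯.isOpen_elem k)
    (hu.wpd_lincomb hΩ hv h i k).symm

end Triangulation

lemma MemH1MinusZero.isTrace {Ω : Set Plane} {w : Plane → ℝ} (h : MemH1MinusZero Ω w) :
    IsTrace Ω w (bdTrace Ω w) := isTrace_bdTrace ⟨_, h.choose_spec.1⟩

lemma MemH1MinusZero.memH1 {Ω : Set Plane} {w : Plane → ℝ} (h : MemH1MinusZero Ω w) :
    MemH1 Ω w := h.isTrace.1

lemma bdryMinusZero_subset_frontier {Ω : Set Plane} : bdryMinusZero Ω ⊆ frontier Ω :=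
  union_subset (fun _ hz => hz.1.1) fun _ hz => hz.1

lemma MemH1MinusZero.bdTrace_eq_zero {Ω : Set Plane}
    (hT : HasTraceInequality Ω (arcLength.restrict (frontier Ω))) {w : Plane → ℝ}
    (h : MemH1MinusZero Ω w) : ∀ᵐ z ∂(arcLength.restrict (bdryMinusZero Ω)), bdTrace Ω w z = 0 := by
  obtain ⟨g, hg, h0⟩ := h
  filter_upwards [h0, ae_restrict_of_ae_restrict_of_subset bdryMinusZero_subset_frontier
    (hg.bdTrace_ae_eq hT)] with z h1 h2
  rw [h2, h1]

lemma MemH1MinusZero.lincomb {Ω : Set Plane} (hΩ : IsOpen Ω) {u v W : Plane → ℝ}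
    (hu : MemH1MinusZero Ω u) (hv : MemH1MinusZero Ω v) {a b : ℝ}
    (h : W =ᵐ[volume.restrict Ω] fun z => a * u z + b * v z) : MemH1MinusZero Ω W := by
  obtain ⟨f, hf, hf0⟩ := hu
  obtain ⟨g, hg, hg0⟩ := hv
  refine ⟨_, (hf.lincomb hΩ hg a b).congr hΩ h.symm, ?_⟩
  filter_upwards [hf0, hg0] with z h1 h2
  rw [h1, h2]
  ring

/-! ### The mesh-dependent norm -/

lemma memH2_of_contDiff {U : Set Plane} (hU : IsOpen U) (hb : Bornology.IsBounded U)
    {f : Plane → ℝ} (hf : ContDiff ℝ ∞ f) : MemH2 U f :=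
  ⟨memH1_of_contDiff hU hb hf, fun i => (memH1_of_contDiff hU hb (contDiff_pd hf)).congr
    (wpd_of_contDiff hU hb hf i).symm⟩

namespace Triangulation

variable {Ω : Set Plane} {𝒯 : Triangulation Ω} {A B : Matrix (Fin 2) (Fin 2) ℝ} {u v w : Plane → ℝ}

lemma MemBrokenH2.memLp_avgGrad (h : 𝒯.MemBrokenH2 w) (i : Fin 2) :
    MemLp (fun z => 𝒯.avgGrad w z i) 2 arcLength := (h.memBdL2 i).avg

lemma MemBrokenH2.memLp_jump1Grad (h : 𝒯.MemBrokenH2 w) (i : Fin 2) :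
    MemLp (fun z => 𝒯.jump1Grad w z i) 2 arcLength := (h.memBdL2 i).jump1

lemma integrableOn_gradDensity (h : MemH1 Ω w) : IntegrableOn (𝒯.gradDensity B w) Ω := by
  have := integrable_mul_dotProduct (μ := volume.restrict Ω) (m := fun _ => 1) (C := 1)
    (ξ := wgrad Ω w) (η := wgrad Ω w) aestronglyMeasurable_const (ae_of_all _ fun _ => by simp)
    h.memL2_wpd h.memL2_wpd B
  simp only [one_mul] at this
  exact this

lemma integrableOn_secondDensity (h : 𝒯.MemBrokenH2 w) (k : Fin 𝒯.card) :
    IntegrableOn (𝒯.secondDensity A w k) (𝒯.elem k) := by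
  have := integrable_mul_dotProduct (μ := volume.restrict (𝒯.elem k)) (m := fun _ => 1) (C := 1)
    (ξ := wgrad (𝒯.elem k) (wpd (𝒯.elem k) 0 w)) (η := wgrad (𝒯.elem k) (wpd (𝒯.elem k) 0 w))
    aestronglyMeasurable_const (ae_of_all _ fun _ => by simp)
    ((h k).2 0).memL2_wpd ((h k).2 0).memL2_wpd A
  simp only [one_mul] at this
  exact this

lemma aestronglyMeasurable_outerNormal_mul (𝒯 : Triangulation Ω) (hΩ : IsPolygonalDomain Ω) :
    AEStronglyMeasurable (fun z : Plane => z 0 * outerNormal Ω z 1)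
      (arcLength.restrict (frontier Ω)) :=
  (Continuous.aestronglyMeasurable (by fun_prop)).mul (𝒯.aestronglyMeasurable_outerNormal_domain hΩ 1)

lemma exists_abs_outerNormal_mul_le (𝒯 : Triangulation Ω) (hΩ : IsPolygonalDomain Ω) :
    ∃ R, ∀ z ∈ frontier Ω, |z 0 * outerNormal Ω z 1| ≤ R := by
  obtain ⟨R, -, hR⟩ := 𝒯.exists_norm_le
  refine ⟨R, fun z hz => ?_⟩
  rw [abs_mul]
  exact (mul_le_of_le_one_right (abs_nonneg _) (abs_outerNormal_le _ _ _)).trans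
    ((abs_coord_le_norm _ _).trans (hR z (frontier_subset_skeleton hΩ hz)))

lemma bdryPlus_subset_frontier : bdryPlus Ω ⊆ frontier Ω := fun _ hz => hz.1.1

lemma integrableOn_outDensity (hΩ : IsPolygonalDomain Ω) (h : ∃ g, IsTrace Ω w g) :
    IntegrableOn (𝒯.outDensity w) (frontier Ω) arcLength := by
  obtain ⟨R, hR⟩ := 𝒯.exists_abs_outerNormal_mul_le hΩ
  refine Integrable.bdd_mul (c := R) ?_ (𝒯.aestronglyMeasurable_outerNormal_mul hΩ) ?_
  · exact (isTrace_bdTrace h).2.1.integrable_sq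
  · exact (ae_restrict_mem isClosed_frontier.measurableSet).mono hR

lemma integrableOn_outGradDensity (hΩ : IsPolygonalDomain Ω) (h : 𝒯.MemBrokenH2 w) :
    IntegrableOn (𝒯.outGradDensity A w) (frontier Ω) arcLength := by
  obtain ⟨R, hR⟩ := 𝒯.exists_abs_outerNormal_mul_le hΩ
  exact integrable_mul_dotProduct (𝒯.aestronglyMeasurable_outerNormal_mul hΩ)
    ((ae_restrict_mem isClosed_frontier.measurableSet).mono hR)
    (fun i => (h.memLp_avgGrad i).restrict _) (fun i => (h.memLp_avgGrad i).restrict _) A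

lemma integrable_jumpDensity (h : 𝒯.MemBrokenH2 w) (Cτ : ℝ) (p : ℕ) :
    Integrable (𝒯.jumpDensity A (𝒯.penalty Cτ p) w) arcLength := by
  obtain ⟨C, hC⟩ := 𝒯.exists_penalty_le Cτ p
  exact integrable_mul_dotProduct (aestronglyMeasurable_penalty Cτ p) (ae_of_all _ hC)
    h.memLp_jump1Grad h.memLp_jump1Grad A

lemma MemBdL2.integrable_inner_jump {φ : Fin 𝒯.card → Plane → ℝ} (h : 𝒯.MemBdL2 φ) :
    Integrable (fun z => ⟪𝒯.jump φ z, 𝒯.jump φ z⟫) arcLength := by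
  have := (h.jump 0).integrable_sq.add (h.jump 1).integrable_sq
  refine this.congr (ae_of_all _ fun z => ?_)
  simp only [Pi.add_apply, inner_plane]
  ring

lemma integrable_s1Density (h : 𝒯.MemBrokenH2 w) (κ lam : ℝ) :
    Integrable (𝒯.s1Density κ lam w w) arcLength := by
  obtain ⟨R, hR⟩ := 𝒯.exists_absXN2_le
  refine Integrable.bdd_mul (c := R / 2) ?_ (aestronglyMeasurable_absXN2.aemeasurable.div_const 2).aestronglyMeasurable
    (ae_of_all _ fun z => ?_)
  · exact ((h.memBdL2 0).integrable_inner_jump.const_mul κ).add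
      ((h.memBdL2 1).integrable_inner_jump.const_mul lam)
  · rw [norm_div, Real.norm_eq_abs, Real.norm_ofNat]
    linarith [hR z]

lemma tnormWellDefined (hΩ : IsPolygonalDomain Ω) (h : MemH1MinusZero Ω w)
    (h' : 𝒯.MemBrokenH2 w) (κ lam Cτ : ℝ) (p : ℕ) :
    𝒯.TNormWellDefined A B κ lam (𝒯.penalty Cτ p) w :=
  ⟨⟨_, h.isTrace⟩, fun k i => ⟨_, h'.isTrace i k⟩, integrableOn_gradDensity h.memH1,
    (integrableOn_outDensity hΩ ⟨_, h.isTrace⟩).mono_set bdryPlus_subset_frontier,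
    (integrableOn_outGradDensity hΩ h').mono_set bdryPlus_subset_frontier,
    integrableOn_secondDensity h', (integrable_jumpDensity h' Cτ p).integrableOn,
    (integrable_s1Density h' κ lam).integrableOn⟩

/-- The space `H¹₋,₀(Ω) ∩ H²(Ω, 𝒯)`. -/
def normSpace (𝒯 : Triangulation Ω) (hΩ : IsPolygonalDomain Ω) :
    Submodule ℝ (Lp ℝ 2 (volume.restrict Ω)) where
  carrier := {w | MemH1MinusZero Ω w ∧ 𝒯.MemBrokenH2 w}
  zero_mem' := by
    have h0 : (0 : Lp ℝ 2 (volume.restrict Ω)) =ᵐ[volume.restrict Ω] fun _ => (0 : ℝ) :=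
      Lp.coeFn_zero _ _ _
    refine ⟨⟨_, (isTrace_of_contDiff hΩ.isOpen hΩ.isBounded (arcLength_frontier_lt_top 𝒯 hΩ)
      (contDiff_const (c := (0 : ℝ)))).congr hΩ.isOpen h0.symm, ae_of_all _ fun _ => rfl⟩,
      fun k => ?_⟩
    exact (memH2_of_contDiff (𝒯.isOpen_elem k) (𝒯.isBounded_elem k) contDiff_const).congr
      (𝒯.isOpen_elem k) (ae_elem_of_ae hΩ h0 k).symm
  add_mem' := by
    rintro u v ⟨hu, hu'⟩ ⟨hv, hv'⟩
    have h : (u + v : Lp ℝ 2 (volume.restrict Ω)) =ᵐ[volume.restrict Ω]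
        fun z => 1 * u z + 1 * v z := by
      filter_upwards [Lp.coeFn_add u v] with z hz
      rw [hz, Pi.add_apply, one_mul, one_mul]
    exact ⟨hu.lincomb hΩ.isOpen hv h, hu'.lincomb hΩ hv' h⟩
  smul_mem' := by
    rintro c u ⟨hu, hu'⟩
    have h : (c • u : Lp ℝ 2 (volume.restrict Ω)) =ᵐ[volume.restrict Ω]
        fun z => c * u z + 0 * u z := by
      filter_upwards [Lp.coeFn_smul c u] with z hz
      rw [hz, Pi.smul_apply, smul_eq_mul, zero_mul, add_zero]
    exact ⟨hu.lincomb hΩ.isOpen hu h, hu'.lincomb hΩ hu' h⟩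

lemma mem_normSpace {hΩ : IsPolygonalDomain Ω} {w : Lp ℝ 2 (volume.restrict Ω)} :
    w ∈ 𝒯.normSpace hΩ ↔ MemH1MinusZero Ω w ∧ 𝒯.MemBrokenH2 w := Iff.rfl

/-- A single criterion for all terms of the norm: the density is a squared seminorm applied to a
quantity ξ that is linear in the function almost everywhere. The case b = 0 of the linearity
hypothesis gives homogeneity. -/
lemma isSqSeminorm_integral {hΩ : IsPolygonalDomain Ω} {F : Type*} [AddCommGroup F] [Module ℝ F]
    {μ : Measure Plane} {Q : Plane → F → ℝ} (hQ : ∀ᵐ z ∂μ, IsSqSeminorm (Q z))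
    {ξ : (Plane → ℝ) → Plane → F}
    (hξ : ∀ u v W : Plane → ℝ, MemH1MinusZero Ω u → 𝒯.MemBrokenH2 u → MemH1MinusZero Ω v →
      𝒯.MemBrokenH2 v → ∀ a b : ℝ, W =ᵐ[volume.restrict Ω] (fun z => a * u z + b * v z) →
      ∀ᵐ z ∂μ, ξ W z = a • ξ u z + b • ξ v z)
    (hint : ∀ w : Plane → ℝ, MemH1MinusZero Ω w → 𝒯.MemBrokenH2 w →
      Integrable (fun z => Q z (ξ w z)) μ) :
    IsSqSeminorm (fun u : 𝒯.normSpace hΩ => ∫ z, Q z (ξ u.1 z) ∂μ) := by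
  refine IsSqSeminorm.integral (ξ := fun (u : 𝒯.normSpace hΩ) z => ξ u.1 z) hQ (fun u v => ?_)
    (fun c u => ?_) fun u => hint _ u.2.1 u.2.2
  · have h : (u.1 + v.1 : Lp ℝ 2 (volume.restrict Ω)) =ᵐ[volume.restrict Ω]
        fun z => 1 * u.1 z + 1 * v.1 z := by
      filter_upwards [Lp.coeFn_add u.1 v.1] with z hz
      rw [hz, Pi.add_apply, one_mul, one_mul]
    filter_upwards [hξ _ _ _ u.2.1 u.2.2 v.2.1 v.2.2 1 1 h] with z hz
    rw [one_smul, one_smul] at hz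
    exact hz
  · have h : (c • u.1 : Lp ℝ 2 (volume.restrict Ω)) =ᵐ[volume.restrict Ω]
        fun z => c * u.1 z + 0 * u.1 z := by
      filter_upwards [Lp.coeFn_smul c u.1] with z hz
      rw [hz, Pi.smul_apply, smul_eq_mul, zero_mul, add_zero]
    filter_upwards [hξ _ _ _ u.2.1 u.2.2 u.2.1 u.2.2 c 0 h] with z hz
    rw [zero_smul, add_zero] at hz
    exact hz

lemma isSqSeminorm_tnormSq (hΩ : IsPolygonalDomain Ω) (hA : A.PosSemidef) (hB : B.PosSemidef)
    {κ lam Cτ : ℝ} (hκ : 0 ≤ κ) (hlam : 0 ≤ lam) (hC : 0 ≤ Cτ) (p : ℕ) :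
    IsSqSeminorm (fun u : 𝒯.normSpace hΩ => 𝒯.tnormSq A B κ lam (𝒯.penalty Cτ p) u.1) := by
  have hTΩ := hasTraceInequality_domain 𝒯 hΩ
  have hplus : ∀ᵐ z ∂(arcLength.restrict (bdryPlus Ω)), 0 ≤ z 0 * outerNormal Ω z 1 :=
    (ae_restrict_mem (measurableSet_bdryPlus 𝒯 hΩ)).mono fun z hz => hz.2
  refine (((((?_ : IsSqSeminorm _).add ?_).add ?_).add ?_).add ?_).add ?_
  · refine isSqSeminorm_integral (Q := fun _ ξ => ξ ⬝ᵥ (B *ᵥ ξ)) (ξ := wgrad Ω)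
      (ae_of_all _ fun _ => .matrix hB) (fun u v W hu _ hv _ a b h => ?_)
      fun w hw _ => integrableOn_gradDensity (𝒯 := 𝒯) hw.memH1
    have h1 := fun i => ((hu.memH1.lincomb hv.memH1 a b).wpd_congr hΩ.isOpen h.symm i).trans
      (hu.memH1.wpd_lincomb hΩ.isOpen hv.memH1 a b i)
    filter_upwards [h1 0, h1 1] with z h0 h1
    ext i
    fin_cases i
    · exact h0
    · exact h1
  · refine isSqSeminorm_integral (Q := fun z x => z 0 * outerNormal Ω z 1 * x ^ 2)
      (ξ := bdTrace Ω) (hplus.mono fun z hz => IsSqSeminorm.sq.const_mul hz)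
      (fun u v W hu _ hv _ a b h => ?_) fun w hw _ =>
        (integrableOn_outDensity (𝒯 := 𝒯) hΩ ⟨_, hw.isTrace⟩).mono_set bdryPlus_subset_frontier
    refine ae_restrict_of_ae_restrict_of_subset bdryPlus_subset_frontier ?_
    exact IsTrace.bdTrace_ae_eq hTΩ ((hu.isTrace.lincomb hΩ.isOpen hv.isTrace a b).congr
      hΩ.isOpen h.symm)
  · refine isSqSeminorm_integral (Q := fun z ξ => z 0 * outerNormal Ω z 1 * (ξ ⬝ᵥ (A *ᵥ ξ)))
      (ξ := 𝒯.avgGrad) (hplus.mono fun z hz => (IsSqSeminorm.matrix hA).const_mul hz)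
      (fun u v W _ hu _ hv a b h => ae_restrict_of_ae ?_) fun w _ hw =>
        (integrableOn_outGradDensity hΩ hw).mono_set bdryPlus_subset_frontier
    filter_upwards [hu.bdPD_lincomb hΩ hv h 0, hu.bdPD_lincomb hΩ hv h 1] with z h0 h1
    ext i
    fin_cases i
    · exact (avg_congr h0).trans (avg_lincomb _ _ _ _ _)
    · exact (avg_congr h1).trans (avg_lincomb _ _ _ _ _)
  · refine IsSqSeminorm.sum _ fun k => isSqSeminorm_integral (Q := fun _ ξ => ξ ⬝ᵥ (A *ᵥ ξ))
      (ξ := fun w => wgrad (𝒯.elem k) (wpd (𝒯.elem k) 0 w))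
      (ae_of_all _ fun _ => .matrix hA) (fun u v W _ hu _ hv a b h => ?_)
      fun w _ hw => integrableOn_secondDensity hw k
    filter_upwards [hu.wpd_wpd_lincomb hΩ hv h 0 0 k, hu.wpd_wpd_lincomb hΩ hv h 0 1 k] with z h0 h1
    ext i
    fin_cases i
    · exact h0
    · exact h1
  · refine isSqSeminorm_integral (Q := fun z ξ => 𝒯.penalty Cτ p z * (ξ ⬝ᵥ (A *ᵥ ξ)))
      (ξ := 𝒯.jump1Grad)
      (ae_of_all _ fun z => (IsSqSeminorm.matrix hA).const_mul (penalty_nonneg hC p z))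
      (fun u v W _ hu _ hv a b h => ae_restrict_of_ae ?_) fun w _ hw =>
        (integrable_jumpDensity hw Cτ p).integrableOn
    filter_upwards [hu.bdPD_lincomb hΩ hv h 0, hu.bdPD_lincomb hΩ hv h 1] with z h0 h1
    ext i
    fin_cases i
    · exact (jump1_congr h0).trans (jump1_lincomb _ _ _ _ _)
    · exact (jump1_congr h1).trans (jump1_lincomb _ _ _ _ _)
  · refine isSqSeminorm_integral (F := Plane × Plane)
      (Q := fun z x => 𝒯.absXN2 z / 2 * (κ * ⟪x.1, x.1⟫ + lam * ⟪x.2, x.2⟫))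
      (ξ := fun w z => (𝒯.jump (𝒯.bdPD 0 w) z, 𝒯.jump (𝒯.bdPD 1 w) z))
      (ae_of_all _ fun z => ?_) (fun u v W _ hu _ hv a b h => ae_restrict_of_ae ?_) fun w _ hw =>
        (integrable_s1Density hw κ lam).integrableOn
    · exact (((IsSqSeminorm.inner.comp_linearMap (LinearMap.fst ℝ Plane Plane)).const_mul hκ).add
        ((IsSqSeminorm.inner.comp_linearMap (LinearMap.snd ℝ Plane Plane)).const_mul
          hlam)).const_mul (div_nonneg (absXN2_nonneg z) zero_le_two)
    filter_upwards [hu.bdPD_lincomb hΩ hv h 0, hu.bdPD_lincomb hΩ hv h 1] with z h0 h1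
    exact Prod.ext ((jump_congr h0).trans (jump_lincomb _ _ _ _ _))
      ((jump_congr h1).trans (jump_lincomb _ _ _ _ _))

lemma s1_nonneg {κ lam : ℝ} (hκ : 0 ≤ κ) (hlam : 0 ≤ lam) (w : Plane → ℝ) :
    0 ≤ 𝒯.s1 κ lam w w :=
  integral_nonneg fun z => mul_nonneg (div_nonneg (absXN2_nonneg z) zero_le_two)
    (add_nonneg (mul_nonneg hκ real_inner_self_nonneg) (mul_nonneg hlam real_inner_self_nonneg))

lemma integral_gradDensity_le_tnormSq (hΩ : IsPolygonalDomain Ω) (hA : A.PosSemidef)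
    {κ lam Cτ : ℝ} (hκ : 0 ≤ κ) (hlam : 0 ≤ lam) (hC : 0 ≤ Cτ) (p : ℕ) (w : Plane → ℝ) :
    ∫ z in Ω, 𝒯.gradDensity B w z ≤ 𝒯.tnormSq A B κ lam (𝒯.penalty Cτ p) w := by
  have hQ : ∀ ξ : Fin 2 → ℝ, 0 ≤ ξ ⬝ᵥ (A *ᵥ ξ) := (IsSqSeminorm.matrix hA).nonneg
  have h1 : 0 ≤ ∫ z in bdryPlus Ω, 𝒯.outDensity w z ∂arcLength :=
    setIntegral_nonneg (measurableSet_bdryPlus 𝒯 hΩ) fun z hz => mul_nonneg hz.2 (sq_nonneg _)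
  have h2 : 0 ≤ ∫ z in bdryPlus Ω, 𝒯.outGradDensity A w z ∂arcLength :=
    setIntegral_nonneg (measurableSet_bdryPlus 𝒯 hΩ) fun z hz => mul_nonneg hz.2 (hQ _)
  have h3 : 0 ≤ ∑ k, ∫ z in 𝒯.elem k, 𝒯.secondDensity A w k z :=
    Finset.sum_nonneg fun k _ => integral_nonneg fun z => hQ _
  have h4 : 0 ≤ ∫ z in 𝒯.interiorSkeleton ∪ bdryZero Ω,
      𝒯.jumpDensity A (𝒯.penalty Cτ p) w z ∂arcLength :=
    integral_nonneg fun z => mul_nonneg (penalty_nonneg hC p z) (hQ _)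
  have h5 := s1_nonneg (𝒯 := 𝒯) hκ hlam w
  rw [tnormSq]
  linarith

/-- Only the gradient term is used. B is positive definite, so the weak gradient vanishes and the
function is constant; the trace of a constant is that constant, and it must be zero on a set of
positive length. -/
lemma ae_eq_zero_of_tnormSq_eq_zero (hΩ : IsPolygonalDomain Ω)
    (hpos : 0 < arcLength (bdryMinusZero Ω)) (hA : A.PosSemidef) (hB : B.PosDef)
    {κ lam Cτ : ℝ} (hκ : 0 ≤ κ) (hlam : 0 ≤ lam) (hC : 0 ≤ Cτ) (p : ℕ)
    (hw : MemH1MinusZero Ω w) (h : 𝒯.tnormSq A B κ lam (𝒯.penalty Cτ p) w = 0) :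
    w =ᵐ[volume.restrict Ω] 0 := by
  have hTΩ := hasTraceInequality_domain 𝒯 hΩ
  have hQ : ∀ ξ : Fin 2 → ℝ, 0 ≤ ξ ⬝ᵥ (B *ᵥ ξ) := (IsSqSeminorm.matrix hB.posSemidef).nonneg
  have h0 : ∫ z in Ω, 𝒯.gradDensity B w z = 0 := le_antisymm
    (h ▸ integral_gradDensity_le_tnormSq hΩ hA hκ hlam hC p w) (integral_nonneg fun z => hQ _)
  have h1 := (integral_eq_zero_iff_of_nonneg (fun z => hQ _)
    (integrableOn_gradDensity (𝒯 := 𝒯) hw.memH1)).1 h0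
  have h2 : ∀ᵐ z ∂(volume.restrict Ω), wgrad Ω w z = 0 := by
    filter_upwards [h1] with z hz
    by_contra hne
    have := hB.dotProduct_mulVec_pos hne
    simp only [star_trivial] at this
    exact this.ne' hz
  obtain ⟨c, hc⟩ := exists_ae_eq_const hΩ.isOpen hΩ.isConnected hw.memH1.1 fun i =>
    (hw.memH1.hasWeakPD i).congr_right (h2.mono fun z hz => congrFun hz i)
  have htr : IsTrace Ω w fun _ => c := (isTrace_of_contDiff hΩ.isOpen hΩ.isBounded
    (arcLength_frontier_lt_top 𝒯 hΩ) contDiff_const).congr hΩ.isOpen (EventuallyEq.symm hc)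
  have hne : (ae (arcLength.restrict (bdryMinusZero Ω))).NeBot := by
    rw [ae_neBot, Ne, Measure.restrict_eq_zero]
    exact hpos.ne'
  obtain ⟨z, hz1, hz2⟩ := ((hw.bdTrace_eq_zero hTΩ).and (ae_restrict_of_ae_restrict_of_subset
    bdryMinusZero_subset_frontier (htr.bdTrace_ae_eq hTΩ))).exists
  filter_upwards [hc] with y hy
  exact hy.trans (hz2.symm.trans hz1)

theorem exists_addGroupNorm (hΩ : IsPolygonalDomain Ω) (hpos : 0 < arcLength (bdryMinusZero Ω))
    (hA : A.PosSemidef) (hB : B.PosDef) {κ lam Cτ : ℝ} (hκ : 0 ≤ κ) (hlam : 0 ≤ lam)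
    (hC : 0 ≤ Cτ) (p : ℕ) :
    ∃ N : AddGroupNorm (𝒯.normSpace hΩ),
      (∀ w, N w = 𝒯.tnorm A B κ lam (𝒯.penalty Cτ p) w.1) ∧
      ∀ (c : ℝ) (w), N (c • w) = |c| * N w := by
  have h := isSqSeminorm_tnormSq (𝒯 := 𝒯) hΩ hA hB.posSemidef hκ hlam hC p
  refine ⟨h.toAddGroupNorm fun w hw => ?_, fun w => rfl, h.sqrt_smul⟩
  refine Subtype.ext ?_
  rw [Lp.ext_iff]
  exact (ae_eq_zero_of_tnormSq_eq_zero hΩ hpos hA hB hκ hlam hC p w.2.1 hw).trans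
    (Lp.coeFn_zero _ _ _).symm

end Triangulation

/-! ### Piecewise polynomial functions -/

lemma pd_comm {f : Plane → ℝ} (hf : ContDiff ℝ ∞ f) (i j : Fin 2) (z : Plane) :
    pd i (pd j f) z = pd j (pd i f) z := by
  have hd : DifferentiableAt ℝ (fderiv ℝ f) z :=
    ((hf.fderiv_right (m := ∞) (by simp)).differentiable (by simp)) z
  have hpd : ∀ i j, pd i (pd j f) z = fderiv ℝ (fderiv ℝ f) z (EuclideanSpace.single i 1)
      (EuclideanSpace.single j 1) := by
    intro i j
    change fderiv ℝ (fun y => fderiv ℝ f y (EuclideanSpace.single j 1)) z _ = _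
    rw [fderiv_clm_apply hd (differentiableAt_const _)]
    simp
  rw [hpd, hpd]
  exact (hf.contDiffAt.of_le (WithTop.coe_le_coe.2 (le_top : (2 : ℕ∞) ≤ ⊤))).isSymmSndFDerivAt (n := 2) (by simp) _ _

lemma pd_polyFun (P : MvPolynomial (Fin 2) ℝ) (i : Fin 2) :
    pd i (polyFun P) = polyFun (MvPolynomial.pderiv i P) := by
  have hdiff : ∀ P, Differentiable ℝ (polyFun P) := fun P =>
    (contDiff_polyFun P).differentiable (by simp)
  ext z
  induction P using MvPolynomial.induction_on with
  | C a =>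
    have : polyFun (MvPolynomial.C a) = fun _ => a := by ext z; simp [polyFun]
    rw [this]
    simp [pd, polyFun]
  | add P Q hP hQ =>
    have e : ∀ P Q, polyFun (P + Q) = fun z => 1 * polyFun P z + 1 * polyFun Q z := by
      intro P Q; ext z; simp [polyFun]
    rw [map_add, e, pd_lincomb (hdiff P) (hdiff Q), hP, hQ, e]
  | mul_X P n hP =>
    have e : polyFun (P * MvPolynomial.X n) = fun z => polyFun P z * (z n - 0) := by
      ext z; simp [polyFun]
    rw [e, pd_mul (hdiff P) (by fun_prop), hP, pd_coord]
    by_cases h : i = n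
    · subst h
      simp [polyFun, Derivation.leibniz]
    · simp [polyFun, Derivation.leibniz, h, MvPolynomial.pderiv_X_of_ne (Ne.symm h)]

lemma totalDegree_pderiv_le (P : MvPolynomial (Fin 2) ℝ) (i : Fin 2) :
    (MvPolynomial.pderiv i P).totalDegree ≤ P.totalDegree := by
  conv_lhs => rw [P.as_sum, map_sum]
  refine (MvPolynomial.totalDegree_finsetSum _ _).trans (Finset.sup_le fun s hs => ?_)
  rw [MvPolynomial.pderiv_monomial]
  refine (MvPolynomial.totalDegree_monomial_le _ _).trans
    (le_trans ?_ (MvPolynomial.le_totalDegree hs))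
  rw [Finsupp.sum_fintype _ _ fun _ => rfl, Finsupp.sum_fintype _ _ fun _ => rfl]
  exact Finset.sum_le_sum fun j _ => by simp

lemma matA_dotProduct (α β γ : ℝ) (ξ η : Fin 2 → ℝ) :
    ξ ⬝ᵥ (matA α β γ *ᵥ η) =
      α * ξ 0 * η 0 + β * (ξ 0 * η 1 + ξ 1 * η 0) + γ * ξ 1 * η 1 := by
  simp [matA, dotProduct, Matrix.mulVec, Fin.sum_univ_two]
  ring

lemma matB_dotProduct (α β ε : ℝ) (ξ : Fin 2 → ℝ) :
    ξ ⬝ᵥ (matB α β ε *ᵥ ξ) = 2 * (1 - ε) * ξ 0 ^ 2 + (2 * β - α ^ 2 / (2 * ε)) * ξ 1 ^ 2 := by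
  simp [matB, dotProduct, Matrix.mulVec_diagonal, Fin.sum_univ_two]
  ring

/-- A Cholesky factorisation. If α = 0, non-negativity of the determinant forces β = 0, which makes
the degenerate case diagonal. -/
lemma exists_sum_sq_of_posSemidef {α β γ : ℝ} (h : (matA α β γ).PosSemidef) :
    ∃ a b c : ℝ, ∀ ξ : Fin 2 → ℝ,
      ξ ⬝ᵥ (matA α β γ *ᵥ ξ) = (a * ξ 0 + b * ξ 1) ^ 2 + (c * ξ 1) ^ 2 := by
  have hα : 0 ≤ α := h.diag_nonneg (i := 0)
  have hγ : 0 ≤ γ := h.diag_nonneg (i := 1)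
  have hdet : 0 ≤ α * γ - β * β := by
    have := h.det_nonneg
    rwa [matA, Matrix.det_fin_two_of] at this
  simp only [matA_dotProduct]
  rcases hα.eq_or_lt with rfl | hα
  · have hβ : β = 0 := by nlinarith
    refine ⟨0, 0, √γ, fun ξ => ?_⟩
    rw [mul_pow, Real.sq_sqrt hγ, hβ]
    ring
  · refine ⟨√α, β / √α, √(γ - β ^ 2 / α), fun ξ => ?_⟩
    have h1 : 0 ≤ γ - β ^ 2 / α := by
      rw [sub_nonneg, div_le_iff₀ hα]
      nlinarith
    have h2 : √α * (β / √α) = β := by field_simp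
    have h3 : (β / √α) ^ 2 = β ^ 2 / α := by rw [div_pow, Real.sq_sqrt hα.le]
    have h4 : √α ^ 2 = α := Real.sq_sqrt hα.le
    rw [mul_pow (√(γ - β ^ 2 / α)), Real.sq_sqrt h1]
    linear_combination (-ξ 0 ^ 2) * h4 - 2 * ξ 0 * ξ 1 * h2 - ξ 1 ^ 2 * h3

/-- The trace inequality for vectors of polynomials in the seminorm of a non-negative definite
matrix. -/
lemma polynomial_trace_inequality_matA {v : Fin 3 → Plane} (hv : AffineIndependent ℝ v) {σ : ℝ}
    (hσ : Metric.diam (openTriangle v) ≤ σ * inradius (openTriangle v)) {α β γ : ℝ}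
    (hA : (matA α β γ).PosSemidef) {p : ℕ} (hp : 1 ≤ p) (P : Fin 2 → MvPolynomial (Fin 2) ℝ)
    (hP : ∀ j, (P j).totalDegree ≤ p) :
    Metric.diam (openTriangle v) * ∫ z in frontier (openTriangle v),
      (fun j => polyFun (P j) z) ⬝ᵥ (matA α β γ *ᵥ fun j => polyFun (P j) z) ∂arcLength ≤
    48 * |σ| * p ^ 2 * ∫ z in openTriangle v,
      (fun j => polyFun (P j) z) ⬝ᵥ (matA α β γ *ᵥ fun j => polyFun (P j) z) := by
  obtain ⟨a, b, c, habc⟩ := exists_sum_sq_of_posSemidef hA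
  -- The quadratic form of the vector is the sum of squares of the two scalar polynomials R and S,
  -- of degree at most p. The constant thus does not depend on A.
  set R := MvPolynomial.C a * P 0 + MvPolynomial.C b * P 1 with hR
  set S := MvPolynomial.C c * P 1 with hS
  have hCd : ∀ (a : ℝ) j, (MvPolynomial.C a * P j).totalDegree ≤ p := fun a j => by
    rw [MvPolynomial.C_mul']
    exact (MvPolynomial.totalDegree_smul_le _ _).trans (hP j)
  have e : ∀ z, (fun j => polyFun (P j) z) ⬝ᵥ (matA α β γ *ᵥ fun j => polyFun (P j) z) =
      polyFun R z ^ 2 + polyFun S z ^ 2 := fun z => by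
    rw [habc]
    simp [hR, hS, polyFun]
  have hcont : ∀ Q, Continuous fun z => polyFun Q z ^ 2 := fun Q =>
    (contDiff_polyFun Q).continuous.pow 2
  have hi1 : ∀ Q, IntegrableOn (fun z => polyFun Q z ^ 2) (frontier (openTriangle v)) arcLength :=
    fun Q => integrableOn_frontier_of_continuous hv (hcont Q)
  have hi2 : ∀ Q, IntegrableOn (fun z => polyFun Q z ^ 2) (openTriangle v) volume := fun Q =>
    (memL2_of_continuous (isOpen_openTriangle v) (isBounded_openTriangle v)
      (contDiff_polyFun Q).continuous).integrable_sq
  simp only [e]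
  rw [integral_add (hi1 R) (hi1 S), integral_add (hi2 R) (hi2 S), mul_add, mul_add]
  exact add_le_add
    (polynomial_trace_inequality hv hσ R hp ((MvPolynomial.totalDegree_add _ _).trans
      (max_le (hCd a 0) (hCd b 1))))
    (polynomial_trace_inequality hv hσ S hp (hCd c 1))

/-! ### Piecewise smooth functions -/

namespace Triangulation

variable {Ω : Set Plane} {𝒯 : Triangulation Ω} {w : Plane → ℝ} {f : Fin 𝒯.card → Plane → ℝ}

/-- On every element `T_k` the function `w` agrees with the smooth function `f k`. -/
structure IsPiecewise (𝒯 : Triangulation Ω) (w : Plane → ℝ) (f : Fin 𝒯.card → Plane → ℝ) :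
    Prop where
  contDiff : ∀ k, ContDiff ℝ ∞ (f k)
  ae_eq : ∀ k, w =ᵐ[volume.restrict (𝒯.elem k)] f k

namespace IsPiecewise

lemma wpd_ae_eq (h : 𝒯.IsPiecewise w f) (i : Fin 2) (k : Fin 𝒯.card) :
    wpd (𝒯.elem k) i w =ᵐ[volume.restrict (𝒯.elem k)] pd i (f k) :=
  ((memH1_of_contDiff (𝒯.isOpen_elem k) (𝒯.isBounded_elem k) (h.contDiff k)).wpd_congr
    (𝒯.isOpen_elem k) (h.ae_eq k).symm i).trans
      (wpd_of_contDiff (𝒯.isOpen_elem k) (𝒯.isBounded_elem k) (h.contDiff k) i)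

lemma wpd_wpd_ae_eq (h : 𝒯.IsPiecewise w f) (i j : Fin 2) (k : Fin 𝒯.card) :
    wpd (𝒯.elem k) j (wpd (𝒯.elem k) i w) =ᵐ[volume.restrict (𝒯.elem k)] pd j (pd i (f k)) :=
  ((memH1_of_contDiff (𝒯.isOpen_elem k) (𝒯.isBounded_elem k) (contDiff_pd (h.contDiff k))).wpd_congr
    (𝒯.isOpen_elem k) (h.wpd_ae_eq i k).symm j).trans
      (wpd_of_contDiff (𝒯.isOpen_elem k) (𝒯.isBounded_elem k) (contDiff_pd (h.contDiff k)) j)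

lemma wpd_transport_ae_eq (h : 𝒯.IsPiecewise w f) (i : Fin 2) (k : Fin 𝒯.card) :
    wpd (𝒯.elem k) i (fun y => y 0 * wpd (𝒯.elem k) 1 w y) =ᵐ[volume.restrict (𝒯.elem k)]
      pd i (fun y => y 0 * pd 1 (f k) y) := by
  have hs : ContDiff ℝ ∞ (fun y : Plane => y 0 * pd 1 (f k) y) :=
    ContDiff.mul (by fun_prop) (contDiff_pd (h.contDiff k))
  refine ((memH1_of_contDiff (𝒯.isOpen_elem k) (𝒯.isBounded_elem k) hs).wpd_congr
    (𝒯.isOpen_elem k) ?_ i).trans (wpd_of_contDiff (𝒯.isOpen_elem k) (𝒯.isBounded_elem k) hs i)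
  filter_upwards [h.wpd_ae_eq 1 k] with z hz
  rw [hz]

lemma wpd_domain_ae_eq (h : 𝒯.IsPiecewise w f) (hΩ : IsPolygonalDomain Ω) (hw : MemH1 Ω w)
    (i : Fin 2) (k : Fin 𝒯.card) : wpd Ω i w =ᵐ[volume.restrict (𝒯.elem k)] pd i (f k) :=
  (hw.wpd_mono (𝒯.isOpen_elem k) (𝒯.elem_subset hΩ k) i).symm.trans (h.wpd_ae_eq i k)

lemma memBrokenH2 (h : 𝒯.IsPiecewise w f) : 𝒯.MemBrokenH2 w := fun k =>
  (memH2_of_contDiff (𝒯.isOpen_elem k) (𝒯.isBounded_elem k) (h.contDiff k)).congr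
    (𝒯.isOpen_elem k) (h.ae_eq k).symm

lemma isTrace_of_ae_eq {k : Fin 𝒯.card} {g φ : Plane → ℝ} (hφ : ContDiff ℝ ∞ φ)
    (hg : g =ᵐ[volume.restrict (𝒯.elem k)] φ) : IsTrace (𝒯.elem k) g φ :=
  (isTrace_of_contDiff (𝒯.isOpen_elem k) (𝒯.isBounded_elem k) (arcLength_frontier_elem_lt_top k)
    hφ).congr (𝒯.isOpen_elem k) hg.symm

lemma bdPD_eq (h : 𝒯.IsPiecewise w f) (i : Fin 2) :
    𝒯.BdEq (𝒯.bdPD i w) (fun k => pd i (f k)) :=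
  bdEq_of_forall fun k => (isTrace_of_ae_eq (contDiff_pd (h.contDiff k))
    (h.wpd_ae_eq i k)).bdTrace_ae_eq (hasTraceInequality_elem k)

lemma bdPDx_eq (h : 𝒯.IsPiecewise w f) (j : Fin 2) :
    𝒯.BdEq (𝒯.bdPDx j w) (fun k => pd j (pd 0 (f k))) :=
  bdEq_of_forall fun k => (isTrace_of_ae_eq (contDiff_pd (contDiff_pd (h.contDiff k)))
    (h.wpd_wpd_ae_eq 0 j k)).bdTrace_ae_eq (hasTraceInequality_elem k)

lemma bdTrace_eq (h : 𝒯.IsPiecewise w f) (hΩ : IsPolygonalDomain Ω) (hw : MemH1MinusZero Ω w) :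
    ∀ᵐ z ∂arcLength, z ∈ frontier Ω → ∀ k ∈ 𝒯.elemsAt z, bdTrace Ω w z = f k z := by
  have hk : ∀ k, ∀ᵐ z ∂arcLength, z ∈ frontier Ω ∩ frontier (𝒯.elem k) →
      bdTrace Ω w z = f k z := fun k =>
    (ae_restrict_iff' (isClosed_frontier.measurableSet.inter (measurableSet_frontier_elem k))).1
      (hw.isTrace.ae_eq_of_subset (𝒯.isOpen_elem k) (𝒯.elem_subset hΩ k)
        (hasTraceInequality_elem k) (isTrace_of_ae_eq (h.contDiff k) (h.ae_eq k)))
  filter_upwards [ae_all_iff.2 hk] with z hz hzΩ k hkz using hz k ⟨hzΩ, mem_elemsAt.1 hkz⟩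

/-- Continuity across faces: membership in H¹(Ω) with a trace provides one smooth sequence
approximating `w` on both elements at once, so both one-sided traces are limits of the same boundary
values. -/
lemma eq_of_mem_elemsAt (h : 𝒯.IsPiecewise w f) (hΩ : IsPolygonalDomain Ω)
    (hw : MemH1MinusZero Ω w) :
    ∀ᵐ z ∂arcLength, ∀ k ∈ 𝒯.elemsAt z, ∀ l ∈ 𝒯.elemsAt z, f k z = f l z := by
  have hk : ∀ k l, ∀ᵐ z ∂arcLength, z ∈ frontier (𝒯.elem k) ∩ frontier (𝒯.elem l) →
      f k z = f l z := fun k l =>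
    (ae_restrict_iff' ((measurableSet_frontier_elem k).inter (measurableSet_frontier_elem l))).1
      (MemH1.trace_ae_eq (𝒯.isOpen_elem k) (𝒯.elem_subset hΩ k) (𝒯.isOpen_elem l)
        (𝒯.elem_subset hΩ l) (hasTraceInequality_elem k) (hasTraceInequality_elem l) hw.isTrace
        (isTrace_of_ae_eq (h.contDiff k) (h.ae_eq k)) (isTrace_of_ae_eq (h.contDiff l) (h.ae_eq l)))
  filter_upwards [ae_all_iff.2 fun k => ae_all_iff.2 (hk k)] with z hz k hk l hl
    using hz k l ⟨mem_elemsAt.1 hk, mem_elemsAt.1 hl⟩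

end IsPiecewise

end Triangulation

/-! ### The energy identity on an element -/

/-- Reduces an inequality between many integrals to a pointwise one, so that the energy balances
need no term-by-term splitting. -/
lemma sum_mul_integral_nonneg {μ : Measure Plane} {n : ℕ} {c : Fin n → ℝ}
    {F : Fin n → Plane → ℝ} (hF : ∀ i, Integrable (F i) μ)
    (h : ∀ᵐ z ∂μ, 0 ≤ ∑ i, c i * F i z) : 0 ≤ ∑ i, c i * ∫ z, F i z ∂μ := by
  simp only [← integral_const_mul]
  rw [← integral_finsetSum _ fun i _ => (hF i).const_mul (c i)]
  exact integral_nonneg_of_ae h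

lemma pd_add {f g : Plane → ℝ} (hf : Differentiable ℝ f) (hg : Differentiable ℝ g) (i : Fin 2)
    (z : Plane) : pd i (fun y => f y + g y) z = pd i f z + pd i g z := by
  simpa using pd_lincomb hf hg 1 1 i z

lemma pd_coord_mul {g : Plane → ℝ} (hg : Differentiable ℝ g) (i j : Fin 2) (z : Plane) :
    pd i (fun y => y j * g y) z = z j * pd i g z + g z * if i = j then 1 else 0 := by
  have := pd_mul (f := fun y : Plane => y j) (by fun_prop) hg i z
  have h0 := pd_coord i j 0 z
  simp only [sub_zero] at h0
  rw [this, h0]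

/-- The flux of the energy of the transport part of the equation. -/
def flux (α β γ : ℝ) (f : Plane → ℝ) (z : Plane) : ℝ :=
  z 0 * (f z * f z + (fun i => pd i f z) ⬝ᵥ (matA α β γ *ᵥ fun i => pd i f z))

lemma contDiff_flux (α β γ : ℝ) {f : Plane → ℝ} (hf : ContDiff ℝ ∞ f) :
    ContDiff ℝ ∞ (flux α β γ f) := by
  have h0 := contDiff_pd (i := 0) hf
  have h1 := contDiff_pd (i := 1) hf
  unfold flux
  simp only [matA_dotProduct]
  fun_prop

/-- The last bracket is the commutator of ∂ₓ with multiplication by x, paired with A∇f. It is the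
source of the control of the y-derivative. -/
lemma pd_flux (α β γ : ℝ) {f : Plane → ℝ} (hf : ContDiff ℝ ∞ f) (z : Plane) :
    pd 1 (flux α β γ f) z = 2 * (z 0 * pd 1 f z * f z) +
      2 * ((fun i => pd i (fun y => y 0 * pd 1 f y) z) ⬝ᵥ (matA α β γ *ᵥ fun i => pd i f z)) -
      2 * (α * pd 0 f z * pd 1 f z + β * pd 1 f z ^ 2) := by
  have hd : Differentiable ℝ f := hf.differentiable (by simp)
  have hg : ∀ i, Differentiable ℝ (pd i f) := fun i => (contDiff_pd hf).differentiable (by simp)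
  have e : flux α β γ f = fun y => y 0 * (f y * f y + (α * (pd 0 f y * pd 0 f y) +
      (2 * β) * (pd 0 f y * pd 1 f y) + γ * (pd 1 f y * pd 1 f y))) := by
    ext y
    simp only [flux, matA_dotProduct]
    ring
  have hff : Differentiable ℝ fun y => f y * f y := hd.mul hd
  have hgg : ∀ i j, Differentiable ℝ fun y => pd i f y * pd j f y := fun i j => (hg i).mul (hg j)
  have hd3 : Differentiable ℝ fun y => α * (pd 0 f y * pd 0 f y) +
      (2 * β) * (pd 0 f y * pd 1 f y) := ((hgg 0 0).const_mul _).add ((hgg 0 1).const_mul _)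
  have hd4 : Differentiable ℝ fun y => α * (pd 0 f y * pd 0 f y) +
      (2 * β) * (pd 0 f y * pd 1 f y) + γ * (pd 1 f y * pd 1 f y) :=
    hd3.add ((hgg 1 1).const_mul _)
  have hd5 : Differentiable ℝ fun y => f y * f y + (α * (pd 0 f y * pd 0 f y) +
      (2 * β) * (pd 0 f y * pd 1 f y) + γ * (pd 1 f y * pd 1 f y)) := hff.add hd4
  have h4 := pd_lincomb hd3 (hgg 1 1) 1 γ 1 z
  simp only [one_mul] at h4
  rw [e, pd_coord_mul hd5, pd_add hff hd4, h4, pd_lincomb (hgg 0 0) (hgg 0 1),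
    pd_mul hd hd, pd_mul (hg 0) (hg 0), pd_mul (hg 0) (hg 1), pd_mul (hg 1) (hg 1),
    matA_dotProduct]
  simp only [pd_coord_mul (hg 1)]
  rw [pd_comm hf 0 1]
  simp
  ring

/-- The energy of the volume terms on a triangle. -/
lemma le_volume_terms {v : Fin 3 → Plane} (hv : AffineIndependent ℝ v) {f : Plane → ℝ}
    (hf : ContDiff ℝ ∞ f) (α β γ : ℝ) {ε : ℝ} (hε : 0 < ε) :
    (1 / 2) * (∫ z in openTriangle v,
        (fun j => pd j (pd 0 f) z) ⬝ᵥ (matA α β γ *ᵥ fun j => pd j (pd 0 f) z)) +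
      (1 / 2) * (∫ z in frontier (openTriangle v),
        flux α β γ f z * outerNormal (openTriangle v) z 1 ∂arcLength) ≤
    (∫ z in openTriangle v, pd 0 f z * pd 0 f z) + (∫ z in openTriangle v, z 0 * pd 1 f z * f z) +
      (∫ z in openTriangle v,
        (matA α β γ *ᵥ fun j => pd j (pd 0 f) z) ⬝ᵥ fun j => pd j (pd 0 f) z) +
      (∫ z in openTriangle v,
        (fun i => pd i (fun y => y 0 * pd 1 f y) z) ⬝ᵥ (matA α β γ *ᵥ fun i => pd i f z)) -
      (1 / 2) * ((∫ z in openTriangle v,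
          (fun i => pd i f z) ⬝ᵥ (matB α β ε *ᵥ fun i => pd i f z)) +
        ∫ z in openTriangle v,
          (fun j => pd j (pd 0 f) z) ⬝ᵥ (matA α β γ *ᵥ fun j => pd j (pd 0 f) z)) := by
  have hint : ∀ {g : Plane → ℝ}, Continuous g → IntegrableOn g (openTriangle v) := fun hg =>
    (hg.continuousOn.integrableOn_compact (isBounded_openTriangle v).isCompact_closure).mono_set
      subset_closure
  have c0 := hf.continuous
  have c1 := fun i => continuous_pd (i := i) hf
  have c2 := fun i j => continuous_pd (i := i) (contDiff_pd (i := j) hf)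
  have c3 : ∀ i, Continuous (pd i fun y : Plane => y 0 * pd 1 f y) := fun i =>
    continuous_pd (ContDiff.mul (by fun_prop) (contDiff_pd hf))
  have c4 := continuous_pd (i := 1) (contDiff_flux α β γ hf)
  rw [← setIntegral_pd_openTriangle hv 1 ((contDiff_flux α β γ hf).of_le
    (by exact_mod_cast le_top))]
  simp only [dotProduct_comm (matA α β γ *ᵥ _)]
  have i1 : IntegrableOn (fun z => pd 0 f z * pd 0 f z) (openTriangle v) :=
    hint ((c1 0).mul (c1 0))
  have i2 : IntegrableOn (fun z : Plane => z 0 * pd 1 f z * f z) (openTriangle v) :=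
    hint (((by fun_prop : Continuous fun z : Plane => z 0).mul (c1 1)).mul c0)
  have i3 : IntegrableOn (fun z => (fun j => pd j (pd 0 f) z) ⬝ᵥ
      (matA α β γ *ᵥ fun j => pd j (pd 0 f) z)) (openTriangle v) := by
    simp only [matA_dotProduct]
    exact hint (by fun_prop)
  have i4 : IntegrableOn (fun z => (fun i => pd i (fun y => y 0 * pd 1 f y) z) ⬝ᵥ
      (matA α β γ *ᵥ fun i => pd i f z)) (openTriangle v) := by
    simp only [matA_dotProduct]
    exact hint (by fun_prop)
  have i5 : IntegrableOn (fun z => (fun i => pd i f z) ⬝ᵥ (matB α β ε *ᵥ fun i => pd i f z))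
      (openTriangle v) := by
    simp only [matB_dotProduct]
    exact hint (by fun_prop)
  have i6 : IntegrableOn (pd 1 (flux α β γ f)) (openTriangle v) := hint c4
  have hnn := sum_mul_integral_nonneg (μ := volume.restrict (openTriangle v))
    (c := ![1, 1, 1, -(1 / 2), -(1 / 2)]) (F := ![fun z => pd 0 f z * pd 0 f z,
      fun z => z 0 * pd 1 f z * f z,
      fun z => (fun i => pd i (fun y => y 0 * pd 1 f y) z) ⬝ᵥ (matA α β γ *ᵥ fun i => pd i f z),
      fun z => (fun i => pd i f z) ⬝ᵥ (matB α β ε *ᵥ fun i => pd i f z), pd 1 (flux α β γ f)])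
    (fun i => by fin_cases i; exacts [i1, i2, i4, i5, i6]) (ae_of_all _ fun z => ?_)
  · simp only [Fin.sum_univ_five, Matrix.cons_val] at hnn
    linarith
  · simp only [Fin.sum_univ_five, Matrix.cons_val]
    rw [pd_flux α β γ hf, matB_dotProduct]
    -- After the flux cancels, the integrand is f_x² + α f_x f_y + β f_y² minus half of ∇f·B∇f. The
    -- entries of B are such that this is exactly the perfect square displayed here.
    have e : ε * pd 0 f z ^ 2 + α * pd 0 f z * pd 1 f z + α ^ 2 / (4 * ε) * pd 1 f z ^ 2 =
        (ε * pd 0 f z + α / 2 * pd 1 f z) ^ 2 / ε := by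
      field_simp
      ring
    have h0 : 0 ≤ (ε * pd 0 f z + α / 2 * pd 1 f z) ^ 2 / ε := by positivity
    rw [← e] at h0
    have e2 : α ^ 2 / (2 * ε) = 2 * (α ^ 2 / (4 * ε)) := by field_simp; ring
    rw [e2]
    linarith

/-! ### The boundary terms -/

/-- Non-negativity of the quadratic form at ξ - (τ/4)η. The weight τ/4 is chosen so that a quarter
of the penalty remains after the half required by the norm. -/
lemma matA_young {α β γ : ℝ} (hA : (matA α β γ).PosSemidef) {τ : ℝ} (hτ : 0 < τ)
    (ξ η : Fin 2 → ℝ) : (matA α β γ *ᵥ ξ) ⬝ᵥ η + (matA α β γ *ᵥ ξ) ⬝ᵥ η ≤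
      τ / 4 * (η ⬝ᵥ (matA α β γ *ᵥ η)) + 4 / τ * (ξ ⬝ᵥ (matA α β γ *ᵥ ξ)) := by
  have h := (IsSqSeminorm.matrix hA).nonneg (ξ - (τ / 4) • η)
  have h2 := mul_nonneg (by positivity : 0 ≤ 4 / τ) h
  rw [dotProduct_comm (matA α β γ *ᵥ ξ) η]
  simp only [matA_dotProduct, Pi.sub_apply, Pi.smul_apply, smul_eq_mul] at h2 ⊢
  have e : 4 / τ * (α * (ξ 0 - τ / 4 * η 0) * (ξ 0 - τ / 4 * η 0) +
      β * ((ξ 0 - τ / 4 * η 0) * (ξ 1 - τ / 4 * η 1) + (ξ 1 - τ / 4 * η 1) * (ξ 0 - τ / 4 * η 0)) +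
      γ * (ξ 1 - τ / 4 * η 1) * (ξ 1 - τ / 4 * η 1)) =
      τ / 4 * (α * η 0 * η 0 + β * (η 0 * η 1 + η 1 * η 0) + γ * η 1 * η 1) +
      4 / τ * (α * ξ 0 * ξ 0 + β * (ξ 0 * ξ 1 + ξ 1 * ξ 0) + γ * ξ 1 * ξ 1) -
      2 * (α * η 0 * ξ 0 + β * (η 0 * ξ 1 + η 1 * ξ 0) + γ * η 1 * ξ 1) := by
    field_simp
    ring
  linarith

namespace Triangulation

variable {Ω : Set Plane} {𝒯 : Triangulation Ω} {w : Plane → ℝ} {f : Fin 𝒯.card → Plane → ℝ}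
  {α β γ : ℝ} {τ : Plane → ℝ} {z : Plane}

/-- The density of the first integral of the stabilisation form. -/
def flowDensity (𝒯 : Triangulation Ω) (A : Matrix (Fin 2) (Fin 2) ℝ) (w : Plane → ℝ)
    (z : Plane) : ℝ :=
  z 0 * (∑ i, ∑ j, (A i j * 𝒯.avg (𝒯.bdPD j w) z) • 𝒯.jump (𝒯.bdPD i w) z) 1

/-- The density of the second integral of the stabilisation form. -/
def faceDensity (𝒯 : Triangulation Ω) (A : Matrix (Fin 2) (Fin 2) ℝ) (τ w : Plane → ℝ)
    (z : Plane) : ℝ :=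
  (A *ᵥ 𝒯.avgGradx w z) ⬝ᵥ 𝒯.jump1Grad w z + (A *ᵥ 𝒯.avgGradx w z) ⬝ᵥ 𝒯.jump1Grad w z -
    τ z * (𝒯.jump1Grad w z ⬝ᵥ (A *ᵥ 𝒯.jump1Grad w z))

/-- The part of the face terms that is absorbed by the second derivatives. -/
def absorbedDensity (𝒯 : Triangulation Ω) (A : Matrix (Fin 2) (Fin 2) ℝ) (τ w : Plane → ℝ)
    (z : Plane) : ℝ :=
  4 / τ z * (𝒯.avgGradx w z ⬝ᵥ (A *ᵥ 𝒯.avgGradx w z))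

/-- The sum of the energy fluxes out of the elements at a point of the skeleton. -/
def fluxSum (𝒯 : Triangulation Ω) (α β γ : ℝ) (f : Fin 𝒯.card → Plane → ℝ) (z : Plane) : ℝ :=
  ∑ k ∈ 𝒯.elemsAt z, flux α β γ (f k) z * outerNormal (𝒯.elem k) z 1

lemma flowDensity_eq : 𝒯.flowDensity (matA α β γ) w z = z 0 *
    ((fun i => 𝒯.jump (𝒯.bdPD i w) z 1) ⬝ᵥ (matA α β γ *ᵥ fun j => 𝒯.avg (𝒯.bdPD j w) z)) := by
  rw [flowDensity, matA_dotProduct]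
  congr 1
  simp [Fin.sum_univ_two, matA]
  ring

/-- Of the penalty, one half goes to the norm and one quarter to the cross terms. The last quarter
is kept on the right, for use on ∂₀Ω. -/
lemma faceDensity_add_jumpDensity_le (hA : (matA α β γ).PosSemidef) (hτ : 0 < τ z) :
    𝒯.faceDensity (matA α β γ) τ w z + 1 / 2 * 𝒯.jumpDensity (matA α β γ) τ w z ≤
      𝒯.absorbedDensity (matA α β γ) τ w z -
        τ z / 4 * (𝒯.jump1Grad w z ⬝ᵥ (matA α β γ *ᵥ 𝒯.jump1Grad w z)) := by
  have := matA_young hA hτ (𝒯.avgGradx w z) (𝒯.jump1Grad w z)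
  rw [faceDensity, jumpDensity, absorbedDensity]
  linarith

/-- On an interior face the fluxes of the energy cancel against the stabilisation. -/
lemma density_interior {k l : Fin 𝒯.card} (hkl : k ≠ l) (he : 𝒯.elemsAt z = {k, l})
    (hN : outerNormal (𝒯.elem l) z = - outerNormal (𝒯.elem k) z) (hf : f k z = f l z)
    (hg : ∀ i, ∀ m ∈ 𝒯.elemsAt z, 𝒯.bdPD i w m z = pd i (f m) z) :
    1 / 2 * 𝒯.fluxSum α β γ f z = 𝒯.flowDensity (matA α β γ) w z := by
  rw [flowDensity_eq]
  simp only [jump_congr (hg _), avg_congr (hg _), jump_apply]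
  simp only [avg, fluxSum, he, Finset.sum_pair hkl, Finset.card_pair hkl, hN, hf, flux,
    matA_dotProduct, PiLp.neg_apply]
  push_cast
  ring

/-- Where `w` vanishes only the gradient part of the flux remains. The first identity serves ∂₋Ω,
the second both ∂₋Ω and ∂₀Ω. -/
lemma density_minus {k : Fin 𝒯.card} (he : 𝒯.elemsAt z = {k})
    (hf : f k z = 0) (hg : ∀ i, ∀ m ∈ 𝒯.elemsAt z, 𝒯.bdPD i w m z = pd i (f m) z) :
    𝒯.fluxSum α β γ f z = 𝒯.flowDensity (matA α β γ) w z ∧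
    𝒯.fluxSum α β γ f z = z 0 * outerNormal (𝒯.elem k) z 1 *
      ((fun i => pd i (f k) z) ⬝ᵥ (matA α β γ *ᵥ fun i => pd i (f k) z)) := by
  rw [flowDensity_eq]
  simp only [jump_congr (hg _), avg_congr (hg _), jump_apply]
  simp only [avg, fluxSum, he, Finset.sum_singleton, Finset.card_singleton, hf, flux,
    matA_dotProduct]
  push_cast
  constructor <;> ring

lemma density_plus {k : Fin 𝒯.card} (he : 𝒯.elemsAt z = {k})
    (hN : outerNormal Ω z = outerNormal (𝒯.elem k) z) (hf : bdTrace Ω w z = f k z)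
    (hg : ∀ i, ∀ m ∈ 𝒯.elemsAt z, 𝒯.bdPD i w m z = pd i (f m) z) :
    𝒯.fluxSum α β γ f z = 𝒯.outDensity w z + 𝒯.outGradDensity (matA α β γ) w z := by
  simp only [outDensity, outGradDensity, avgGrad, matA_dotProduct, avg_congr (hg _)]
  simp only [avg, fluxSum, he, Finset.sum_singleton, Finset.card_singleton, hf, flux, hN,
    matA_dotProduct]
  push_cast
  ring

lemma jump1Grad_zero {k : Fin 𝒯.card} (he : 𝒯.elemsAt z = {k})
    (hg : ∀ i, ∀ m ∈ 𝒯.elemsAt z, 𝒯.bdPD i w m z = pd i (f m) z) :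
    𝒯.jump1Grad w z ⬝ᵥ (matA α β γ *ᵥ 𝒯.jump1Grad w z) = outerNormal (𝒯.elem k) z 0 ^ 2 *
      ((fun i => pd i (f k) z) ⬝ᵥ (matA α β γ *ᵥ fun i => pd i (f k) z)) := by
  simp only [jump1Grad, matA_dotProduct, jump1_congr (hg _)]
  simp only [jump1, he, Finset.sum_singleton]
  ring

lemma meshSize_pos (𝒯 : Triangulation Ω) (k : Fin 𝒯.card) : 0 < 𝒯.meshSize k := by
  refine lt_of_le_of_ne Metric.diam_nonneg fun h => ?_
  have hs : (𝒯.elem k).Subsingleton := by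
    intro x hx y hy
    have := Metric.dist_le_diam_of_mem (𝒯.isBounded_elem k) hx hy
    rw [← meshSize, ← h] at this
    exact dist_le_zero.1 this
  exact ((𝒯.isOpen_elem k).measure_pos volume
    (openTriangle_nonempty (𝒯.nondegenerate k))).ne' (hs.measure_zero _)

lemma avg_meshSize_pos (hz : z ∈ 𝒯.skeleton) : 0 < 𝒯.avg (fun k _ => 𝒯.meshSize k) z := by
  obtain ⟨k, hk⟩ := mem_skeleton.1 hz
  have hne : (𝒯.elemsAt z).Nonempty := ⟨k, mem_elemsAt.2 hk⟩
  exact div_pos (Finset.sum_pos (fun k _ => 𝒯.meshSize_pos k) hne)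
    (Nat.cast_pos.2 hne.card_pos)

lemma penalty_pos {Cτ : ℝ} (hC : 0 < Cτ) {p : ℕ} (hp : p ≠ 0) (hz : z ∈ 𝒯.skeleton) :
    0 < 𝒯.penalty Cτ p z :=
  div_pos (mul_pos hC (by positivity)) (avg_meshSize_pos hz)

lemma bdryZero_subset_frontier : bdryZero Ω ⊆ frontier Ω := fun _ hz => hz.1

lemma bdryMinus_subset_frontier : bdryMinus Ω ⊆ frontier Ω := fun _ hz => hz.1.1

/-- The boundary terms of the energy balance at a point of the skeleton. -/
lemma density_nonneg (hΩ : IsPolygonalDomain Ω) (hA : (matA α β γ).PosSemidef)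
    (hz : z ∉ 𝒯.vertices) (hτ : z ∈ 𝒯.skeleton → 0 < τ z)
    (hτ0 : z ∈ bdryZero Ω → 2 * |z 0| ≤ τ z * outerNormal Ω z 0 ^ 2)
    (hg : ∀ i, ∀ m ∈ 𝒯.elemsAt z, 𝒯.bdPD i w m z = pd i (f m) z)
    (hf : ∀ k ∈ 𝒯.elemsAt z, ∀ l ∈ 𝒯.elemsAt z, f k z = f l z)
    (ht : z ∈ frontier Ω → ∀ k ∈ 𝒯.elemsAt z, bdTrace Ω w z = f k z)
    (h0 : z ∈ bdryMinusZero Ω → bdTrace Ω w z = 0) :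
    0 ≤ 1 / 2 * 𝒯.skeleton.indicator (𝒯.fluxSum α β γ f) z
      - (𝒯.interiorSkeleton ∪ bdryMinus Ω).indicator (𝒯.flowDensity (matA α β γ) w) z
      - (𝒯.interiorSkeleton ∪ bdryZero Ω).indicator (𝒯.faceDensity (matA α β γ) τ w) z
      - 1 / 2 * (bdryPlus Ω).indicator (𝒯.outDensity w) z
      - 1 / 2 * (bdryPlus Ω).indicator (𝒯.outGradDensity (matA α β γ) w) z
      - 1 / 2 * (𝒯.interiorSkeleton ∪ bdryZero Ω).indicator
        (𝒯.jumpDensity (matA α β γ) τ w) z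
      + (𝒯.interiorSkeleton ∪ bdryZero Ω).indicator
        (𝒯.absorbedDensity (matA α β γ) τ w) z := by
  classical
  have hQ : ∀ ξ : Fin 2 → ℝ, 0 ≤ ξ ⬝ᵥ (matA α β γ *ᵥ ξ) := (IsSqSeminorm.matrix hA).nonneg
  have hΓ : z ∈ 𝒯.interiorSkeleton ↔ z ∈ 𝒯.skeleton ∧ z ∉ frontier Ω := Iff.rfl
  have hm : z ∈ bdryMinus Ω ↔ (z ∈ frontier Ω ∧ z ∉ bdryZero Ω) ∧
    z 0 * outerNormal Ω z 1 < 0 := Iff.rfl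
  have hp : z ∈ bdryPlus Ω ↔ (z ∈ frontier Ω ∧ z ∉ bdryZero Ω) ∧
    0 ≤ z 0 * outerNormal Ω z 1 := Iff.rfl
  have hsub := @frontier_subset_skeleton Ω 𝒯 hΩ z
  have hz0 := @bdryZero_subset_frontier Ω z
  have hmz : z ∈ bdryMinusZero Ω ↔ z ∈ bdryMinus Ω ∨ z ∈ bdryZero Ω := Iff.rfl
  have hU1 : z ∈ 𝒯.interiorSkeleton ∪ bdryMinus Ω ↔
    z ∈ 𝒯.interiorSkeleton ∨ z ∈ bdryMinus Ω := Iff.rfl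
  have hU2 : z ∈ 𝒯.interiorSkeleton ∪ bdryZero Ω ↔
    z ∈ 𝒯.interiorSkeleton ∨ z ∈ bdryZero Ω := Iff.rfl
  simp only [indicator, hU1, hU2]
  by_cases hs : z ∈ 𝒯.skeleton
  swap
  · have h1 : z ∉ frontier Ω := fun h => hs (hsub h)
    have h2 : z ∉ bdryZero Ω := fun h => h1 (hz0 h)
    simp [hs, hΓ, hm, hp, h1, h2]
  have hτz := hτ hs
  have hface := faceDensity_add_jumpDensity_le (𝒯 := 𝒯) (w := w) hA hτz
  by_cases hzΩ : z ∈ frontier Ω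
  swap
  · have h2 : z ∉ bdryZero Ω := fun h => hzΩ (hz0 h)
    obtain ⟨k, l, hkl, he, hN⟩ := exists_elemsAt_eq_pair hΩ hz (hΓ.2 ⟨hs, hzΩ⟩)
    have hkl' := hf k (by simp [he]) l (by simp [he])
    have hd := density_interior (α := α) (β := β) (γ := γ) hkl he hN hkl' hg
    -- On an interior face the fluxes cancel exactly, and the remaining quarter of the penalty is
    -- discarded as non-negative.
    have := mul_nonneg (by positivity : 0 ≤ τ z / 4) (hQ (𝒯.jump1Grad w z))
    simp only [hs, hΓ, hm, hp, hzΩ, h2, if_true, if_false, not_false_eq_true, and_self,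
      false_and, or_false]
    linarith
  obtain ⟨k, he, hN, -⟩ := exists_elemsAt_eq_singleton (𝒯 := 𝒯) hΩ hz hzΩ
  have hk : k ∈ 𝒯.elemsAt z := by simp [he]
  by_cases hb0 : z ∈ bdryZero Ω
  · have hfk : f k z = 0 := by rw [← ht hzΩ k hk, h0 (hmz.2 (Or.inr hb0))]
    have hd := (density_minus (α := α) (β := β) (γ := γ) he hfk hg).2
    rw [jump1Grad_zero he hg, ← hN] at hface
    rw [← hN] at hd
    set Q := (fun i => pd i (f k) z) ⬝ᵥ (matA α β γ *ᵥ fun i => pd i (f k) z) with hQdef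
    have hQ0 : 0 ≤ Q := hQ _
    have h1 : - |z 0| ≤ z 0 * outerNormal Ω z 1 := by
      have : |z 0 * outerNormal Ω z 1| ≤ |z 0| := by
        rw [abs_mul]
        exact mul_le_of_le_one_right (abs_nonneg _) (abs_outerNormal_le _ _ _)
      linarith [neg_abs_le (z 0 * outerNormal Ω z 1)]
    -- On ∂₀Ω half the flux is x n₂ Q/2, at least -|x| Q/2. The remaining quarter of the penalty is
    -- τ n₁² Q/4, and the hypothesis on τ makes it at least |x| Q/2.
    have h2 : 0 ≤ (τ z * outerNormal Ω z 0 ^ 2 / 4 + z 0 * outerNormal Ω z 1 / 2) * Q :=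
      mul_nonneg (by linarith [hτ0 hb0]) hQ0
    simp only [hs, hΓ, hm, hp, hzΩ, hb0, if_true, if_false, not_true_eq_false, and_false,
      false_and, or_false, or_true]
    linarith
  · by_cases hsign : z 0 * outerNormal Ω z 1 < 0
    · have hfk : f k z = 0 := by
        rw [← ht hzΩ k hk, h0 (hmz.2 (Or.inl (hm.2 ⟨⟨hzΩ, hb0⟩, hsign⟩)))]
      obtain ⟨hd, hd'⟩ := density_minus (α := α) (β := β) (γ := γ) he hfk hg
      rw [← hN] at hd'
      -- On ∂₋Ω the stabilisation equals the whole flux, of which the energy supplies only half; the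
      -- difference is minus half the flux, non-negative as x n₂ < 0.
      have := mul_nonpos_of_nonpos_of_nonneg hsign.le
        (hQ fun i => pd i (f k) z)
      simp only [hs, hΓ, hm, hp, hzΩ, hb0, hsign, hsign.not_ge, if_true, if_false,
        not_true_eq_false, not_false_eq_true, and_false, and_self, or_false, or_true]
      linarith
    · have hd := density_plus (α := α) (β := β) (γ := γ) he hN (ht hzΩ k hk) hg
      simp only [hs, hΓ, hm, hp, hzΩ, hb0, hsign, not_lt.1 hsign, if_true, if_false,
        not_true_eq_false, not_false_eq_true, and_false, and_self, or_false]
      linarith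

end Triangulation

/-! ### The energy balance on the skeleton -/

namespace Triangulation

variable {Ω : Set Plane} {𝒯 : Triangulation Ω} {w : Plane → ℝ} {f : Fin 𝒯.card → Plane → ℝ}
  {α β γ : ℝ}

lemma integrableOn_fluxSum (hf : ∀ k, ContDiff ℝ ∞ (f k)) :
    Integrable (𝒯.fluxSum α β γ f) arcLength :=
  integrableOn_sum_elemsAt fun k => integrableOn_mul_outerNormal (𝒯.nondegenerate k)
    (integrableOn_frontier_of_continuous (𝒯.nondegenerate k)
      (contDiff_flux α β γ (hf k)).continuous) 1

lemma integrableOn_flowDensity (h : 𝒯.MemBrokenH2 w) :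
    IntegrableOn (𝒯.flowDensity (matA α β γ) w) 𝒯.skeleton arcLength := by
  obtain ⟨R, -, hR⟩ := 𝒯.exists_norm_le
  have e : 𝒯.flowDensity (matA α β γ) w = _ := funext fun z => flowDensity_eq
  rw [e]
  exact integrable_mul_dotProduct (Continuous.aestronglyMeasurable (by fun_prop))
    ((ae_restrict_mem measurableSet_skeleton).mono fun z hz =>
      (abs_coord_le_norm z 0).trans (hR z hz))
    (fun i => ((h.memBdL2 i).jump 1).restrict _) (fun i => (h.memBdL2 i).avg.restrict _) _

lemma IsPiecewise.memLp_avgGradx (h : 𝒯.IsPiecewise w f) (j : Fin 2) :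
    MemLp (fun z => 𝒯.avgGradx w z j) 2 arcLength := by
  have hc : 𝒯.MemBdL2 (fun k => pd j (pd 0 (f k))) :=
    memBdL2_of_continuous fun k => continuous_pd (contDiff_pd (h.contDiff k))
  refine (memLp_congr_ae ?_).1 hc.avg
  filter_upwards [h.bdPDx_eq j] with z hz using (avg_congr hz).symm

lemma IsPiecewise.integrable_faceDensity (h : 𝒯.IsPiecewise w f)
    (A : Matrix (Fin 2) (Fin 2) ℝ) (Cτ : ℝ) (p : ℕ) :
    Integrable (𝒯.faceDensity A (𝒯.penalty Cτ p) w) arcLength := by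
  have h1 := integrable_mul_dotProduct (μ := arcLength) (m := fun _ => 1) (C := 1)
    aestronglyMeasurable_const (ae_of_all _ fun _ => by simp)
    h.memBrokenH2.memLp_jump1Grad h.memLp_avgGradx A
  simp only [one_mul, dotProduct_comm (𝒯.jump1Grad w _)] at h1
  have h2 : Integrable (𝒯.jumpDensity A (𝒯.penalty Cτ p) w) arcLength :=
    integrable_jumpDensity h.memBrokenH2 Cτ p
  exact (h1.add h1).sub h2

lemma IsPiecewise.integrable_absorbedDensity (h : 𝒯.IsPiecewise w f)
    (A : Matrix (Fin 2) (Fin 2) ℝ) (Cτ : ℝ) (p : ℕ) :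
    Integrable (𝒯.absorbedDensity A (𝒯.penalty Cτ p) w) arcLength := by
  have hb : ∀ z, |𝒯.avg (fun k _ => 𝒯.meshSize k) z| ≤ ∑ k, 𝒯.meshSize k := fun z =>
    abs_avg_le (Finset.sum_nonneg fun k _ => (𝒯.meshSize_pos k).le) fun k _ => by
      rw [abs_of_pos (𝒯.meshSize_pos k)]
      exact Finset.single_le_sum (f := 𝒯.meshSize) (fun l _ => (𝒯.meshSize_pos l).le)
        (Finset.mem_univ k)
  refine integrable_mul_dotProduct (C := |4 / (Cτ * p ^ 2)| * ∑ k, 𝒯.meshSize k) ?_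
    (ae_of_all _ fun z => ?_) h.memLp_avgGradx h.memLp_avgGradx A
  · exact (aemeasurable_const.div
      (aestronglyMeasurable_penalty Cτ p).aemeasurable).aestronglyMeasurable
  · rw [penalty, div_div_eq_mul_div, mul_div_right_comm, abs_mul]
    gcongr
    exact hb z

/-- For large penalty parameters the penalty dominates the boundary terms on `∂₀Ω`. -/
lemma exists_le_penalty_mul (hΩ : IsPolygonalDomain Ω) (𝒯₀ : Triangulation Ω) :
    ∃ C, 0 < C ∧ ∀ (𝒯 : Triangulation Ω) (Cτ : ℝ) (p : ℕ), C ≤ Cτ → p ≠ 0 →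
      -- The bound must not depend on the mesh under consideration. The auxiliary triangulation only
      -- shows that the normal of Ω takes finitely many values off a null set, and the resulting δ
      -- belongs to Ω.
      ∀ᵐ z ∂arcLength, z ∈ bdryZero Ω →
        2 * |z 0| ≤ 𝒯.penalty Cτ p z * outerNormal Ω z 0 ^ 2 := by
  obtain ⟨δ, hδ, hn⟩ := 𝒯₀.exists_le_abs_outerNormal hΩ
  obtain ⟨R, hR0, hR⟩ := hΩ.isBounded.closure.exists_pos_norm_le
  set D := Metric.diam Ω + 1 with hD
  have hD0 : 0 < D := by positivity
  -- Mesh sizes are at most D and p ≥ 1, so the penalty is at least Cτ/D. With |x| ≤ R and |n₁| ≥ δ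
  -- it is enough that Cτ δ²/D ≥ 2R.
  refine ⟨2 * R * D / δ ^ 2, by positivity, fun 𝒯 Cτ p hC hp => ?_⟩
  rw [ae_restrict_iff' isClosed_frontier.measurableSet] at hn
  filter_upwards [hn] with z hz hz0
  have hδz := hz hz0.1 hz0.2
  have hCτ : 0 < Cτ := lt_of_lt_of_le (by positivity) hC
  have hs : z ∈ 𝒯.skeleton := frontier_subset_skeleton hΩ hz0.1
  have hh0 := avg_meshSize_pos hs
  have hhD : 𝒯.avg (fun k _ => 𝒯.meshSize k) z ≤ D := by
    refine (le_abs_self _).trans (abs_avg_le hD0.le fun k _ => ?_)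
    rw [abs_of_pos (𝒯.meshSize_pos k)]
    exact (Metric.diam_mono (𝒯.elem_subset hΩ k) hΩ.isBounded).trans (by linarith)
  have hp1 : (1 : ℝ) ≤ (p : ℝ) ^ 2 := by
    have : (1 : ℝ) ≤ p := by exact_mod_cast Nat.one_le_iff_ne_zero.2 hp
    nlinarith
  have h1 : 2 * R * D ≤ Cτ * δ ^ 2 := by rwa [div_le_iff₀ (by positivity)] at hC
  have h2 : Cτ / D ≤ 𝒯.penalty Cτ p z := by
    rw [penalty, div_le_div_iff₀ hD0 hh0]
    nlinarith [mul_le_mul_of_nonneg_left hhD hCτ.le, mul_le_mul_of_nonneg_left hp1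
      (mul_pos hCτ hD0).le]
  have h3 : δ ^ 2 ≤ outerNormal Ω z 0 ^ 2 := by
    rw [← sq_abs (outerNormal Ω z 0)]
    gcongr
  calc 2 * |z 0| ≤ 2 * R := by
        have := (abs_coord_le_norm z 0).trans (hR z (frontier_subset_closure hz0.1))
        linarith
    _ ≤ Cτ / D * δ ^ 2 := by
        rw [div_mul_eq_mul_div, le_div_iff₀ hD0]
        exact h1
    _ ≤ 𝒯.penalty Cτ p z * outerNormal Ω z 0 ^ 2 :=
        mul_le_mul h2 h3 (sq_nonneg _) (penalty_pos hCτ hp hs).le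

lemma measurableSet_bdryMinusZero (𝒯 : Triangulation Ω) (hΩ : IsPolygonalDomain Ω) :
    MeasurableSet (bdryMinusZero Ω) :=
  (measurableSet_bdryMinus 𝒯 hΩ).union (measurableSet_bdryZero 𝒯 hΩ)

/-- The pointwise inequality `density_nonneg` integrated over the plane. Indicators bring integrals
over different parts of the skeleton to a common domain. -/
lemma IsPiecewise.skeleton_balance (h : 𝒯.IsPiecewise w f) (hΩ : IsPolygonalDomain Ω)
    (hw : MemH1MinusZero Ω w) (hA : (matA α β γ).PosSemidef) {Cτ : ℝ} (hC : 0 < Cτ) {p : ℕ}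
    (hp : p ≠ 0) (hτ : ∀ᵐ z ∂arcLength, z ∈ bdryZero Ω →
      2 * |z 0| ≤ 𝒯.penalty Cτ p z * outerNormal Ω z 0 ^ 2) :
    0 ≤ 1 / 2 * (∑ k, ∫ z in frontier (𝒯.elem k),
          flux α β γ (f k) z * outerNormal (𝒯.elem k) z 1 ∂arcLength)
      - (∫ z in 𝒯.interiorSkeleton ∪ bdryMinus Ω, 𝒯.flowDensity (matA α β γ) w z ∂arcLength)
      - (∫ z in 𝒯.interiorSkeleton ∪ bdryZero Ω,
          𝒯.faceDensity (matA α β γ) (𝒯.penalty Cτ p) w z ∂arcLength)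
      - 1 / 2 * (∫ z in bdryPlus Ω, 𝒯.outDensity w z ∂arcLength)
      - 1 / 2 * (∫ z in bdryPlus Ω, 𝒯.outGradDensity (matA α β γ) w z ∂arcLength)
      - 1 / 2 * (∫ z in 𝒯.interiorSkeleton ∪ bdryZero Ω,
          𝒯.jumpDensity (matA α β γ) (𝒯.penalty Cτ p) w z ∂arcLength)
      + ∫ z in 𝒯.interiorSkeleton ∪ bdryZero Ω,
          𝒯.absorbedDensity (matA α β γ) (𝒯.penalty Cτ p) w z ∂arcLength := by
  have hB := h.memBrokenH2
  have m0 := measurableSet_bdryZero 𝒯 hΩ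
  have mm := measurableSet_bdryMinus 𝒯 hΩ
  have mp := measurableSet_bdryPlus 𝒯 hΩ
  have mi := measurableSet_interiorSkeleton (𝒯 := 𝒯)
  have s1 : 𝒯.interiorSkeleton ∪ bdryMinus Ω ⊆ 𝒯.skeleton :=
    union_subset (fun _ hz => hz.1)
      (bdryMinus_subset_frontier.trans (frontier_subset_skeleton hΩ))
  have hsum := sum_setIntegral_frontier (𝒯 := 𝒯)
    (F := fun k z => flux α β γ (f k) z * outerNormal (𝒯.elem k) z 1) fun k =>
      integrableOn_mul_outerNormal (𝒯.nondegenerate k)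
        (integrableOn_frontier_of_continuous (𝒯.nondegenerate k)
          (contDiff_flux α β γ (h.contDiff k)).continuous) 1
  rw [hsum]
  have hnn := sum_mul_integral_nonneg (μ := arcLength)
    (c := ![1 / 2, -1, -1, -(1 / 2), -(1 / 2), -(1 / 2), 1])
    (F := ![𝒯.skeleton.indicator (𝒯.fluxSum α β γ f),
      (𝒯.interiorSkeleton ∪ bdryMinus Ω).indicator (𝒯.flowDensity (matA α β γ) w),
      (𝒯.interiorSkeleton ∪ bdryZero Ω).indicator
        (𝒯.faceDensity (matA α β γ) (𝒯.penalty Cτ p) w),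
      (bdryPlus Ω).indicator (𝒯.outDensity w),
      (bdryPlus Ω).indicator (𝒯.outGradDensity (matA α β γ) w),
      (𝒯.interiorSkeleton ∪ bdryZero Ω).indicator
        (𝒯.jumpDensity (matA α β γ) (𝒯.penalty Cτ p) w),
      (𝒯.interiorSkeleton ∪ bdryZero Ω).indicator
        (𝒯.absorbedDensity (matA α β γ) (𝒯.penalty Cτ p) w)]) ?_ ?_
  · simp only [Fin.sum_univ_seven, Matrix.cons_val, integral_indicator measurableSet_skeleton,
      integral_indicator (mi.union mm), integral_indicator (mi.union m0),
      integral_indicator mp] at hnn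
    unfold fluxSum at hnn
    linarith
  · intro i
    fin_cases i
    · exact (integrableOn_fluxSum h.contDiff).indicator measurableSet_skeleton
    · exact (integrable_indicator_iff (mi.union mm)).2 ((integrableOn_flowDensity hB).mono_set s1)
    · exact (h.integrable_faceDensity _ Cτ p).indicator (mi.union m0)
    · exact (integrable_indicator_iff mp).2
        ((integrableOn_outDensity hΩ ⟨_, hw.isTrace⟩).mono_set bdryPlus_subset_frontier)
    · exact (integrable_indicator_iff mp).2
        ((integrableOn_outGradDensity hΩ hB).mono_set bdryPlus_subset_frontier)
    · exact (integrable_jumpDensity hB Cτ p).indicator (mi.union m0)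
    · exact (h.integrable_absorbedDensity _ Cτ p).indicator (mi.union m0)
  · have ht0 := (ae_restrict_iff' (measurableSet_bdryMinusZero 𝒯 hΩ)).1
      (hw.bdTrace_eq_zero (hasTraceInequality_domain 𝒯 hΩ))
    filter_upwards [𝒯.ae_notMem_vertices, hτ, h.bdPD_eq 0, h.bdPD_eq 1,
      h.eq_of_mem_elemsAt hΩ hw, h.bdTrace_eq hΩ hw, ht0] with z hv hτz hg0 hg1 hf ht h0
    have := density_nonneg (w := w) (α := α) (β := β) (γ := γ) hΩ hA hv
      (fun hz => penalty_pos hC hp hz) hτz (fun i => by fin_cases i; exacts [hg0, hg1]) hf ht h0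
    simp only [Fin.sum_univ_seven, Matrix.cons_val]
    linarith

end Triangulation

/-! ### Absorption of the face terms and coercivity -/

namespace Triangulation

variable {Ω : Set Plane} {𝒯 : Triangulation Ω} {w : Plane → ℝ} {f : Fin 𝒯.card → Plane → ℝ}
  {α β γ : ℝ}

/-- Elements that meet in a point of the skeleton are adjacent, up to a null set of points. -/
lemma ae_adjacent (𝒯 : Triangulation Ω) :
    ∀ᵐ z ∂arcLength, ∀ k ∈ 𝒯.elemsAt z, ∀ l ∈ 𝒯.elemsAt z, k ≠ l → 𝒯.Adjacent k l := by
  have h : ∀ k l, ∀ᵐ z ∂arcLength, z ∈ frontier (𝒯.elem k) ∩ frontier (𝒯.elem l) →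
      k ≠ l → 𝒯.Adjacent k l := by
    intro k l
    by_cases hpos : 0 < arcLength (frontier (𝒯.elem k) ∩ frontier (𝒯.elem l))
    · exact ae_of_all _ fun z _ hkl => ⟨hkl, hpos⟩
    · filter_upwards [measure_eq_zero_iff_ae_notMem.1 (nonpos_iff_eq_zero.1 (not_lt.1 hpos))] with z hz hz'
      exact absurd hz' hz
  filter_upwards [ae_all_iff.2 fun k => ae_all_iff.2 (h k)] with z hz k hk l hl
    using hz k l ⟨mem_elemsAt.1 hk, mem_elemsAt.1 hl⟩

/-- Every element met at the point is `k` itself or adjacent to it. The factor 1 + |q| covers both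
cases without any assumption on the sign or size of q. -/
lemma avg_meshSize_le {q : ℝ} (hq : 𝒯.LocallyQuasiUniform q) {z : Plane}
    (hz : ∀ k ∈ 𝒯.elemsAt z, ∀ l ∈ 𝒯.elemsAt z, k ≠ l → 𝒯.Adjacent k l) {k : Fin 𝒯.card}
    (hk : k ∈ 𝒯.elemsAt z) :
    𝒯.avg (fun k _ => 𝒯.meshSize k) z ≤ (1 + |q|) * 𝒯.meshSize k := by
  have hpos := 𝒯.meshSize_pos k
  refine (le_abs_self _).trans (abs_avg_le (by positivity) fun l hl => ?_)
  rw [abs_of_pos (𝒯.meshSize_pos l)]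
  by_cases hlk : l = k
  · rw [hlk]
    nlinarith [abs_nonneg q]
  · have := hq l k (hz l hl k hk hlk)
    nlinarith [mul_le_mul_of_nonneg_right (le_abs_self q) hpos.le]

/-- A square of a seminorm of an average is at most the sum of its values. -/
lemma sqSeminorm_avg_le (hΩ : IsPolygonalDomain Ω) {Q : (Fin 2 → ℝ) → ℝ} (hQ : IsSqSeminorm Q)
    (φ : Fin 2 → Fin 𝒯.card → Plane → ℝ) {z : Plane} (hv : z ∉ 𝒯.vertices)
    (hz : z ∈ 𝒯.skeleton) :
    Q (fun j => 𝒯.avg (φ j) z) ≤ ∑ k ∈ 𝒯.elemsAt z, Q (fun j => φ j k z) := by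
  by_cases hzΩ : z ∈ frontier Ω
  · obtain ⟨k, he, -⟩ := exists_elemsAt_eq_singleton (𝒯 := 𝒯) hΩ hv hzΩ
    simp [avg, he]
  · obtain ⟨k, l, hkl, he, -⟩ := exists_elemsAt_eq_pair hΩ hv ⟨hz, hzΩ⟩
    have e : (fun j => 𝒯.avg (φ j) z) =
        (1 / 2 : ℝ) • ((fun j => φ j k z) + fun j => φ j l z) := by
      ext j
      simp [avg, he, Finset.sum_pair hkl, Finset.card_pair hkl]
      ring
    rw [e, hQ.smul, he, Finset.sum_pair hkl]
    have h1 := hQ.add_le (fun j => φ j k z) (fun j => φ j l z) 1 one_pos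
    have h2 := hQ.nonneg fun j => φ j k z
    have h3 := hQ.nonneg fun j => φ j l z
    norm_num at h1 ⊢
    linarith

/-- Averages are bounded by sums over the elements, 1/τ is of order h/(Cτ p²) by quasi-uniformity,
and the trace inequality for polynomials exchanges h times a boundary integral for p² times an area
integral. The powers of p cancel, which makes the threshold for Cτ independent of the degree. -/
lemma IsPiecewise.integral_absorbedDensity_le (hΩ : IsPolygonalDomain Ω)
    {P : Fin 𝒯.card → MvPolynomial (Fin 2) ℝ}
    (h : 𝒯.IsPiecewise w fun k => polyFun (P k)) {σ q : ℝ}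
    (hσ : 𝒯.ShapeRegular σ) (hq : 𝒯.LocallyQuasiUniform q) (hA : (matA α β γ).PosSemidef)
    {Cτ : ℝ} (hC : 0 < Cτ) (hC' : 384 * |σ| * (1 + |q|) ≤ Cτ) {p : ℕ} (hp : 1 ≤ p)
    (hP : ∀ k, (P k).totalDegree ≤ p) :
    ∫ z in 𝒯.interiorSkeleton ∪ bdryZero Ω,
        𝒯.absorbedDensity (matA α β γ) (𝒯.penalty Cτ p) w z ∂arcLength ≤
      1 / 2 * ∑ k, ∫ z in 𝒯.elem k, (fun j => pd j (pd 0 (polyFun (P k))) z) ⬝ᵥ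
        (matA α β γ *ᵥ fun j => pd j (pd 0 (polyFun (P k))) z) := by
  have hQ := IsSqSeminorm.matrix hA
  have hp0 : (0 : ℝ) < (p : ℝ) ^ 2 := by positivity
  -- At each element c h bounds 4/τ. The trace inequality multiplies c by 48|σ|p², and the result is
  -- at most 1/2 precisely when 384|σ|(1 + |q|) ≤ Cτ.
  set c := 4 * (1 + |q|) / (Cτ * p ^ 2) with hc
  have hc0 : 0 ≤ c := by positivity
  set F : Fin 𝒯.card → Plane → ℝ := fun k z => c * 𝒯.meshSize k *
    ((fun j => pd j (pd 0 (polyFun (P k))) z) ⬝ᵥ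
      (matA α β γ *ᵥ fun j => pd j (pd 0 (polyFun (P k))) z)) with hF
  have hF0 : ∀ k z, 0 ≤ F k z := fun k z =>
    mul_nonneg (mul_nonneg hc0 (𝒯.meshSize_pos k).le) (hQ.nonneg _)
  have hcont : ∀ k, Continuous (F k) := fun k => by
    have := fun j => continuous_pd (i := j) (contDiff_pd (i := 0) (h.contDiff k))
    simp only [hF, matA_dotProduct]
    fun_prop
  have hFi : ∀ k, IntegrableOn (F k) (frontier (𝒯.elem k)) arcLength := fun k =>
    integrableOn_frontier_of_continuous (𝒯.nondegenerate k) (hcont k)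
  have hS : 𝒯.interiorSkeleton ∪ bdryZero Ω ⊆ 𝒯.skeleton :=
    union_subset (fun _ hz => hz.1)
      (bdryZero_subset_frontier.trans (frontier_subset_skeleton hΩ))
  have hsumi := integrableOn_sum_elemsAt hFi
  have hle : ∀ᵐ z ∂(arcLength.restrict (𝒯.interiorSkeleton ∪ bdryZero Ω)),
      𝒯.absorbedDensity (matA α β γ) (𝒯.penalty Cτ p) w z ≤ ∑ k ∈ 𝒯.elemsAt z, F k z := by
    rw [ae_restrict_iff' (measurableSet_interiorSkeleton.union (measurableSet_bdryZero 𝒯 hΩ))]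
    filter_upwards [𝒯.ae_notMem_vertices, 𝒯.ae_adjacent, h.bdPDx_eq 0, h.bdPDx_eq 1]
      with z hv hadj h0 h1 hz
    have e : 𝒯.avgGradx w z =
        fun j => 𝒯.avg ((fun j k => pd j (pd 0 (polyFun (P k)))) j) z := by
      ext j
      fin_cases j
      · exact avg_congr h0
      · exact avg_congr h1
    have h2 := sqSeminorm_avg_le hΩ hQ (fun j k => pd j (pd 0 (polyFun (P k)))) hv (hS hz)
    rw [absorbedDensity, e]
    refine (mul_le_mul_of_nonneg_left h2
      (div_nonneg zero_le_four (penalty_pos hC (by lia) (hS hz)).le)).trans ?_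
    rw [Finset.mul_sum]
    refine Finset.sum_le_sum fun k hk => mul_le_mul_of_nonneg_right ?_ (hQ.nonneg _)
    rw [penalty, div_div_eq_mul_div, hc, div_mul_eq_mul_div]
    refine div_le_div_of_nonneg_right ?_ (by positivity)
    rw [mul_assoc]
    exact mul_le_mul_of_nonneg_left (avg_meshSize_le hq hadj hk) zero_le_four
  refine (integral_mono_ae (h.integrable_absorbedDensity _ Cτ p).integrableOn
    hsumi.integrableOn hle).trans ((setIntegral_mono_set hsumi.integrableOn (ae_of_all _ fun z =>
      Finset.sum_nonneg fun k _ => hF0 k z) hS.eventuallyLE).trans ?_)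
  rw [← sum_setIntegral_frontier hFi, Finset.mul_sum]
  refine Finset.sum_le_sum fun k _ => ?_
  have htr := polynomial_trace_inequality_matA (𝒯.nondegenerate k) (hσ k) hA hp
    (fun j => MvPolynomial.pderiv j (MvPolynomial.pderiv 0 (P k))) fun j =>
      (totalDegree_pderiv_le _ _).trans ((totalDegree_pderiv_le _ _).trans (hP k))
  simp only [← pd_polyFun] at htr
  have hI : 0 ≤ ∫ z in 𝒯.elem k, (fun j => pd j (pd 0 (polyFun (P k))) z) ⬝ᵥ
      (matA α β γ *ᵥ fun j => pd j (pd 0 (polyFun (P k))) z) :=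
    integral_nonneg fun z => hQ.nonneg _
  simp only [hF, mul_assoc c]
  rw [integral_const_mul, integral_const_mul]
  refine (mul_le_mul_of_nonneg_left htr hc0).trans ?_
  rw [← mul_assoc]
  refine mul_le_mul_of_nonneg_right ?_ hI
  rw [hc, div_mul_eq_mul_div, div_le_iff₀ (by positivity)]
  nlinarith [mul_le_mul_of_nonneg_right hC' hp0.le]

/-- The sum of three estimates: the volume terms on each element, the balance on the skeleton, and
the absorption of the averaged second derivatives. The rest of the proof replaces weak derivatives
by classical ones of the polynomial pieces. The form contains all of `s1` and half the squared norm
only half of it, so its non-negativity suffices. -/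
lemma IsPiecewise.coercive (hΩ : IsPolygonalDomain Ω)
    {P : Fin 𝒯.card → MvPolynomial (Fin 2) ℝ} (h : 𝒯.IsPiecewise w fun k => polyFun (P k))
    (hw : MemH1MinusZero Ω w) {σ q : ℝ}
    (hσ : 𝒯.ShapeRegular σ) (hq : 𝒯.LocallyQuasiUniform q) (hA : (matA α β γ).PosSemidef)
    {ε κ lam : ℝ} (hε : 0 < ε) (hκ : 0 ≤ κ) (hlam : 0 ≤ lam)
    {Cτ : ℝ} (hC : 0 < Cτ) (hC' : 384 * |σ| * (1 + |q|) ≤ Cτ) {p : ℕ} (hp : 1 ≤ p)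
    (hP : ∀ k, (P k).totalDegree ≤ p)
    (hτ : ∀ᵐ z ∂arcLength, z ∈ bdryZero Ω →
      2 * |z 0| ≤ 𝒯.penalty Cτ p z * outerNormal Ω z 0 ^ 2) :
    1 / 2 * 𝒯.tnormSq (matA α β γ) (matB α β ε) κ lam (𝒯.penalty Cτ p) w ≤
      𝒯.bilin (matA α β γ) κ lam (𝒯.penalty Cτ p) w w := by
  have hbal := h.skeleton_balance hΩ hw hA hC (by lia) hτ
  have habs := h.integral_absorbedDensity_le hΩ hσ hq hA hC hC' hp hP
  have hs1 := s1_nonneg (𝒯 := 𝒯) hκ hlam w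
  have hvol := Finset.sum_le_sum fun k (_ : k ∈ Finset.univ) =>
    le_volume_terms (𝒯.nondegenerate k) (h.contDiff k) α β γ hε
  simp only [Finset.sum_add_distrib, Finset.sum_sub_distrib, ← Finset.mul_sum] at hvol
  have hL : ∀ i, MemLp (wpd Ω i w) 2 (volume.restrict Ω) := hw.memH1.memL2_wpd
  have e1 : ∫ z in Ω, wpd Ω 0 w z * wpd Ω 0 w z =
      ∑ k, ∫ z in 𝒯.elem k, pd 0 (polyFun (P k)) z * pd 0 (polyFun (P k)) z := by
    have hi : IntegrableOn (fun z => wpd Ω 0 w z * wpd Ω 0 w z) Ω := (hL 0).integrable_mul (hL 0)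
    rw [𝒯.setIntegral_eq_sum_elem hΩ hi]
    refine Finset.sum_congr rfl fun k _ => integral_congr_ae ?_
    filter_upwards [h.wpd_domain_ae_eq hΩ hw.memH1 0 k] with z hz
    rw [hz]
  have e2 : ∫ z in Ω, z 0 * wpd Ω 1 w z * w z =
      ∑ k, ∫ z in 𝒯.elem k, z 0 * pd 1 (polyFun (P k)) z * polyFun (P k) z := by
    have hi : IntegrableOn (fun z => z 0 * wpd Ω 1 w z * w z) Ω := by
      obtain ⟨R, hR⟩ := hΩ.isBounded.exists_norm_le
      have h1 : Integrable (fun z => wpd Ω 1 w z * w z) (volume.restrict Ω) :=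
        (hL 1).integrable_mul hw.memH1.1
      have := h1.bdd_mul (c := R) (f := fun z : Plane => z 0)
        (Continuous.aestronglyMeasurable (by fun_prop))
        ((ae_restrict_mem hΩ.isOpen.measurableSet).mono fun z hz =>
          (abs_coord_le_norm z 0).trans (hR z hz))
      simp only [← mul_assoc] at this
      exact this
    rw [𝒯.setIntegral_eq_sum_elem hΩ hi]
    refine Finset.sum_congr rfl fun k _ => integral_congr_ae ?_
    filter_upwards [h.wpd_domain_ae_eq hΩ hw.memH1 1 k, h.ae_eq k] with z hz hz'
    rw [hz, hz']
  have hgrad : ∀ k, ∀ᵐ z ∂(volume.restrict (𝒯.elem k)),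
      wgrad (𝒯.elem k) w z = fun i => pd i (polyFun (P k)) z := fun k => by
    filter_upwards [h.wpd_ae_eq 0 k, h.wpd_ae_eq 1 k] with z h0 h1
    ext i
    fin_cases i; exacts [h0, h1]
  have hgradx : ∀ k, ∀ᵐ z ∂(volume.restrict (𝒯.elem k)),
      wgrad (𝒯.elem k) (wpd (𝒯.elem k) 0 w) z = fun j => pd j (pd 0 (polyFun (P k))) z :=
    fun k => by
      filter_upwards [h.wpd_wpd_ae_eq 0 0 k, h.wpd_wpd_ae_eq 0 1 k] with z h0 h1
      ext i
      fin_cases i; exacts [h0, h1]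
  have e3 : ∀ k, ∫ z in 𝒯.elem k, (matA α β γ *ᵥ wgrad (𝒯.elem k) (wpd (𝒯.elem k) 0 w) z) ⬝ᵥ
      wgrad (𝒯.elem k) (wpd (𝒯.elem k) 0 w) z = ∫ z in 𝒯.elem k,
      (matA α β γ *ᵥ fun j => pd j (pd 0 (polyFun (P k))) z) ⬝ᵥ
        fun j => pd j (pd 0 (polyFun (P k))) z := fun k => by
    refine integral_congr_ae ?_
    filter_upwards [hgradx k] with z hz
    rw [hz]
  have e4 : ∀ k, ∫ z in 𝒯.elem k, wgrad (𝒯.elem k) (fun y => y 0 * wpd (𝒯.elem k) 1 w y) z ⬝ᵥ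
      (matA α β γ *ᵥ wgrad (𝒯.elem k) w z) = ∫ z in 𝒯.elem k,
      (fun i => pd i (fun y => y 0 * pd 1 (polyFun (P k)) y) z) ⬝ᵥ
        (matA α β γ *ᵥ fun i => pd i (polyFun (P k)) z) := fun k => by
    refine integral_congr_ae ?_
    filter_upwards [hgrad k, h.wpd_transport_ae_eq 0 k, h.wpd_transport_ae_eq 1 k] with z hz h0 h1
    rw [hz]
    congr 1
    ext i
    fin_cases i; exacts [h0, h1]
  have e5 : ∫ z in Ω, 𝒯.gradDensity (matB α β ε) w z = ∑ k, ∫ z in 𝒯.elem k,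
      (fun i => pd i (polyFun (P k)) z) ⬝ᵥ
        (matB α β ε *ᵥ fun i => pd i (polyFun (P k)) z) := by
    rw [𝒯.setIntegral_eq_sum_elem hΩ (integrableOn_gradDensity hw.memH1)]
    refine Finset.sum_congr rfl fun k _ => integral_congr_ae ?_
    filter_upwards [h.wpd_domain_ae_eq hΩ hw.memH1 0 k, h.wpd_domain_ae_eq hΩ hw.memH1 1 k]
      with z h0 h1
    have : wgrad Ω w z = fun i => pd i (polyFun (P k)) z := by
      ext i
      fin_cases i; exacts [h0, h1]
    rw [gradDensity, this]
  have e6 : ∀ k, ∫ z in 𝒯.elem k, 𝒯.secondDensity (matA α β γ) w k z = ∫ z in 𝒯.elem k,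
      (fun j => pd j (pd 0 (polyFun (P k))) z) ⬝ᵥ
        (matA α β γ *ᵥ fun j => pd j (pd 0 (polyFun (P k))) z) := fun k => by
    refine integral_congr_ae ?_
    filter_upwards [hgradx k] with z hz
    rw [secondDensity, hz]
  rw [tnormSq, bilin, sh, e1, e2, e5, Finset.sum_congr rfl fun k _ => e3 k,
    Finset.sum_congr rfl fun k _ => e4 k, Finset.sum_congr rfl fun k _ => e6 k]
  unfold flowDensity faceDensity at hbal
  unfold elem at hbal habs hs1 ⊢
  linarith

lemma MemVh.exists_isPiecewise {p : ℕ} (h : 𝒯.MemVh p w) :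
    ∃ P : Fin 𝒯.card → MvPolynomial (Fin 2) ℝ,
      (∀ k, (P k).totalDegree ≤ p) ∧ 𝒯.IsPiecewise w fun k => polyFun (P k) := by
  choose P hP hw using h.2
  exact ⟨P, hP, fun k => contDiff_polyFun (P k), hw⟩

lemma tnormSq_nonneg (hΩ : IsPolygonalDomain Ω) {A B : Matrix (Fin 2) (Fin 2) ℝ}
    (hA : A.PosSemidef) (hB : B.PosSemidef)
    {κ lam Cτ : ℝ} (hκ : 0 ≤ κ) (hlam : 0 ≤ lam) (hC : 0 ≤ Cτ) (p : ℕ) (w : Plane → ℝ) :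
    0 ≤ 𝒯.tnormSq A B κ lam (𝒯.penalty Cτ p) w :=
  (integral_nonneg fun _ => (IsSqSeminorm.matrix hB).nonneg _).trans
    (integral_gradDensity_le_tnormSq (B := B) hΩ hA hκ hlam hC p w)

end Triangulation

end Kolmogorov

end

/-! ### Choice of the penalty threshold and conclusion. -/

theorem lemma2 (Ω : Set Plane) (hΩ : IsPolygonalDomain Ω)
    (hpos : 0 < arcLength (bdryMinusZero Ω)) (σ q : ℝ) :
    ∃ C₀ : ℝ, 0 < C₀ ∧ ∀ 𝒯 : Triangulation Ω, 𝒯.ShapeRegular σ → 𝒯.LocallyQuasiUniform q →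
      ∀ p : ℕ, 2 ≤ p → ∀ Cτ : ℝ, C₀ ≤ Cτ →
      ∀ α β γ ε κ lam : ℝ, 0 ≤ α → 0 ≤ β → 0 ≤ γ → (matA α β γ).PosSemidef →
        0 < ε → ε < 1 → (matB α β ε).PosDef → 0 ≤ κ → 0 ≤ lam →
        -- the mesh-dependent quantity is well defined and a norm on `H¹₋,₀(Ω) ∩ H²(Ω, 𝒯)`
        (∃ X : Submodule ℝ (Lp ℝ 2 (volume.restrict Ω)),
          (∀ w : Lp ℝ 2 (volume.restrict Ω),
            w ∈ X ↔ MemH1MinusZero Ω w ∧ 𝒯.MemBrokenH2 w) ∧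
          (∀ w ∈ X, 𝒯.TNormWellDefined (matA α β γ) (matB α β ε) κ lam (𝒯.penalty Cτ p) w) ∧
          ∃ N : AddGroupNorm X,
            (∀ w : X, N w = 𝒯.tnorm (matA α β γ) (matB α β ε) κ lam (𝒯.penalty Cτ p)
              (w : Lp ℝ 2 (volume.restrict Ω))) ∧
            ∀ (c : ℝ) (w : X), N (c • w) = |c| * N w) ∧
        -- coercivity on `V_h`
        ∀ w : Lp ℝ 2 (volume.restrict Ω), 𝒯.MemVh p w →
          1 / 2 * 𝒯.tnorm (matA α β γ) (matB α β ε) κ lam (𝒯.penalty Cτ p) w ^ 2 ≤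
            𝒯.bilin (matA α β γ) κ lam (𝒯.penalty Cτ p) w w := by
  -- A reference triangulation is needed to bound the normals of Ω before the mesh is quantified; if
  -- there is none, the claim is vacuous.
  by_cases hne : Nonempty (Triangulation Ω)
  swap
  · exact ⟨1, one_pos, fun 𝒯 => absurd ⟨𝒯⟩ hne⟩
  obtain ⟨𝒯₀⟩ := hne
  obtain ⟨C, hC0, hC⟩ := Triangulation.exists_le_penalty_mul hΩ 𝒯₀
  -- The first entry handles the flux through ∂₀Ω and depends on Ω, the second absorbs the face
  -- terms and depends on σ and q. Positivity comes from the first, since the second may be zero.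
  refine ⟨max C (384 * |σ| * (1 + |q|)), lt_max_of_lt_left hC0, ?_⟩
  intro 𝒯 hσ hq p hp Cτ hCτ α β γ ε κ lam _ _ _ hA hε _ hB hκ hlam
  have hCτC := (le_max_left _ _).trans hCτ
  have hCτ0 : 0 < Cτ := hC0.trans_le hCτC
  refine ⟨⟨𝒯.normSpace hΩ, fun w => Triangulation.mem_normSpace,
    fun w hw => Triangulation.tnormWellDefined hΩ hw.1 hw.2 κ lam Cτ p,
    Triangulation.exists_addGroupNorm hΩ hpos hA hB hκ hlam hCτ0.le p⟩, fun w hw => ?_⟩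
  obtain ⟨P, hP, hwP⟩ := hw.exists_isPiecewise
  rw [Triangulation.tnorm, Real.sq_sqrt
    (Triangulation.tnormSq_nonneg hΩ hA hB.posSemidef hκ hlam hCτ0.le p w)]
  exact hwP.coercive hΩ hw.1 hσ hq hA hε hκ hlam hCτ0 ((le_max_right _ _).trans hCτ) (by lia) hP
    (hC 𝒯 Cτ p hCτC (by lia))
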